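/- Let $M>0$ and $0\le a<M$, and consider the exterior region $r>r_+=M+\sqrt{M^2-a^2}$ of the subextremal Kerr spacetime (rotation axis included), with metric, in Boyer–Lindquist coordinates $(t,r,\phi,\theta)$, $$g=-\Big(1-\frac{2Mr}{\Sigma}\Big)dt^2-\frac{4Mar\sin^2\theta}{\Sigma}\,dt\,d\phi+\frac{\Sigma}{\Delta}dr^2+\Sigma\,d\theta^2+\frac{\sin^2\theta}{\Sigma}\big((r^2+a^2)^2-a^2\Delta\sin^2\theta\big)d\phi^2,$$ where $\Sigma=r^2+a^2\cos^2\theta$ and $\Delta=r^2-2Mr+a^2$, time-oriented by the timelike vector field $(r^2+a^2)\partial_t+a\,\partial_\phi$. The future event horizon $\mathcal H^+$ is the boundary hypersurface $r=r_+$ in ingoing Kerr coordinates $(t+r_*,\,r,\,\theta,\,\phi+r_\sharp)$, and future null infinity $\mathcal I^+$ is the boundary hypersurface $1/r=0$ in compactified outgoing Kerr coordinates $(t-r_*,\,1/r,\,\theta,\,\phi-r_\sharp)$, where $dr_*/dr=(r^2+a^2)/\Delta$ and $dr_\sharp/dr=a/\Delta$. Let $p$ be any point of the exterior region and let $(e_0,e_1,e_2,e_3)$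 be any observer at $p$, i.e. any orthonormal basis of the tangent space at $p$ with $e_0$ timelike and future directed. For $k=(k_1,k_2,k_3)\in S^2$ let $\gamma(k|_p)$ be the inextendible null geodesic of the exterior region through $p$ with tangent vector $e_0+k_1e_1+k_2e_2+k_3e_3$ at $p$. A geodesic is said to meet $\mathcal H^+$ (respectively $\mathcal I^+$) if, towards the future end of its parameter interval, it converges to a point of $\mathcal H^+$ (respectively $\mathcal I^+$) in the coordinates above. Let $$\Omega_{\mathcal H^+}(p)=\{k\in S^2:\gamma(k|_p)\text{ meets }\mathcal H^+\},\qquad \Omega_{\mathcal I^+}(p)=\{k\in S^2:\gamma(k|_p)\text{ meets }\mathcal I^+\},$$ $$\mathbb T_+(p)=\{k\in S^2:\gamma(k|_p)\text{ meets neither }\mathcal H^+\text{ nor }\mathcal I^+\}.$$ Then for every $k\in\mathbb T_+(p)$ and every $\varepsilon>0$, the ball $B_\varepsilon(k)\subset S^2$ satisfies $$B_\varepsilon(k)\cap\Omega_{\mathcal H^+}(p)\neq\emptyset\qquad\text{and}\qquad B_\varepsilon(k)\cap\Omega_{\mathcal I^+}(p)\neq\emptyset .$$ -/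

import Mathlib

open Filter Topology

namespace Kerr

/-! ### The exterior region and its metric

Events are quadruples `q = (t, x, y, z)`, related to Boyer-Lindquist coordinates `(t, r, φ, θ)` by
`x = r sin θ cos φ`, `y = r sin θ sin φ`, `z = r cos θ`.  This single chart covers the whole
exterior region, rotation axis included. -/

/-- The Boyer-Lindquist radius `r`. -/
noncomputable def radius (q : Fin 4 → ℝ) : ℝ := √(q 1 ^ 2 + q 2 ^ 2 + q 3 ^ 2)

/-- The radius of the event horizon. -/
noncomputable def rPlus (M a : ℝ) : ℝ := M + √(M ^ 2 - a ^ 2)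

/-- The radius of the Cauchy horizon. -/
noncomputable def rMinus (M a : ℝ) : ℝ := M - √(M ^ 2 - a ^ 2)

/-- `Δ = r² - 2 M r + a²`. -/
def delta (M a r : ℝ) : ℝ := r ^ 2 - 2 * M * r + a ^ 2

/-- `Σ = r² + a² cos² θ`. -/
noncomputable def sigma (a : ℝ) (q : Fin 4 → ℝ) : ℝ :=
  radius q ^ 2 + a ^ 2 * (q 3 / radius q) ^ 2

/-- The exterior region `r > r₊`. -/
def exterior (M a : ℝ) : Set (Fin 4 → ℝ) := {q | rPlus M a < radius q}

/-- The one-form `dr`. -/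
noncomputable def dr (q v : Fin 4 → ℝ) : ℝ :=
  (q 1 * v 1 + q 2 * v 2 + q 3 * v 3) / radius q

/-- The one-form `sin² θ dφ`, which is smooth across the rotation axis. -/
noncomputable def sinSqDphi (q v : Fin 4 → ℝ) : ℝ :=
  (q 1 * v 2 - q 2 * v 1) / radius q ^ 2

/-- The Kerr metric `g(v, w)` at the event `q`; the fourth summand is
`Σ (dθ² + sin² θ dφ²)`.  See `metric_boyerLindquist` for the Boyer-Lindquist form. -/
noncomputable def metric (M a : ℝ) (q v w : Fin 4 → ℝ) : ℝ :=
  -(1 - 2 * M * radius q / sigma a q) * (v 0 * w 0)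
  - 2 * M * a * radius q / sigma a q * (v 0 * sinSqDphi q w + w 0 * sinSqDphi q v)
  + sigma a q / delta M a (radius q) * (dr q v * dr q w)
  + sigma a q / radius q ^ 2 * (v 1 * w 1 + v 2 * w 2 + v 3 * w 3 - dr q v * dr q w)
  + a ^ 2 * (1 + 2 * M * radius q / sigma a q) * (sinSqDphi q v * sinSqDphi q w)

/-- The event with Boyer-Lindquist coordinates `(t, r, φ, θ)`. -/
noncomputable def blPoint (t r φ θ : ℝ) : Fin 4 → ℝ :=
  ![t, r * Real.sin θ * Real.cos φ, r * Real.sin θ * Real.sin φ, r * Real.cos θ]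

/-- The vector `t' ∂_t + r' ∂_r + φ' ∂_φ + θ' ∂_θ` at the event with Boyer-Lindquist coordinates
`(t, r, φ, θ)`. -/
noncomputable def blVector (r φ θ t' r' φ' θ' : ℝ) : Fin 4 → ℝ :=
  ![t',
    r' * Real.sin θ * Real.cos φ - φ' * r * Real.sin θ * Real.sin φ
      + θ' * r * Real.cos θ * Real.cos φ,
    r' * Real.sin θ * Real.sin φ + φ' * r * Real.sin θ * Real.cos φ
      + θ' * r * Real.cos θ * Real.sin φ,
    r' * Real.cos θ - θ' * r * Real.sin θ]

theorem radius_blPoint (t r φ θ : ℝ) (hr : 0 < r) : radius (blPoint t r φ θ) = r := by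
  have h : (r * Real.sin θ * Real.cos φ) ^ 2 + (r * Real.sin θ * Real.sin φ) ^ 2
      + (r * Real.cos θ) ^ 2 = r ^ 2 := by
    have h1 := Real.sin_sq_add_cos_sq φ
    have h2 := Real.sin_sq_add_cos_sq θ
    linear_combination r ^ 2 * Real.sin θ ^ 2 * h1 + r ^ 2 * h2
  simp [radius, blPoint, h, Real.sqrt_sq hr.le]

/-- In Boyer-Lindquist coordinates `metric` is the usual Kerr line element. -/
theorem metric_boyerLindquist (M a t r φ θ t' r' φ' θ' : ℝ) (hr : 0 < r) :
    metric M a (blPoint t r φ θ) (blVector r φ θ t' r' φ' θ') (blVector r φ θ t' r' φ' θ') =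
      -(1 - 2 * M * r / (r ^ 2 + a ^ 2 * Real.cos θ ^ 2)) * t' ^ 2
      - 2 * M * a * r * Real.sin θ ^ 2 / (r ^ 2 + a ^ 2 * Real.cos θ ^ 2) * (2 * t' * φ')
      + (r ^ 2 + a ^ 2 * Real.cos θ ^ 2) / delta M a r * r' ^ 2
      + (r ^ 2 + a ^ 2 * Real.cos θ ^ 2) * θ' ^ 2
      + Real.sin θ ^ 2 / (r ^ 2 + a ^ 2 * Real.cos θ ^ 2)
        * ((r ^ 2 + a ^ 2) ^ 2 - a ^ 2 * delta M a r * Real.sin θ ^ 2) * φ' ^ 2 := by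
  have h1 := Real.sin_sq_add_cos_sq φ
  have h2 := Real.sin_sq_add_cos_sq θ
  have hS : r ^ 2 + a ^ 2 * Real.cos θ ^ 2 ≠ 0 := by positivity
  have hsig : sigma a (blPoint t r φ θ) = r ^ 2 + a ^ 2 * Real.cos θ ^ 2 := by
    rw [sigma, radius_blPoint t r φ θ hr]
    simp [blPoint, hr.ne']
  have hdr : dr (blPoint t r φ θ) (blVector r φ θ t' r' φ' θ') = r' := by
    rw [dr, radius_blPoint t r φ θ hr, div_eq_iff hr.ne']
    simp only [blPoint, blVector, Matrix.cons_val]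
    linear_combination (r * r' * Real.sin θ ^ 2
      + r ^ 2 * θ' * Real.sin θ * Real.cos θ) * h1 + r * r' * h2
  have hph : sinSqDphi (blPoint t r φ θ) (blVector r φ θ t' r' φ' θ')
      = Real.sin θ ^ 2 * φ' := by
    rw [sinSqDphi, radius_blPoint t r φ θ hr, div_eq_iff (pow_ne_zero 2 hr.ne')]
    simp only [blPoint, blVector, Matrix.cons_val]
    linear_combination r ^ 2 * φ' * Real.sin θ ^ 2 * h1
  have hsq : (blVector r φ θ t' r' φ' θ' 1 * blVector r φ θ t' r' φ' θ' 1
      + blVector r φ θ t' r' φ' θ' 2 * blVector r φ θ t' r' φ' θ' 2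
      + blVector r φ θ t' r' φ' θ' 3 * blVector r φ θ t' r' φ' θ' 3 - r' * r')
      = r ^ 2 * (θ' ^ 2 + Real.sin θ ^ 2 * φ' ^ 2) := by
    simp only [blVector, Matrix.cons_val]
    linear_combination (r' ^ 2 * Real.sin θ ^ 2 + r ^ 2 * φ' ^ 2 * Real.sin θ ^ 2
      + r ^ 2 * θ' ^ 2 * Real.cos θ ^ 2 + 2 * r * r' * θ' * Real.sin θ * Real.cos θ) * h1
      + (r' ^ 2 + r ^ 2 * θ' ^ 2) * h2
  have h0 : blVector r φ θ t' r' φ' θ' 0 = t' := by simp [blVector]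
  rw [metric, hsig, hdr, hph, hsq, radius_blPoint t r φ θ hr, h0]
  have hc : Real.cos θ ^ 2 = 1 - Real.sin θ ^ 2 := by linarith
  by_cases hD : delta M a r = 0
  · simp only [hD, div_zero, zero_mul]
    rw [delta] at hD
    have hD' : a ^ 2 = 2 * M * r - r ^ 2 := by linarith
    field_simp
    rw [hc]
    linear_combination (-Real.sin θ ^ 4 * φ' ^ 2 * a ^ 2) * hD
  · field_simp
    rw [hc, delta]
    ring

/-! ### Time orientation, observers and celestial spheres -/

/-- The vector field `(r² + a²) ∂_t + a ∂_φ`, timelike on the exterior region; it is the positive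
multiple `√(ΣΔ) e₀` of the time direction `e₀` of the standard tetrad, and fixes the time
orientation. -/
noncomputable def timeDirection (a : ℝ) (q : Fin 4 → ℝ) : Fin 4 → ℝ :=
  ![radius q ^ 2 + a ^ 2, -(a * q 2), a * q 1, 0]

/-- An observer at `p`: an orthonormal basis `e 0, e 1, e 2, e 3` of the tangent space whose
first vector is timelike and future directed. -/
structure IsObserver (M a : ℝ) (p : Fin 4 → ℝ) (e : Fin 4 → Fin 4 → ℝ) : Prop where
  orthonormal : ∀ i j, metric M a p (e i) (e j) = if i = j then (if i = 0 then -1 else 1) else 0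
  future : metric M a p (e 0) (timeDirection a p) < 0

/-- The celestial sphere `S² = {k ∈ ℝ³ : |k| = 1}`. -/
abbrev CelestialSphere : Type := Metric.sphere (0 : EuclideanSpace ℝ (Fin 3)) 1

/-- The null vector `e₀ + k₁ e₁ + k₂ e₂ + k₃ e₃`. -/
noncomputable def nullVector (e : Fin 4 → Fin 4 → ℝ) (k : CelestialSphere) : Fin 4 → ℝ :=
  e 0 + ∑ i : Fin 3, k.1 i • e i.succ

/-! ### Geodesics -/

/-- Christoffel symbols of the first kind, `g(∇_u v, w)` for constant `u, v, w`:
`½ (∂_u g(v, w) + ∂_v g(u, w) - ∂_w g(u, v))`. -/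
noncomputable def christoffel (M a : ℝ) (q u v w : Fin 4 → ℝ) : ℝ :=
  (fderiv ℝ (fun x => metric M a x v w) q u + fderiv ℝ (fun x => metric M a x u w) q v
    - fderiv ℝ (fun x => metric M a x u v) q w) / 2

/-- `γ` restricted to the open interval `J` is an affinely parametrised geodesic of the exterior
region: `g(∇_{γ'} γ', w) = 0` for every vector `w`. -/
structure IsGeodesicOn (M a : ℝ) (γ : ℝ → Fin 4 → ℝ) (J : Set ℝ) : Prop where
  isOpen : IsOpen J
  ordConnected : J.OrdConnected
  mem_exterior : ∀ s ∈ J, γ s ∈ exterior M a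
  contDiffOn : ContDiffOn ℝ 2 γ J
  equation : ∀ s ∈ J, ∀ w : Fin 4 → ℝ,
    metric M a (γ s) (deriv (deriv γ) s) w
      + christoffel M a (γ s) (deriv γ s) (deriv γ s) w = 0

/-- `γ` on `J` is a geodesic through `p` whose tangent vector at `p` is
`e₀ + k₁ e₁ + k₂ e₂ + k₃ e₃`. -/
structure IsNullGeodesicFrom (M a : ℝ) (p : Fin 4 → ℝ) (e : Fin 4 → Fin 4 → ℝ)
    (k : CelestialSphere) (γ : ℝ → Fin 4 → ℝ) (J : Set ℝ) : Prop where
  isGeodesicOn : IsGeodesicOn M a γ J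
  zero_mem : (0 : ℝ) ∈ J
  start : γ 0 = p
  tangent : deriv γ 0 = nullVector e k

/-! ### The future event horizon and future null infinity -/

/-- The tortoise coordinate `r*`, an antiderivative of `(r² + a²) / Δ`. -/
noncomputable def rStar (M a r : ℝ) : ℝ :=
  r + 2 * M / (rPlus M a - rMinus M a)
    * (rPlus M a * Real.log (r - rPlus M a) - rMinus M a * Real.log (r - rMinus M a))

/-- The angle `r♯`, an antiderivative of `a / Δ`. -/
noncomputable def rSharp (M a r : ℝ) : ℝ :=
  a / (rPlus M a - rMinus M a) * (Real.log (r - rPlus M a) - Real.log (r - rMinus M a))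

theorem delta_eq (M a r : ℝ) (h : a ^ 2 ≤ M ^ 2) :
    delta M a r = (r - rPlus M a) * (r - rMinus M a) := by
  have hs := Real.sq_sqrt (sub_nonneg.2 h)
  simp only [delta, rPlus, rMinus]
  linear_combination hs

theorem hasDerivAt_rStar (M a r : ℝ) (ha : 0 ≤ a) (haM : a < M) (hr : rPlus M a < r) :
    HasDerivAt (rStar M a) ((r ^ 2 + a ^ 2) / delta M a r) r := by
  have hpos : 0 < √(M ^ 2 - a ^ 2) := Real.sqrt_pos.2 (by nlinarith)
  have hd : rPlus M a - rMinus M a ≠ 0 := by simp only [rPlus, rMinus]; linarith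
  have h1 : r - rPlus M a ≠ 0 := by linarith
  have h2 : r - rMinus M a ≠ 0 := by simp only [rPlus, rMinus] at *; linarith
  have hsum : 2 * M = rPlus M a + rMinus M a := by simp only [rPlus, rMinus]; ring
  have hD := delta_eq M a r (by nlinarith)
  have hl1 := ((hasDerivAt_id r).sub_const (rPlus M a)).log h1
  have hl2 := ((hasDerivAt_id r).sub_const (rMinus M a)).log h2
  have h := (hasDerivAt_id r).add
    (((hl1.const_mul (rPlus M a)).sub (hl2.const_mul (rMinus M a))).const_mul
      (2 * M / (rPlus M a - rMinus M a)))
  refine h.congr_deriv ?_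
  have hN : r ^ 2 + a ^ 2 = (r - rPlus M a) * (r - rMinus M a) + 2 * M * r := by
    rw [← hD, delta]; ring
  rw [hN, hD]
  simp only [id]
  field_simp
  ring

theorem hasDerivAt_rSharp (M a r : ℝ) (ha : 0 ≤ a) (haM : a < M) (hr : rPlus M a < r) :
    HasDerivAt (rSharp M a) (a / delta M a r) r := by
  have hpos : 0 < √(M ^ 2 - a ^ 2) := Real.sqrt_pos.2 (by nlinarith)
  have hd : rPlus M a - rMinus M a ≠ 0 := by simp only [rPlus, rMinus]; linarith
  have h1 : r - rPlus M a ≠ 0 := by linarith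
  have h2 : r - rMinus M a ≠ 0 := by simp only [rPlus, rMinus] at *; linarith
  have hD := delta_eq M a r (by nlinarith)
  have hl1 := ((hasDerivAt_id r).sub_const (rPlus M a)).log h1
  have hl2 := ((hasDerivAt_id r).sub_const (rMinus M a)).log h2
  refine ((hl1.sub hl2).const_mul (a / (rPlus M a - rMinus M a))).congr_deriv ?_
  rw [hD]
  simp only [id]
  field_simp
  ring

/-- The ingoing Kerr chart `(v, r, θ, φ + r♯)`, `v = t + r*`, in Cartesian form.  The metric
extends smoothly in this chart across `r = r₊`. -/
noncomputable def ingoingChart (M a : ℝ) (q : Fin 4 → ℝ) : Fin 4 → ℝ :=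
  ![q 0 + rStar M a (radius q),
    Real.cos (rSharp M a (radius q)) * q 1 - Real.sin (rSharp M a (radius q)) * q 2,
    Real.sin (rSharp M a (radius q)) * q 1 + Real.cos (rSharp M a (radius q)) * q 2,
    q 3]

/-- The future event horizon `ℋ⁺`: the hypersurface `r = r₊` of the ingoing Kerr chart. -/
def futureHorizon (M a : ℝ) : Set (Fin 4 → ℝ) := {q | radius q = rPlus M a}

/-- The outgoing Kerr chart in compactified form: `(u, 1 / r, n)`, where `u = t - r*` and `n` is
the point of the unit sphere with angles `(θ, φ - r♯)`.  The conformal metric `r⁻² g` extends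
smoothly in this chart across `1 / r = 0`. -/
noncomputable def outgoingChart (M a : ℝ) (q : Fin 4 → ℝ) : ℝ × ℝ × (Fin 3 → ℝ) :=
  (q 0 - rStar M a (radius q), 1 / radius q,
    ![(Real.cos (rSharp M a (radius q)) * q 1 + Real.sin (rSharp M a (radius q)) * q 2) / radius q,
      (Real.cos (rSharp M a (radius q)) * q 2 - Real.sin (rSharp M a (radius q)) * q 1) / radius q,
      q 3 / radius q])

/-- Future null infinity `ℐ⁺`: the hypersurface `1 / r = 0` of the compactified outgoing chart. -/
def futureNullInfinity : Set (ℝ × ℝ × (Fin 3 → ℝ)) :=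
  {x | x.2.1 = 0 ∧ x.2.2 0 ^ 2 + x.2.2 1 ^ 2 + x.2.2 2 ^ 2 = 1}

/-- `γ` meets `ℋ⁺`: at the future end of its parameter interval it has a limit point on `ℋ⁺`. -/
def MeetsFutureHorizon (M a : ℝ) (γ : ℝ → Fin 4 → ℝ) (J : Set ℝ) : Prop :=
  ∃ x ∈ futureHorizon M a, Tendsto (fun s : J => ingoingChart M a (γ s)) atTop (𝓝 x)

/-- `γ` meets `ℐ⁺`: at the future end of its parameter interval it has a limit point on `ℐ⁺`. -/
def MeetsFutureNullInfinity (M a : ℝ) (γ : ℝ → Fin 4 → ℝ) (J : Set ℝ) : Prop :=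
  ∃ x ∈ futureNullInfinity, Tendsto (fun s : J => outgoingChart M a (γ s)) atTop (𝓝 x)

/-! ### Infalling, escaping and trapped directions -/

/-- The future infalling set `Ω_{ℋ⁺}(p)`. -/
def futureInfalling (M a : ℝ) (p : Fin 4 → ℝ) (e : Fin 4 → Fin 4 → ℝ) : Set CelestialSphere :=
  {k | ∃ γ J, IsNullGeodesicFrom M a p e k γ J ∧ MeetsFutureHorizon M a γ J}

/-- The future escaping set `Ω_{ℐ⁺}(p)`. -/
def futureEscaping (M a : ℝ) (p : Fin 4 → ℝ) (e : Fin 4 → Fin 4 → ℝ) : Set CelestialSphere :=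
  {k | ∃ γ J, IsNullGeodesicFrom M a p e k γ J ∧ MeetsFutureNullInfinity M a γ J}

/-- The future trapped set `𝕋₊(p)`. -/
def futureTrapped (M a : ℝ) (p : Fin 4 → ℝ) (e : Fin 4 → Fin 4 → ℝ) : Set CelestialSphere :=
  {k | ∀ γ J, IsNullGeodesicFrom M a p e k γ J →
    ¬ (MeetsFutureHorizon M a γ J ∨ MeetsFutureNullInfinity M a γ J)}

end Kerr

/-!
Null geodesics of Kerr separate: they have an energy `E`, an axial angular momentum `L` and a
Carter constant `K ≥ 0`, and in a suitable (Mino) parameter the radius moves as a particle in one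
dimension, `(dr/dl)² = X(r)² - K Δ(r)` with `X = E (r² + a²) - a L`, while the direction moves on
the unit sphere.  Nothing has to be known about all geodesics: infalling and escaping ones are only
ever constructed, and trapping is only used to exclude constructions.

*Construction.*  The angular motion is the flow of a smooth vector field, cut off so as to be
compactly supported, hence global (`exists_angular_motion`).  A one-dimensional motion runs to a
target past at most one simple turning point (`reaches_of_pos`, `reaches_of_root`), in `r` for the
horizon and in `-1 / r` for null infinity.  Together they satisfy the geodesic equation
(`Orbit.IsMotion.isGeodesicOn`), whose Carter form is checked through the one-form `g(γ', ·)`, and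
the limit in the ingoing or outgoing chart exists because `(X + ρ) / Δ = K / (X - ρ)` for
`ρ = dr/dl` (`exists_infalling`, `exists_escaping`).

*Perturbation.*  With `κ = √K`, a future motion is confined to where the gap `G = X - κ √Δ` is
nonnegative.  As `√Δ` is concave and increasing, `G` is convex for `E ≥ 0` and decreasing for
`E ≤ 0`; so a zero of `G` between the starting radius and a point with `G < 0` is a simple turning
point.  Hence `G < 0` somewhere below the starting radius makes the motion escape and `G < 0`
somewhere above makes it fall in (`radiallyEscapes_of_barrier`, `radiallyFalls_of_barrier`), whereas
`G > 0` all the way ahead lets it go on (`radiallyEscapes_of_gap_pos`, `radiallyFalls_of_gap_pos`).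
For a trapped direction, therefore, `G ≥ 0` everywhere, and `G` vanishes somewhere ahead of the
starting radius or at it.  Multiply the angular components of the direction in Carter's tetrad by
`1 - μ`, keeping the time component: this replaces `G` by `(1 - μ) G + μ P` with a positive function
`P` (`tetradGap_shrink`).  For small `μ > 0` the gap becomes positive and the motion goes on in its
radial direction, which can be chosen freely if the radial velocity vanished; for small `μ < 0` a
zero ahead becomes a barrier that turns the motion back.  So both fates occur near every trapped
direction (`IsNullData.mem_closure_cones`), and null vectors near `e₀ + k₁ e₁ + k₂ e₂ + k₃ e₃` are
positive multiples of such vectors with `k` nearby (`IsObserver.exists_mem_ball`).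
-/

namespace Kerr

open Set

/-! ### Ordinary differential equations -/

theorem eq_of_hasDerivAt_zero {g : ℝ → ℝ} {J : Set ℝ} (hJ : J.OrdConnected)
    (hg : ∀ s ∈ J, HasDerivAt g 0 s) {x y : ℝ} (hx : x ∈ J) (hy : y ∈ J) : g x = g y := by
  have h := hJ.convex.norm_image_sub_le_of_norm_hasDerivWithin_le (C := 0)
    (fun s hs => (hg s hs).hasDerivWithinAt) (fun s _ => by simp) hy hx
  simpa [sub_eq_zero] using h

theorem hasDerivAt_integral {f : ℝ → ℝ} {α β x₀ x : ℝ} (hf : ContinuousOn f (Ioo α β))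
    (hx₀ : x₀ ∈ Ioo α β) (hx : x ∈ Ioo α β) : HasDerivAt (fun x => ∫ u in x₀..x, f u) (f x) x :=
  intervalIntegral.integral_hasDerivAt_right
    ((hf.mono (ordConnected_Ioo.uIcc_subset hx₀ hx)).intervalIntegrable)
    (hf.stronglyMeasurableAtFilter isOpen_Ioo x hx)
    (hf.continuousAt (Ioo_mem_nhds hx.1 hx.2))

/-- The autonomous scalar equation `y' = f y` with `f` continuous and positive is solved by
inverting the antiderivative of `1 / f`. -/
theorem exists_solution_of_pos {f : ℝ → ℝ} {α β y₀ : ℝ} (hf : ContinuousOn f (Ioo α β))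
    (hpos : ∀ y ∈ Ioo α β, 0 < f y) (hy₀ : y₀ ∈ Ioo α β) :
    ∃ (J : Set ℝ) (y : ℝ → ℝ), IsOpen J ∧ J.OrdConnected ∧ (0 : ℝ) ∈ J ∧ y 0 = y₀ ∧
      (∀ s ∈ J, HasDerivAt y (f (y s)) s) ∧ StrictMonoOn y J ∧ y '' J = Ioo α β := by
  set T : ℝ → ℝ := fun y => ∫ u in y₀..y, 1 / f u with hT
  have hcont : ContinuousOn (fun u => 1 / f u) (Ioo α β) :=
    continuousOn_const.div hf fun u hu => (hpos u hu).ne'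
  have hder : ∀ y ∈ Ioo α β, HasDerivAt T (1 / f y) y := fun y hy =>
    hasDerivAt_integral hcont hy₀ hy
  have hTc : ContinuousOn T (Ioo α β) := fun y hy => (hder y hy).continuousAt.continuousWithinAt
  have hmono : StrictMonoOn T (Ioo α β) := by
    refine strictMonoOn_of_deriv_pos (convex_Ioo α β) hTc fun y hy => ?_
    rw [interior_Ioo] at hy
    rw [(hder y hy).deriv]
    exact one_div_pos.2 (hpos y hy)
  set J := T '' Ioo α β with hJ
  set y := Function.invFunOn T (Ioo α β) with hy
  have hTy : ∀ s ∈ J, T (y s) = s := fun s hs => Function.invFunOn_eq hs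
  have hymem : ∀ s ∈ J, y s ∈ Ioo α β := fun s hs => Function.invFunOn_mem hs
  have hyT : ∀ u ∈ Ioo α β, y (T u) = u := fun u hu =>
    hmono.injOn (hymem _ (mem_image_of_mem T hu)) hu (hTy _ (mem_image_of_mem T hu))
  have hopen : IsOpen J := by
    rw [isOpen_iff_mem_nhds]
    rintro _ ⟨u, hu, rfl⟩
    obtain ⟨u₁, h1, h1'⟩ := exists_between hu.1
    obtain ⟨u₂, h2, h2'⟩ := exists_between hu.2
    have m1 : u₁ ∈ Ioo α β := ⟨h1, h1'.trans hu.2⟩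
    have m2 : u₂ ∈ Ioo α β := ⟨hu.1.trans h2, h2'⟩
    have hsub : Icc u₁ u₂ ⊆ Ioo α β := ordConnected_Ioo.out m1 m2
    refine mem_of_superset (Icc_mem_nhds (hmono m1 hu h1') (hmono hu m2 h2)) ?_
    exact (intermediate_value_Icc (h1'.trans h2).le (hTc.mono hsub)).trans (image_mono hsub)
  have hord : J.OrdConnected := ((isPreconnected_Ioo.image T hTc)).ordConnected
  have himg : y '' J = Ioo α β := by
    apply Subset.antisymm
    · rintro _ ⟨s, hs, rfl⟩; exact hymem s hs
    · intro u hu; exact ⟨T u, mem_image_of_mem T hu, hyT u hu⟩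
  have hymono : StrictMonoOn y J := by
    intro s hs s' hs' hlt
    rw [← hTy s hs, ← hTy s' hs'] at hlt
    exact (hmono.lt_iff_lt (hymem s hs) (hymem s' hs')).1 hlt
  have hT0 : T y₀ = 0 := by simp [hT]
  refine ⟨J, y, hopen, hord, ⟨y₀, hy₀, hT0⟩, ?_, ?_, hymono, himg⟩
  · rw [← hT0, hyT y₀ hy₀]
  · intro s hs
    have hc : ContinuousAt y s := by
      refine hymono.continuousAt_of_image_mem_nhds (hopen.mem_nhds hs) ?_
      rw [himg]
      exact Ioo_mem_nhds (hymem s hs).1 (hymem s hs).2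
    have h := HasDerivAt.of_local_left_inverse hc (hder _ (hymem s hs))
      (one_div_pos.2 (hpos _ (hymem s hs))).ne'
      (by filter_upwards [hopen.mem_nhds hs] with u hu using hTy u hu)
    simpa using h

/-- A `C¹` vector field with compact support has solutions on arbitrarily long intervals. -/
theorem exists_solution_of_hasCompactSupport {E : Type*} [NormedAddCommGroup E]
    [NormedSpace ℝ E] [CompleteSpace E] {V : E → E} (hV : ContDiff ℝ 1 V)
    (hc : HasCompactSupport V) (x₀ : E) {T : ℝ} (hT : 0 < T) :
    ∃ y : ℝ → E, y 0 = x₀ ∧ ∀ t ∈ Ioo (-T) T, HasDerivAt y (V (y t)) t := by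
  obtain ⟨K, hK⟩ := hV.lipschitzWith_of_hasCompactSupport hc one_ne_zero
  obtain ⟨C, hC⟩ := hc.exists_bound_of_continuous hV.continuous
  have hC0 : 0 ≤ C := (norm_nonneg _).trans (hC x₀)
  have hpl : IsPicardLindelof (fun _ => V) (tmin := -T) (tmax := T)
      ⟨0, by constructor <;> linarith⟩ x₀ (⟨C * T, by positivity⟩) 0 ⟨C, hC0⟩ K := by
    refine IsPicardLindelof.of_time_independent (fun x _ => hC x) hK.lipschitzOnWith ?_
    simp
    exact le_rfl
  obtain ⟨y, h0, hy⟩ := hpl.exists_eq_forall_mem_Icc_hasDerivWithinAt₀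
  exact ⟨y, h0, fun t ht => (hy t (Ioo_subset_Icc_self ht)).hasDerivAt (Icc_mem_nhds ht.1 ht.2)⟩

/-! ### The angular motion -/

/-- The equations `ν' = j × ν`, `j' = b² ν₃ ν × e₃` of a point `ν` with angular momentum `j` in the
potential `-b² ν₃² / 2`, as a vector field on pairs `(ν, j)`. -/
def angularField (b : ℝ) (y : Fin 6 → ℝ) : Fin 6 → ℝ :=
  ![y 4 * y 2 - y 5 * y 1, y 5 * y 0 - y 3 * y 2, y 3 * y 1 - y 4 * y 0,
    b ^ 2 * y 2 * y 1, -(b ^ 2 * y 2 * y 0), 0]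

theorem contDiff_angularField (b : ℝ) : ContDiff ℝ 1 (angularField b) := by
  rw [contDiff_pi]
  intro i
  fin_cases i <;> simp [angularField] <;> fun_prop

/-- The motion of a point of the unit sphere in the potential `-b² ν₃² / 2`.  Written with the
angular momentum `j = ν × μ`, the equations preserve `|ν|²`, `ν · j`, `j₃` and `|j|² - b² ν₃²`
identically, even after multiplication by a cut-off function, so that no solution feels the
cut-off. -/
theorem exists_angular_motion (b : ℝ) {T : ℝ} (hT : 0 < T) (n₁ n₂ n₃ m₁ m₂ m₃ : ℝ)
    (hn : n₁ ^ 2 + n₂ ^ 2 + n₃ ^ 2 = 1) (hnm : n₁ * m₁ + n₂ * m₂ + n₃ * m₃ = 0) :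
    ∃ ν₁ ν₂ ν₃ μ₁ μ₂ μ₃ : ℝ → ℝ,
      (ν₁ 0 = n₁ ∧ ν₂ 0 = n₂ ∧ ν₃ 0 = n₃ ∧ μ₁ 0 = m₁ ∧ μ₂ 0 = m₂ ∧ μ₃ 0 = m₃) ∧
      ∀ t ∈ Ioo (-T) T,
        (HasDerivAt ν₁ (μ₁ t) t ∧ HasDerivAt ν₂ (μ₂ t) t ∧ HasDerivAt ν₃ (μ₃ t) t) ∧
        (HasDerivAt μ₁ (-(μ₁ t ^ 2 + μ₂ t ^ 2 + μ₃ t ^ 2 + b ^ 2 * ν₃ t ^ 2) * ν₁ t) t ∧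
          HasDerivAt μ₂ (-(μ₁ t ^ 2 + μ₂ t ^ 2 + μ₃ t ^ 2 + b ^ 2 * ν₃ t ^ 2) * ν₂ t) t ∧
          HasDerivAt μ₃ (-(μ₁ t ^ 2 + μ₂ t ^ 2 + μ₃ t ^ 2 + b ^ 2 * ν₃ t ^ 2) * ν₃ t
            + b ^ 2 * ν₃ t) t) ∧
        ν₁ t ^ 2 + ν₂ t ^ 2 + ν₃ t ^ 2 = 1 ∧ ν₁ t * μ₁ t + ν₂ t * μ₂ t + ν₃ t * μ₃ t = 0 ∧
        ν₁ t * μ₂ t - ν₂ t * μ₁ t = n₁ * m₂ - n₂ * m₁ ∧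
        μ₁ t ^ 2 + μ₂ t ^ 2 + μ₃ t ^ 2 - b ^ 2 * ν₃ t ^ 2
          = m₁ ^ 2 + m₂ ^ 2 + m₃ ^ 2 - b ^ 2 * n₃ ^ 2 := by
  -- The initial state, the conserved energy and a bound for the whole orbit.
  set y₀ : Fin 6 → ℝ := ![n₁, n₂, n₃, n₂ * m₃ - n₃ * m₂, n₃ * m₁ - n₁ * m₃, n₁ * m₂ - n₂ * m₁]
    with hy₀
  set e := m₁ ^ 2 + m₂ ^ 2 + m₃ ^ 2 - b ^ 2 * n₃ ^ 2 with he
  set C := 1 + |e| + b ^ 2 with hC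
  have hCpos : 0 < C := by positivity
  let χ : ContDiffBump (0 : Fin 6 → ℝ) := ⟨C, C + 1, hCpos, by linarith⟩
  obtain ⟨y, hy0, hy⟩ := exists_solution_of_hasCompactSupport
    (V := fun y => χ y • angularField b y)
    (χ.contDiff.smul (contDiff_angularField b)) χ.hasCompactSupport.smul_right y₀ hT
  have hzero : (0 : ℝ) ∈ Ioo (-T) T := ⟨by linarith, hT⟩
  have hd : ∀ t ∈ Ioo (-T) T, ∀ i, HasDerivAt (fun s => y s i)
      (χ (y t) * angularField b (y t) i) t := fun t ht i => by
    simpa using hasDerivAt_pi.1 (hy t ht) i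
  have d0 : ∀ t ∈ Ioo (-T) T, HasDerivAt (fun s => y s 0)
      (χ (y t) * (y t 4 * y t 2 - y t 5 * y t 1)) t := fun t ht => hd t ht 0
  have d1 : ∀ t ∈ Ioo (-T) T, HasDerivAt (fun s => y s 1)
      (χ (y t) * (y t 5 * y t 0 - y t 3 * y t 2)) t := fun t ht => hd t ht 1
  have d2 : ∀ t ∈ Ioo (-T) T, HasDerivAt (fun s => y s 2)
      (χ (y t) * (y t 3 * y t 1 - y t 4 * y t 0)) t := fun t ht => hd t ht 2
  have d3 : ∀ t ∈ Ioo (-T) T, HasDerivAt (fun s => y s 3)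
      (χ (y t) * (b ^ 2 * y t 2 * y t 1)) t := fun t ht => hd t ht 3
  have d4 : ∀ t ∈ Ioo (-T) T, HasDerivAt (fun s => y s 4)
      (χ (y t) * -(b ^ 2 * y t 2 * y t 0)) t := fun t ht => hd t ht 4
  have d5 : ∀ t ∈ Ioo (-T) T, HasDerivAt (fun s => y s 5)
      (χ (y t) * 0) t := fun t ht => hd t ht 5
  have hi : y 0 0 = n₁ ∧ y 0 1 = n₂ ∧ y 0 2 = n₃ ∧ y 0 3 = n₂ * m₃ - n₃ * m₂ ∧
      y 0 4 = n₃ * m₁ - n₁ * m₃ ∧ y 0 5 = n₁ * m₂ - n₂ * m₁ := by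
    rw [hy0]; exact ⟨rfl, rfl, rfl, rfl, rfl, rfl⟩
  obtain ⟨i0, i1, i2, i3, i4, i5⟩ := hi
  have c1 : ∀ t ∈ Ioo (-T) T, y t 0 ^ 2 + y t 1 ^ 2 + y t 2 ^ 2 = 1 := by
    intro t ht
    rw [← hn, ← i0, ← i1, ← i2]
    refine eq_of_hasDerivAt_zero (g := fun t => y t 0 ^ 2 + y t 1 ^ 2 + y t 2 ^ 2)
      ordConnected_Ioo (fun s hs => ?_) ht hzero
    refine ((((d0 s hs).pow 2).add ((d1 s hs).pow 2)).add ((d2 s hs).pow 2)).congr_deriv ?_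
    push_cast; ring
  have c2 : ∀ t ∈ Ioo (-T) T, y t 0 * y t 3 + y t 1 * y t 4 + y t 2 * y t 5 = 0 := by
    intro t ht
    have h0 : y 0 0 * y 0 3 + y 0 1 * y 0 4 + y 0 2 * y 0 5 = 0 := by
      rw [i0, i1, i2, i3, i4, i5]; ring
    rw [← h0]
    refine eq_of_hasDerivAt_zero (g := fun t => y t 0 * y t 3 + y t 1 * y t 4 + y t 2 * y t 5)
      ordConnected_Ioo (fun s hs => ?_) ht hzero
    refine ((((d0 s hs).mul (d3 s hs)).add ((d1 s hs).mul (d4 s hs))).add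
      ((d2 s hs).mul (d5 s hs))).congr_deriv ?_
    ring
  have c3 : ∀ t ∈ Ioo (-T) T, y t 5 = n₁ * m₂ - n₂ * m₁ := by
    intro t ht
    rw [← i5]
    refine eq_of_hasDerivAt_zero (g := fun t => y t 5)
      ordConnected_Ioo (fun s hs => ?_) ht hzero
    exact (d5 s hs).congr_deriv (by ring)
  have c4 : ∀ t ∈ Ioo (-T) T,
      y t 3 ^ 2 + y t 4 ^ 2 + y t 5 ^ 2 - b ^ 2 * y t 2 ^ 2 = e := by
    intro t ht
    have h0 : y 0 3 ^ 2 + y 0 4 ^ 2 + y 0 5 ^ 2 - b ^ 2 * y 0 2 ^ 2 = e := by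
      rw [i2, i3, i4, i5, he]
      linear_combination (m₁ ^ 2 + m₂ ^ 2 + m₃ ^ 2) * hn
        - (n₁ * m₁ + n₂ * m₂ + n₃ * m₃) * hnm
    rw [← h0]
    refine eq_of_hasDerivAt_zero
      (g := fun t => y t 3 ^ 2 + y t 4 ^ 2 + y t 5 ^ 2 - b ^ 2 * y t 2 ^ 2)
      ordConnected_Ioo (fun s hs => ?_) ht hzero
    refine (((((d3 s hs).pow 2).add ((d4 s hs).pow 2)).add ((d5 s hs).pow 2)).sub
      (((d2 s hs).pow 2).const_mul (b ^ 2))).congr_deriv ?_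
    push_cast; ring
  have hχ : ∀ t ∈ Ioo (-T) T, χ (y t) = 1 := by
    intro t ht
    refine χ.one_of_mem_closedBall ?_
    rw [mem_closedBall_zero_iff]
    change ‖y t‖ ≤ C
    have h1 := c1 t ht
    have h4 := c4 t ht
    have hs2 : y t 2 ^ 2 ≤ 1 := by nlinarith [sq_nonneg (y t 0), sq_nonneg (y t 1)]
    have hb2 : b ^ 2 * y t 2 ^ 2 ≤ b ^ 2 := by nlinarith [sq_nonneg b]
    have hee := le_abs_self e
    have hCC : 1 ≤ C := by rw [hC]; linarith [abs_nonneg e, sq_nonneg b]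
    have key : ∀ i, y t i ^ 2 ≤ C := by
      have q0 := sq_nonneg (y t 0); have q1 := sq_nonneg (y t 1); have q2 := sq_nonneg (y t 2)
      have q3 := sq_nonneg (y t 3); have q4 := sq_nonneg (y t 4); have q5 := sq_nonneg (y t 5)
      intro i
      fin_cases i <;> simp only [Fin.mk_zero, Fin.mk_one, Fin.reduceFinMk] <;> linarith
    rw [pi_norm_le_iff_of_nonneg hCpos.le]
    intro i
    rw [Real.norm_eq_abs]
    exact abs_le_of_sq_le_sq ((key i).trans (le_self_pow₀ hCC two_ne_zero)) hCpos.le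
  refine ⟨fun t => y t 0, fun t => y t 1, fun t => y t 2,
    fun t => y t 4 * y t 2 - y t 5 * y t 1, fun t => y t 5 * y t 0 - y t 3 * y t 2,
    fun t => y t 3 * y t 1 - y t 4 * y t 0, ⟨i0, i1, i2, ?_, ?_, ?_⟩, ?_⟩
  · simp only [i1, i2, i4, i5]; linear_combination m₁ * hn - n₁ * hnm
  · simp only [i0, i2, i3, i5]; linear_combination m₂ * hn - n₂ * hnm
  · simp only [i0, i1, i3, i4]; linear_combination m₃ * hn - n₃ * hnm
  intro t ht
  have hx := hχ t ht
  have e0 := d0 t ht; have e1 := d1 t ht; have e2 := d2 t ht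
  have e3 := d3 t ht; have e4 := d4 t ht; have e5 := d5 t ht
  rw [hx, one_mul] at e0 e1 e2 e3 e4 e5
  have h1 := c1 t ht
  have h2 := c2 t ht
  have h3 := c3 t ht
  have h4 := c4 t ht
  refine ⟨⟨e0, e1, e2⟩, ⟨?_, ?_, ?_⟩, h1, by ring, ?_, ?_⟩
  · refine ((e4.mul e2).sub (e5.mul e1)).congr_deriv ?_
    beta_reduce
    generalize y t 0 = v0, y t 1 = v1, y t 2 = v2, y t 3 = v3, y t 4 = v4, y t 5 = v5 at *
    linear_combination (v0 * (v3 ^ 2 + v4 ^ 2 + v5 ^ 2)) * h1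
      - (v0 * (v0 * v3 + v1 * v4 + v2 * v5) - v3) * h2
  · refine ((e5.mul e0).sub (e3.mul e2)).congr_deriv ?_
    beta_reduce
    generalize y t 0 = v0, y t 1 = v1, y t 2 = v2, y t 3 = v3, y t 4 = v4, y t 5 = v5 at *
    linear_combination (v1 * (v3 ^ 2 + v4 ^ 2 + v5 ^ 2)) * h1
      - (v1 * (v0 * v3 + v1 * v4 + v2 * v5) - v4) * h2
  · refine ((e3.mul e1).sub (e4.mul e0)).congr_deriv ?_
    beta_reduce
    generalize y t 0 = v0, y t 1 = v1, y t 2 = v2, y t 3 = v3, y t 4 = v4, y t 5 = v5 at *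
    linear_combination (v2 * (v3 ^ 2 + v4 ^ 2 + v5 ^ 2) + b ^ 2 * v2) * h1
      - (v2 * (v0 * v3 + v1 * v4 + v2 * v5) - v5) * h2
  · rw [← h3]
    beta_reduce
    generalize y t 0 = v0, y t 1 = v1, y t 2 = v2, y t 3 = v3, y t 4 = v4, y t 5 = v5 at *
    linear_combination v5 * h1 - v2 * h2
  · rw [← h4]
    beta_reduce
    generalize y t 0 = v0, y t 1 = v1, y t 2 = v2, y t 3 = v3, y t 4 = v4, y t 5 = v5 at *
    linear_combination (v3 ^ 2 + v4 ^ 2 + v5 ^ 2) * h1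
      - (v0 * v3 + v1 * v4 + v2 * v5) * h2

/-! ### Derivatives of the metric -/

/-- The derivative of `g(v, v)` at `q` in the direction `w`, for constant `v`. -/
noncomputable def metricDeriv (M a : ℝ) (q v w : Fin 4 → ℝ) : ℝ :=
  let r := radius q
  let S := sigma a q
  let D := delta M a r
  let z := q 3 / r
  let dS := 2 * r * dr q w + 2 * a ^ 2 * z * ((w 3 - z * dr q w) / r)
  let dF := 2 * M * (dr q w * S - r * dS) / S ^ 2
  let dvr := (v 1 * w 1 + v 2 * w 2 + v 3 * w 3 - dr q v * dr q w) / r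
  let dω := (w 1 * v 2 - w 2 * v 1) / r ^ 2 - 2 * sinSqDphi q v * dr q w / r
  dF * v 0 ^ 2 - 2 * a * dF * (v 0 * sinSqDphi q v)
    - 2 * a * (2 * M * r / S) * (v 0 * dω)
    + (dS * D - S * ((2 * r - 2 * M) * dr q w)) / D ^ 2 * dr q v ^ 2
    + S / D * (2 * dr q v * dvr)
    + (dS / r ^ 2 - 2 * S * dr q w / r ^ 3) * (v 1 ^ 2 + v 2 ^ 2 + v 3 ^ 2 - dr q v ^ 2)
    - S / r ^ 2 * (2 * dr q v * dvr)
    + a ^ 2 * dF * sinSqDphi q v ^ 2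
    + 2 * a ^ 2 * (1 + 2 * M * r / S) * (sinSqDphi q v * dω)

theorem differentiableAt_radius {q : Fin 4 → ℝ} (hq : 0 < radius q) :
    DifferentiableAt ℝ radius q := by
  have h : q 1 ^ 2 + q 2 ^ 2 + q 3 ^ 2 ≠ 0 := by
    intro h; simp [radius, h] at hq
  unfold radius
  exact DifferentiableAt.sqrt (by fun_prop) h

theorem sigma_pos {a : ℝ} {q : Fin 4 → ℝ} (hq : 0 < radius q) : 0 < sigma a q := by
  unfold sigma; positivity

theorem differentiableAt_metric (M a : ℝ) {q : Fin 4 → ℝ} (v w : Fin 4 → ℝ) (hq : 0 < radius q)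
    (hD : delta M a (radius q) ≠ 0) : DifferentiableAt ℝ (fun x => metric M a x v w) q := by
  have hr := differentiableAt_radius hq
  have hdiv : ∀ {f g : (Fin 4 → ℝ) → ℝ}, DifferentiableAt ℝ f q → DifferentiableAt ℝ g q →
      g q ≠ 0 → DifferentiableAt ℝ (fun x => f x / g x) q := fun hf hg h => by
    simp only [div_eq_mul_inv]
    exact hf.mul (hg.inv h)
  have hdr : ∀ v, DifferentiableAt ℝ (fun x => dr x v) q := fun v => by
    unfold dr; exact hdiv (by fun_prop) hr hq.ne'
  have hph : ∀ v, DifferentiableAt ℝ (fun x => sinSqDphi x v) q := fun v => by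
    unfold sinSqDphi
    exact hdiv (by fun_prop) (hr.pow 2) (pow_ne_zero 2 hq.ne')
  have hz : DifferentiableAt ℝ (fun x : Fin 4 → ℝ => x 3 / radius x) q :=
    hdiv (by fun_prop) hr hq.ne'
  have hs : DifferentiableAt ℝ (fun x => sigma a x) q := by
    unfold sigma; fun_prop
  have hsn := (sigma_pos (a := a) hq).ne'
  have hF : DifferentiableAt ℝ (fun x => 2 * M * radius x / sigma a x) q :=
    hdiv (hr.const_mul _) hs hsn
  have hF' : DifferentiableAt ℝ (fun x => 2 * M * a * radius x / sigma a x) q :=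
    hdiv (hr.const_mul _) hs hsn
  have hdel : DifferentiableAt ℝ (fun x => delta M a (radius x)) q := by
    unfold delta; fun_prop
  have hSD : DifferentiableAt ℝ (fun x => sigma a x / delta M a (radius x)) q := hdiv hs hdel hD
  have hSr : DifferentiableAt ℝ (fun x => sigma a x / radius x ^ 2) q :=
    hdiv hs (hr.pow 2) (pow_ne_zero 2 hq.ne')
  have h1 := hdr v; have h2 := hdr w; have h3 := hph v; have h4 := hph w
  unfold metric
  fun_prop

theorem hasDerivAt_line (q w : Fin 4 → ℝ) (i : Fin 4) (h : ℝ) :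
    HasDerivAt (fun h : ℝ => (q + h • w) i) (w i) h := by
  simpa using ((hasDerivAt_id h).mul_const (w i)).const_add (q i)

theorem hasDerivAt_radius_line {q : Fin 4 → ℝ} (w : Fin 4 → ℝ) (hq : 0 < radius q) :
    HasDerivAt (fun h : ℝ => radius (q + h • w)) (dr q w) 0 := by
  have h : q 1 ^ 2 + q 2 ^ 2 + q 3 ^ 2 ≠ 0 := by
    intro h; simp [radius, h] at hq
  have hd := (((hasDerivAt_line q w 1 0).pow 2).add ((hasDerivAt_line q w 2 0).pow 2)).add
    ((hasDerivAt_line q w 3 0).pow 2)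
  have := hd.sqrt (by simpa using h)
  refine this.congr_deriv ?_
  simp only [dr, radius, zero_smul, add_zero, Nat.cast_ofNat, Pi.add_apply, Pi.pow_apply,
    Pi.zero_apply, Nat.add_one_sub_one, pow_one]
  field_simp

theorem hasDerivAt_metric_line (M a : ℝ) {q : Fin 4 → ℝ} (v w : Fin 4 → ℝ) (hq : 0 < radius q)
    (hD : delta M a (radius q) ≠ 0) :
    HasDerivAt (fun h : ℝ => metric M a (q + h • w) v v) (metricDeriv M a q v w) 0 := by
  have hr := hasDerivAt_radius_line w hq
  have hq0 : q + (0 : ℝ) • w = q := by simp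
  have hrn : radius (q + (0 : ℝ) • w) ≠ 0 := by rw [hq0]; exact hq.ne'
  have hsn : sigma a (q + (0 : ℝ) • w) ≠ 0 := by rw [hq0]; exact (sigma_pos hq).ne'
  have hDn : delta M a (radius (q + (0 : ℝ) • w)) ≠ 0 := by rwa [hq0]
  have hl := hasDerivAt_line q w
  have hdr : HasDerivAt (fun h : ℝ => dr (q + h • w) v)
      ((v 1 * w 1 + v 2 * w 2 + v 3 * w 3 - dr q v * dr q w) / radius q) 0 := by
    have := ((((hl 1 0).mul_const (v 1)).add ((hl 2 0).mul_const (v 2))).add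
      ((hl 3 0).mul_const (v 3))).div hr hrn
    refine this.congr_deriv ?_
    simp only [Pi.add_apply, zero_smul, Pi.zero_apply, add_zero, dr]
    have := hq.ne'
    field_simp
  have hph : HasDerivAt (fun h : ℝ => sinSqDphi (q + h • w) v)
      ((w 1 * v 2 - w 2 * v 1) / radius q ^ 2 - 2 * sinSqDphi q v * dr q w / radius q) 0 := by
    have := (((hl 1 0).mul_const (v 2)).sub ((hl 2 0).mul_const (v 1))).div (hr.pow 2)
      (pow_ne_zero 2 hrn)
    refine this.congr_deriv ?_
    simp only [Pi.sub_apply, Pi.add_apply, zero_smul, Pi.zero_apply, add_zero,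
      Pi.pow_apply, sinSqDphi]
    have := hq.ne'
    field_simp
    push_cast
    ring
  have hz : HasDerivAt (fun h : ℝ => (q + h • w) 3 / radius (q + h • w))
      ((w 3 - q 3 / radius q * dr q w) / radius q) 0 := by
    refine ((hl 3 0).div hr hrn).congr_deriv ?_
    simp only [hq0]
    have := hq.ne'
    field_simp
  have hS : HasDerivAt (fun h : ℝ => sigma a (q + h • w))
      (2 * radius q * dr q w
        + 2 * a ^ 2 * (q 3 / radius q) * ((w 3 - q 3 / radius q * dr q w) / radius q)) 0 := by
    refine ((hr.pow 2).add ((hz.pow 2).const_mul (a ^ 2))).congr_deriv ?_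
    simp only [hq0]
    push_cast
    ring
  have hDel : HasDerivAt (fun h : ℝ => delta M a (radius (q + h • w)))
      ((2 * radius q - 2 * M) * dr q w) 0 := by
    refine (((hr.pow 2).sub (hr.const_mul (2 * M))).add_const (a ^ 2)).congr_deriv ?_
    simp only [hq0]
    push_cast
    ring
  have hF := (hr.const_mul (2 * M)).div hS hsn
  have hF' := (hr.const_mul (2 * M * a)).div hS hsn
  have key := ((((((hF.const_sub 1).neg.mul_const (v 0 * v 0)).sub
    (hF'.mul ((hph.const_mul (v 0)).add (hph.const_mul (v 0))))).add
    ((hS.div hDel hDn).mul (hdr.mul hdr))).add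
    ((hS.div (hr.pow 2) (pow_ne_zero 2 hrn)).mul
      ((hdr.mul hdr).const_sub (v 1 * v 1 + v 2 * v 2 + v 3 * v 3)))).add
    (((hF.const_add 1).const_mul (a ^ 2)).mul (hph.mul hph)))
  refine key.congr_deriv ?_
  simp only [metricDeriv, hq0, Pi.add_apply, Pi.mul_apply, Pi.div_apply, Pi.pow_apply]
  rw [hq0] at hsn hDn hrn
  generalize dr q w = wr at *
  generalize dr q v = vr at *
  generalize sinSqDphi q v = ω at *
  generalize sigma a q = S at *
  generalize delta M a (radius q) = D at *
  generalize radius q = r at *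
  field_simp
  push_cast
  ring

theorem fderiv_metric (M a : ℝ) {q : Fin 4 → ℝ} (v w : Fin 4 → ℝ) (hq : 0 < radius q)
    (hD : delta M a (radius q) ≠ 0) :
    fderiv ℝ (fun x => metric M a x v v) q w = metricDeriv M a q v w := by
  have h1 := (differentiableAt_metric M a v v hq hD).hasFDerivAt.hasLineDerivAt w
  exact HasDerivAt.unique h1 (hasDerivAt_metric_line M a v w hq hD)

/-! ### Separated null geodesics -/

/-- `X = E (r² + a²) - a L`. -/
def carterX (a E L r : ℝ) : ℝ := E * (r ^ 2 + a ^ 2) - a * L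

/-- The data of a curve in the exterior region: the time `t`, the radius `r`, the unit vector `n` in
the direction of the spatial position, the radial momentum `ρ = Δ p_r` and the angular momentum
covector `m`, a vector of `ℝ³` orthogonal to `n`. -/
structure Orbit where
  /-- time -/
  t : ℝ → ℝ
  /-- radius -/
  r : ℝ → ℝ
  /-- radial momentum, multiplied by `Δ` -/
  ρ : ℝ → ℝ
  /-- first component of the direction -/
  n₁ : ℝ → ℝ
  /-- second component of the direction -/
  n₂ : ℝ → ℝ
  /-- third component of the direction -/
  n₃ : ℝ → ℝ
  /-- first component of the angular momentum covector -/
  m₁ : ℝ → ℝ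
  /-- second component of the angular momentum covector -/
  m₂ : ℝ → ℝ
  /-- third component of the angular momentum covector -/
  m₃ : ℝ → ℝ

/-- The curve of events belonging to an orbit. -/
def Orbit.curve (o : Orbit) (s : ℝ) : Fin 4 → ℝ :=
  ![o.t s, o.r s * o.n₁ s, o.r s * o.n₂ s, o.r s * o.n₃ s]

/-- Carter's separated equations of motion for a null geodesic with energy `E`, axial angular
momentum `L` and Carter constant `K`, in a parameter `s` with `dλ = h ds`, where `λ` is Mino time
(`Σ dλ` is the differential of an affine parameter).  In Mino time the radius moves in the
potential `-(X² - Δ K) / 2`, and up to a rotation about the axis `n` moves on the unit sphere in the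
potential `-a² E² n₃² / 2`. -/
structure Orbit.IsMotion (M a E L K : ℝ) (o : Orbit) (h : ℝ → ℝ) (J : Set ℝ) : Prop where
  deriv_t : ∀ s ∈ J, HasDerivAt o.t (h s * ((o.r s ^ 2 + a ^ 2) * carterX a E L (o.r s)
    / delta M a (o.r s) + a * (L - a * E * (1 - o.n₃ s ^ 2)))) s
  deriv_r : ∀ s ∈ J, HasDerivAt o.r (h s * o.ρ s) s
  deriv_ρ : ∀ s ∈ J, HasDerivAt o.ρ
    (h s * (2 * E * o.r s * carterX a E L (o.r s) - (o.r s - M) * K)) s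
  deriv_n₁ : ∀ s ∈ J, HasDerivAt o.n₁ (h s * (o.m₁ s
    - (a * carterX a E L (o.r s) / delta M a (o.r s) - a * E) * o.n₂ s)) s
  deriv_n₂ : ∀ s ∈ J, HasDerivAt o.n₂ (h s * (o.m₂ s
    + (a * carterX a E L (o.r s) / delta M a (o.r s) - a * E) * o.n₁ s)) s
  deriv_n₃ : ∀ s ∈ J, HasDerivAt o.n₃ (h s * o.m₃ s) s
  deriv_m₁ : ∀ s ∈ J, HasDerivAt o.m₁
    (h s * (-(o.m₁ s ^ 2 + o.m₂ s ^ 2 + o.m₃ s ^ 2 + (a * E) ^ 2 * o.n₃ s ^ 2) * o.n₁ s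
    - (a * carterX a E L (o.r s) / delta M a (o.r s) - a * E) * o.m₂ s)) s
  deriv_m₂ : ∀ s ∈ J, HasDerivAt o.m₂
    (h s * (-(o.m₁ s ^ 2 + o.m₂ s ^ 2 + o.m₃ s ^ 2 + (a * E) ^ 2 * o.n₃ s ^ 2) * o.n₂ s
    + (a * carterX a E L (o.r s) / delta M a (o.r s) - a * E) * o.m₁ s)) s
  deriv_m₃ : ∀ s ∈ J, HasDerivAt o.m₃
    (h s * (-(o.m₁ s ^ 2 + o.m₂ s ^ 2 + o.m₃ s ^ 2 + (a * E) ^ 2 * o.n₃ s ^ 2) * o.n₃ s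
    + (a * E) ^ 2 * o.n₃ s)) s
  unit : ∀ s ∈ J, o.n₁ s ^ 2 + o.n₂ s ^ 2 + o.n₃ s ^ 2 = 1
  orthogonal : ∀ s ∈ J, o.n₁ s * o.m₁ s + o.n₂ s * o.m₂ s + o.n₃ s * o.m₃ s = 0
  axial : ∀ s ∈ J, o.n₁ s * o.m₂ s - o.n₂ s * o.m₁ s = L
  carter : ∀ s ∈ J, o.m₁ s ^ 2 + o.m₂ s ^ 2 + o.m₃ s ^ 2
    = K + 2 * a * E * L - (a * E) ^ 2 * (1 - o.n₃ s ^ 2)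
  radial : ∀ s ∈ J, o.ρ s ^ 2 = carterX a E L (o.r s) ^ 2 - delta M a (o.r s) * K
  exterior : ∀ s ∈ J, rPlus M a < o.r s

/-- The velocity, with respect to an affine parameter, of an orbit with the given position and
momentum. -/
noncomputable def orbitVelocity (M a E L r ρ n₁ n₂ n₃ m₁ m₂ m₃ : ℝ) : Fin 4 → ℝ :=
  let Ω := a * carterX a E L r / delta M a r - a * E
  let S := r ^ 2 + a ^ 2 * n₃ ^ 2
  ![((r ^ 2 + a ^ 2) * carterX a E L r / delta M a r + a * (L - a * E * (1 - n₃ ^ 2))) / S,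
    (ρ * n₁ + r * (m₁ - Ω * n₂)) / S, (ρ * n₂ + r * (m₂ + Ω * n₁)) / S, (ρ * n₃ + r * m₃) / S]

section algebra

variable {M a E L K t r ρ n₁ n₂ n₃ m₁ m₂ m₃ : ℝ}

theorem radius_polar (hr : 0 < r) (hn : n₁ ^ 2 + n₂ ^ 2 + n₃ ^ 2 = 1) :
    radius ![t, r * n₁, r * n₂, r * n₃] = r := by
  have h : (r * n₁) ^ 2 + (r * n₂) ^ 2 + (r * n₃) ^ 2 = r ^ 2 := by
    linear_combination r ^ 2 * hn
  simp [radius, h, Real.sqrt_sq hr.le]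

theorem sigma_polar (hr : 0 < r) (hn : n₁ ^ 2 + n₂ ^ 2 + n₃ ^ 2 = 1) :
    sigma a ![t, r * n₁, r * n₂, r * n₃] = r ^ 2 + a ^ 2 * n₃ ^ 2 := by
  rw [sigma, radius_polar hr hn]
  simp [hr.ne']

theorem dr_polar (hr : 0 < r) (hn : n₁ ^ 2 + n₂ ^ 2 + n₃ ^ 2 = 1) (w : Fin 4 → ℝ) :
    dr ![t, r * n₁, r * n₂, r * n₃] w = n₁ * w 1 + n₂ * w 2 + n₃ * w 3 := by
  rw [dr, radius_polar hr hn]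
  simp only [Matrix.cons_val]
  field_simp

theorem sinSqDphi_polar (hr : 0 < r) (hn : n₁ ^ 2 + n₂ ^ 2 + n₃ ^ 2 = 1) (w : Fin 4 → ℝ) :
    sinSqDphi ![t, r * n₁, r * n₂, r * n₃] w = (n₁ * w 2 - n₂ * w 1) / r := by
  rw [sinSqDphi, radius_polar hr hn]
  simp only [Matrix.cons_val]
  field_simp

theorem orbitVelocity_pairings (hr : 0 < r)
    (hn : n₁ ^ 2 + n₂ ^ 2 + n₃ ^ 2 = 1) (hnm : n₁ * m₁ + n₂ * m₂ + n₃ * m₃ = 0)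
    (hL : n₁ * m₂ - n₂ * m₁ = L) {Ω S : ℝ} (hS : S ≠ 0) {V : Fin 4 → ℝ}
    (v1 : V 1 = (ρ * n₁ + r * (m₁ - Ω * n₂)) / S) (v2 : V 2 = (ρ * n₂ + r * (m₂ + Ω * n₁)) / S)
    (v3 : V 3 = (ρ * n₃ + r * m₃) / S) (w : Fin 4 → ℝ) :
    n₁ * V 1 + n₂ * V 2 + n₃ * V 3 = ρ / S ∧
    (n₁ * V 2 - n₂ * V 1) / r = (L + Ω * (1 - n₃ ^ 2)) / S ∧
    V 1 * w 1 + V 2 * w 2 + V 3 * w 3 = (ρ * (n₁ * w 1 + n₂ * w 2 + n₃ * w 3)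
      + r * (m₁ * w 1 + m₂ * w 2 + m₃ * w 3) + r * Ω * (n₁ * w 2 - n₂ * w 1)) / S := by
  refine ⟨?_, ?_, ?_⟩
  · rw [v1, v2, v3]; field_simp
    linear_combination ρ * hn + r * hnm
  · rw [v1, v2]; field_simp
    linear_combination r * Ω * hn + r * hL
  · rw [v1, v2, v3]; field_simp
    ring

/-- The covector `g(γ', ·)` of an orbit is `-E dt + (ρ / Δ) dr + m · dn`. -/
theorem metric_orbitVelocity (hr : 0 < r) (hD : delta M a r ≠ 0)
    (hn : n₁ ^ 2 + n₂ ^ 2 + n₃ ^ 2 = 1) (hnm : n₁ * m₁ + n₂ * m₂ + n₃ * m₃ = 0)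
    (hL : n₁ * m₂ - n₂ * m₁ = L) (w : Fin 4 → ℝ) :
    metric M a ![t, r * n₁, r * n₂, r * n₃]
      (orbitVelocity M a E L r ρ n₁ n₂ n₃ m₁ m₂ m₃) w
      = -E * w 0 + ρ / delta M a r * (n₁ * w 1 + n₂ * w 2 + n₃ * w 3)
        + (m₁ * w 1 + m₂ * w 2 + m₃ * w 3) / r := by
  have hS : r ^ 2 + a ^ 2 * n₃ ^ 2 ≠ 0 := by positivity
  set V := orbitVelocity M a E L r ρ n₁ n₂ n₃ m₁ m₂ m₃ with hV
  set Ω := a * carterX a E L r / delta M a r - a * E with hΩ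
  set S := r ^ 2 + a ^ 2 * n₃ ^ 2 with hSdef
  have v0 : V 0 = ((r ^ 2 + a ^ 2) * carterX a E L r
        / delta M a r + a * (L - a * E * (1 - n₃ ^ 2))) / S := rfl
  have v1 : V 1 = (ρ * n₁ + r * (m₁ - Ω * n₂)) / S := rfl
  have v2 : V 2 = (ρ * n₂ + r * (m₂ + Ω * n₁)) / S := rfl
  have v3 : V 3 = (ρ * n₃ + r * m₃) / S := rfl
  obtain ⟨hdr, hph, hvw⟩ := orbitVelocity_pairings hr hn hnm hL hS v1 v2 v3 w
  rw [metric, sigma_polar hr hn, radius_polar hr hn, dr_polar hr hn, dr_polar hr hn,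
    sinSqDphi_polar hr hn, sinSqDphi_polar hr hn, hdr, hph, hvw, v0]
  generalize n₁ * w 1 + n₂ * w 2 + n₃ * w 3 = A
  generalize m₁ * w 1 + m₂ * w 2 + m₃ * w 3 = B
  generalize n₁ * w 2 - n₂ * w 1 = C
  generalize w 0 = w0
  rw [hΩ]
  have hr0 := hr.ne'
  clear_value S
  field_simp
  rw [hSdef]
  simp only [carterX, delta]
  ring

/-- Hamilton's equation for the momentum of an orbit, paired with a constant vector `w`. -/
theorem metricDeriv_orbitVelocity (hr : 0 < r) (hD : delta M a r ≠ 0)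
    (hn : n₁ ^ 2 + n₂ ^ 2 + n₃ ^ 2 = 1) (hnm : n₁ * m₁ + n₂ * m₂ + n₃ * m₃ = 0)
    (hL : n₁ * m₂ - n₂ * m₁ = L)
    (hK : m₁ ^ 2 + m₂ ^ 2 + m₃ ^ 2 = K + 2 * a * E * L - (a * E) ^ 2 * (1 - n₃ ^ 2))
    (hρ : ρ ^ 2 = carterX a E L r ^ 2 - delta M a r * K) (w : Fin 4 → ℝ) :
    metricDeriv M a ![t, r * n₁, r * n₂, r * n₃]
      (orbitVelocity M a E L r ρ n₁ n₂ n₃ m₁ m₂ m₃) w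
      = 2 / (r ^ 2 + a ^ 2 * n₃ ^ 2) *
        (((2 * E * r * carterX a E L r - (r - M) * K) / delta M a r
          - 2 * ρ ^ 2 * (r - M) / delta M a r ^ 2) * (n₁ * w 1 + n₂ * w 2 + n₃ * w 3)
        + ρ / delta M a r * ((m₁ * w 1 + m₂ * w 2 + m₃ * w 3)
          + (a * carterX a E L r / delta M a r - a * E) * (n₁ * w 2 - n₂ * w 1))
        + (-(m₁ ^ 2 + m₂ ^ 2 + m₃ ^ 2 + (a * E) ^ 2 * n₃ ^ 2) * (n₁ * w 1 + n₂ * w 2 + n₃ * w 3)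
          + (a * E) ^ 2 * n₃ * w 3
          + (a * carterX a E L r / delta M a r - a * E) * (m₁ * w 2 - m₂ * w 1)) / r
        - ρ * (m₁ * w 1 + m₂ * w 2 + m₃ * w 3) / r ^ 2) := by
  have hS : r ^ 2 + a ^ 2 * n₃ ^ 2 ≠ 0 := by positivity
  have hKe : K = (carterX a E L r ^ 2 - ρ ^ 2) / delta M a r := by
    rw [eq_div_iff hD]; linarith
  set V := orbitVelocity M a E L r ρ n₁ n₂ n₃ m₁ m₂ m₃ with hV
  set Ω := a * carterX a E L r / delta M a r - a * E with hΩ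
  set S := r ^ 2 + a ^ 2 * n₃ ^ 2 with hSdef
  have v0 : V 0 = ((r ^ 2 + a ^ 2) * carterX a E L r
        / delta M a r + a * (L - a * E * (1 - n₃ ^ 2))) / S := rfl
  have v1 : V 1 = (ρ * n₁ + r * (m₁ - Ω * n₂)) / S := rfl
  have v2 : V 2 = (ρ * n₂ + r * (m₂ + Ω * n₁)) / S := rfl
  have v3 : V 3 = (ρ * n₃ + r * m₃) / S := rfl
  obtain ⟨hdr, hph, hvw⟩ := orbitVelocity_pairings hr hn hnm hL hS v1 v2 v3 w
  have hwv : w 1 * V 2 - w 2 * V 1 = -(ρ * (n₁ * w 2 - n₂ * w 1) + r * (m₁ * w 2 - m₂ * w 1)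
      + r * Ω * (n₃ * w 3 - (n₁ * w 1 + n₂ * w 2 + n₃ * w 3))) / S := by
    rw [v1, v2]; field_simp
    ring
  have hvv : V 1 ^ 2 + V 2 ^ 2 + V 3 ^ 2 = (ρ ^ 2 + r ^ 2 * (K + 2 * a * E * L
      - (a * E) ^ 2 * (1 - n₃ ^ 2) + 2 * Ω * L + Ω ^ 2 * (1 - n₃ ^ 2))) / S ^ 2 := by
    rw [v1, v2, v3]; field_simp
    linear_combination (ρ ^ 2 + r ^ 2 * Ω ^ 2) * hn + 2 * r * ρ * hnm + 2 * r ^ 2 * Ω * hL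
      + r ^ 2 * hK
  rw [metricDeriv, sigma_polar hr hn, radius_polar hr hn, dr_polar hr hn, dr_polar hr hn,
    sinSqDphi_polar hr hn, hdr, hph, hvw, hwv, hvv, v0, hK]
  have hz : (![t, r * n₁, r * n₂, r * n₃] : Fin 4 → ℝ) 3 / r = n₃ := by
    simp [hr.ne']
  rw [hz]
  generalize n₁ * w 1 + n₂ * w 2 + n₃ * w 3 = A
  generalize m₁ * w 1 + m₂ * w 2 + m₃ * w 3 = B
  generalize n₁ * w 2 - n₂ * w 1 = C
  generalize m₁ * w 2 - m₂ * w 1 = F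
  generalize w 3 = w3
  clear hvv hwv hvw hdr hph v0 v1 v2 v3 hV hK hL hnm hn
  clear_value V
  rw [hΩ, hKe]
  have hr0 := hr.ne'
  clear_value S
  field_simp
  rw [hSdef]
  simp only [carterX, delta]
  ring

end algebra

/-! ### Motions and the geodesic equation -/

theorem contDiffOn_succ_of_hasDerivAt {f g : ℝ → ℝ} {J : Set ℝ} (hJ : IsOpen J) (n : ℕ)
    (hf : ∀ s ∈ J, HasDerivAt f (g s) s) (hg : ContDiffOn ℝ n g J) :
    ContDiffOn ℝ (n + 1 : ℕ) f J := by
  push_cast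
  rw [contDiffOn_succ_iff_deriv_of_isOpen hJ]
  refine ⟨fun s hs => (hf s hs).differentiableAt.differentiableWithinAt, by simp, ?_⟩
  exact hg.congr fun s hs => (hf s hs).deriv

theorem rMinus_lt_rPlus {M a : ℝ} (ha : 0 ≤ a) (haM : a < M) : rMinus M a < rPlus M a := by
  have : 0 < √(M ^ 2 - a ^ 2) := Real.sqrt_pos.2 (by nlinarith)
  simp only [rMinus, rPlus]
  linarith

theorem lt_rPlus {M a : ℝ} (ha : 0 ≤ a) (haM : a < M) : M < rPlus M a := by
  have : 0 < √(M ^ 2 - a ^ 2) := Real.sqrt_pos.2 (by nlinarith)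
  simp only [rPlus]
  linarith

theorem rPlus_pos {M a : ℝ} (ha : 0 ≤ a) (haM : a < M) : 0 < rPlus M a := by
  linarith [lt_rPlus ha haM]

theorem delta_rPlus {M a : ℝ} (ha : 0 ≤ a) (haM : a < M) : delta M a (rPlus M a) = 0 := by
  rw [delta_eq M a _ (by nlinarith)]
  simp

theorem delta_pos {M a r : ℝ} (ha : 0 ≤ a) (haM : a < M) (hr : rPlus M a < r) :
    0 < delta M a r := by
  rw [delta_eq M a r (by nlinarith)]
  have := rMinus_lt_rPlus ha haM
  exact mul_pos (by linarith) (by linarith)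

/-- The velocity of an orbit in its affine parameter. -/
noncomputable def Orbit.velocity (M a E L : ℝ) (o : Orbit) (s : ℝ) : Fin 4 → ℝ :=
  orbitVelocity M a E L (o.r s) (o.ρ s) (o.n₁ s) (o.n₂ s) (o.n₃ s) (o.m₁ s) (o.m₂ s) (o.m₃ s)

namespace Orbit.IsMotion

variable {M a E L K : ℝ} {o : Orbit} {J : Set ℝ}

theorem hasDerivAt_curve (ha : 0 ≤ a) (haM : a < M)
    (H : o.IsMotion M a E L K (fun s => 1 / (o.r s ^ 2 + a ^ 2 * o.n₃ s ^ 2)) J) {s : ℝ}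
    (hs : s ∈ J) : HasDerivAt o.curve (o.velocity M a E L s) s := by
  have hr : 0 < o.r s := (rPlus_pos ha haM).trans (H.exterior s hs)
  have hS : o.r s ^ 2 + a ^ 2 * o.n₃ s ^ 2 ≠ 0 := by positivity
  rw [hasDerivAt_pi]
  intro i
  fin_cases i
  · refine (H.deriv_t s hs).congr_deriv ?_
    simp [velocity, orbitVelocity]
    field_simp
  · refine ((H.deriv_r s hs).mul (H.deriv_n₁ s hs)).congr_deriv ?_
    simp [velocity, orbitVelocity]
    field_simp
  · refine ((H.deriv_r s hs).mul (H.deriv_n₂ s hs)).congr_deriv ?_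
    simp [velocity, orbitVelocity]
    field_simp
  · refine ((H.deriv_r s hs).mul (H.deriv_n₃ s hs)).congr_deriv ?_
    simp [velocity, orbitVelocity]
    field_simp

/-- Smoothness of an orbit, bootstrapped from its equations of motion. -/
theorem contDiffOn (ha : 0 ≤ a) (haM : a < M) (hJ : IsOpen J)
    (H : o.IsMotion M a E L K (fun s => 1 / (o.r s ^ 2 + a ^ 2 * o.n₃ s ^ 2)) J) (n : ℕ) :
    (ContDiffOn ℝ n o.t J ∧ ContDiffOn ℝ n o.r J ∧ ContDiffOn ℝ n o.ρ J) ∧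
    (ContDiffOn ℝ n o.n₁ J ∧ ContDiffOn ℝ n o.n₂ J ∧ ContDiffOn ℝ n o.n₃ J) ∧
    (ContDiffOn ℝ n o.m₁ J ∧ ContDiffOn ℝ n o.m₂ J ∧ ContDiffOn ℝ n o.m₃ J) := by
  induction n with
  | zero =>
    simp only [Nat.cast_zero, contDiffOn_zero]
    exact ⟨⟨fun s hs => (H.deriv_t s hs).continuousAt.continuousWithinAt,
      fun s hs => (H.deriv_r s hs).continuousAt.continuousWithinAt,
      fun s hs => (H.deriv_ρ s hs).continuousAt.continuousWithinAt⟩,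
      ⟨fun s hs => (H.deriv_n₁ s hs).continuousAt.continuousWithinAt,
      fun s hs => (H.deriv_n₂ s hs).continuousAt.continuousWithinAt,
      fun s hs => (H.deriv_n₃ s hs).continuousAt.continuousWithinAt⟩,
      fun s hs => (H.deriv_m₁ s hs).continuousAt.continuousWithinAt,
      fun s hs => (H.deriv_m₂ s hs).continuousAt.continuousWithinAt,
      fun s hs => (H.deriv_m₃ s hs).continuousAt.continuousWithinAt⟩
  | succ n ih =>
    obtain ⟨⟨ct, cr, cρ⟩, ⟨c1, c2, c3⟩, d1, d2, d3⟩ := ih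
    have hrp : ∀ s ∈ J, 0 < o.r s := fun s hs => (rPlus_pos ha haM).trans (H.exterior s hs)
    have hS : ContDiffOn ℝ n (fun s => 1 / (o.r s ^ 2 + a ^ 2 * o.n₃ s ^ 2)) J :=
      contDiffOn_const.div (by fun_prop) fun s hs => by have := hrp s hs; positivity
    have hX : ContDiffOn ℝ n (fun s => carterX a E L (o.r s)) J := by
      unfold carterX; fun_prop
    have hD : ContDiffOn ℝ n (fun s => delta M a (o.r s)) J := by
      unfold delta; fun_prop
    have hDn : ∀ s ∈ J, delta M a (o.r s) ≠ 0 := fun s hs =>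
      (delta_pos ha haM (H.exterior s hs)).ne'
    have h1 : ContDiffOn ℝ n (fun s => (o.r s ^ 2 + a ^ 2) * carterX a E L (o.r s)
        / delta M a (o.r s)) J := ContDiffOn.div (by fun_prop) hD hDn
    have h2 : ContDiffOn ℝ n (fun s => a * carterX a E L (o.r s) / delta M a (o.r s)) J :=
      ContDiffOn.div (by fun_prop) hD hDn
    refine ⟨⟨contDiffOn_succ_of_hasDerivAt hJ n H.deriv_t ?_,
      contDiffOn_succ_of_hasDerivAt hJ n H.deriv_r ?_,
      contDiffOn_succ_of_hasDerivAt hJ n H.deriv_ρ ?_⟩,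
      ⟨contDiffOn_succ_of_hasDerivAt hJ n H.deriv_n₁ ?_,
      contDiffOn_succ_of_hasDerivAt hJ n H.deriv_n₂ ?_,
      contDiffOn_succ_of_hasDerivAt hJ n H.deriv_n₃ ?_⟩,
      contDiffOn_succ_of_hasDerivAt hJ n H.deriv_m₁ ?_,
      contDiffOn_succ_of_hasDerivAt hJ n H.deriv_m₂ ?_,
      contDiffOn_succ_of_hasDerivAt hJ n H.deriv_m₃ ?_⟩ <;> fun_prop

end Orbit.IsMotion

theorem metric_eq_sum (M a : ℝ) (q v w : Fin 4 → ℝ) :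
    metric M a q v w = ∑ i, v i * metric M a q (Pi.single i 1) w := by
  simp only [Fin.sum_univ_four, metric, dr, sinSqDphi]
  simp
  ring

/-- The product rule for `g(γ', w)`. -/
theorem hasDerivAt_metric_curve {M a : ℝ} {γ V : ℝ → Fin 4 → ℝ} {γ' V' : Fin 4 → ℝ} {s : ℝ}
    (hγ : HasDerivAt γ γ' s) (hV : HasDerivAt V V' s) (w : Fin 4 → ℝ) (hq : 0 < radius (γ s))
    (hD : delta M a (radius (γ s)) ≠ 0) :
    HasDerivAt (fun s => metric M a (γ s) (V s) w)
      (metric M a (γ s) V' w + fderiv ℝ (fun x => metric M a x (V s) w) (γ s) γ') s := by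
  have hi : ∀ i, HasDerivAt (fun s => metric M a (γ s) (Pi.single i 1) w)
      (fderiv ℝ (fun x => metric M a x (Pi.single i 1) w) (γ s) γ') s := fun i =>
    (differentiableAt_metric M a _ w hq hD).hasFDerivAt.comp_hasDerivAt s hγ
  have hf : fderiv ℝ (fun x => metric M a x (V s) w) (γ s) γ'
      = ∑ i, V s i * fderiv ℝ (fun x => metric M a x (Pi.single i 1) w) (γ s) γ' := by
    have : HasFDerivAt (fun x => metric M a x (V s) w)
        (∑ i, V s i • fderiv ℝ (fun x => metric M a x (Pi.single i 1) w) (γ s)) (γ s) := by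
      simp_rw [fun x => metric_eq_sum M a x (V s) w]
      exact HasFDerivAt.fun_sum fun i _ =>
        (differentiableAt_metric M a _ w hq hD).hasFDerivAt.const_mul (V s i)
    rw [this.fderiv]
    simp
  rw [hf, metric_eq_sum M a (γ s) V' w, ← Finset.sum_add_distrib]
  simp_rw [fun s => metric_eq_sum M a (γ s) (V s) w]
  exact HasDerivAt.fun_sum fun i _ => (hasDerivAt_pi.1 hV i).mul (hi i)

/-- A separated orbit, parametrised by affine time, is a geodesic. -/
theorem Orbit.IsMotion.isGeodesicOn {M a E L K : ℝ} {o : Orbit} {J : Set ℝ} (ha : 0 ≤ a)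
    (haM : a < M) (hJ : IsOpen J) (hJ' : J.OrdConnected)
    (H : o.IsMotion M a E L K (fun s => 1 / (o.r s ^ 2 + a ^ 2 * o.n₃ s ^ 2)) J) :
    IsGeodesicOn M a o.curve J := by
  have hrp : ∀ s ∈ J, 0 < o.r s := fun s hs => (rPlus_pos ha haM).trans (H.exterior s hs)
  have hrad : ∀ s ∈ J, radius (o.curve s) = o.r s := fun s hs =>
    radius_polar (hrp s hs) (H.unit s hs)
  have hDn : ∀ s ∈ J, delta M a (o.r s) ≠ 0 := fun s hs =>
      (delta_pos ha haM (H.exterior s hs)).ne'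
  have hsm : ContDiffOn ℝ 2 o.curve J := by
    obtain ⟨⟨ct, cr, -⟩, ⟨c1, c2, c3⟩, -⟩ := H.contDiffOn ha haM hJ 2
    rw [contDiffOn_pi]
    intro i
    fin_cases i
    · exact ct
    · exact cr.mul c1
    · exact cr.mul c2
    · exact cr.mul c3
  refine ⟨hJ, hJ', fun s hs => ?_, hsm, fun s hs w => ?_⟩
  · change rPlus M a < radius (o.curve s)
    rw [hrad s hs]; exact H.exterior s hs
  have hder : ∀ u ∈ J, deriv o.curve u = o.velocity M a E L u := fun u hu =>
    (H.hasDerivAt_curve ha haM hu).deriv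
  have hdd : DifferentiableAt ℝ (deriv o.curve) s := by
    have h1 := ((contDiffOn_succ_iff_deriv_of_isOpen (n := 1) hJ).1 hsm).2.2
    exact (h1.differentiableOn one_ne_zero).differentiableAt (hJ.mem_nhds hs)
  have h1 := hasDerivAt_metric_curve (M := M) (a := a)
    (H.hasDerivAt_curve ha haM hs).differentiableAt.hasDerivAt hdd.hasDerivAt w
    (by rw [hrad s hs]; exact hrp s hs) (by rw [hrad s hs]; exact hDn s hs)
  have hr0 := (hrp s hs).ne'
  have hD0 := hDn s hs
  -- The same derivative, computed from the formula for the momentum.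
  have h2 : HasDerivAt (fun s => metric M a (o.curve s) (deriv o.curve s) w)
      (metricDeriv M a (o.curve s) (o.velocity M a E L s) w / 2) s := by
    have hA := (((H.deriv_n₁ s hs).mul_const (w 1)).add ((H.deriv_n₂ s hs).mul_const (w 2))).add
      ((H.deriv_n₃ s hs).mul_const (w 3))
    have hB := (((H.deriv_m₁ s hs).mul_const (w 1)).add ((H.deriv_m₂ s hs).mul_const (w 2))).add
      ((H.deriv_m₃ s hs).mul_const (w 3))
    have hDel : HasDerivAt (fun u => delta M a (o.r u)) _ s :=
      (((H.deriv_r s hs).pow 2).sub ((H.deriv_r s hs).const_mul (2 * M))).add_const (a ^ 2)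
    have hp := ((((H.deriv_ρ s hs).div hDel hD0).mul hA).const_add (-E * w 0)).add
      (hB.div (H.deriv_r s hs) hr0)
    have hev : (fun s => metric M a (o.curve s) (deriv o.curve s) w) =ᶠ[𝓝 s]
        fun u => -E * w 0 + o.ρ u / delta M a (o.r u)
          * (o.n₁ u * w 1 + o.n₂ u * w 2 + o.n₃ u * w 3)
          + (o.m₁ u * w 1 + o.m₂ u * w 2 + o.m₃ u * w 3) / o.r u := by
      filter_upwards [hJ.mem_nhds hs] with u hu
      rw [hder u hu]
      exact metric_orbitVelocity (hrp u hu) (hDn u hu) (H.unit u hu) (H.orthogonal u hu)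
        (H.axial u hu) w
    refine (hp.congr_of_eventuallyEq hev).congr_deriv ?_
    rw [show metricDeriv M a (o.curve s) (o.velocity M a E L s) w = _ from
      metricDeriv_orbitVelocity (hrp s hs) hD0 (H.unit s hs) (H.orthogonal s hs)
        (H.axial s hs) (H.carter s hs) (H.radial s hs) w]
    simp only [Pi.add_apply, Pi.div_apply]
    have hS : o.r s ^ 2 + a ^ 2 * o.n₃ s ^ 2 ≠ 0 := by have := hrp s hs; positivity
    generalize carterX a E L (o.r s) = X at *
    generalize delta M a (o.r s) = D at *
    generalize o.m₁ s ^ 2 + o.m₂ s ^ 2 + o.m₃ s ^ 2 + (a * E) ^ 2 * o.n₃ s ^ 2 = m2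
    generalize o.r s ^ 2 + a ^ 2 * o.n₃ s ^ 2 = S at *
    field_simp
    push_cast
    ring
  have h3 := h1.unique h2
  rw [christoffel, ← fderiv_metric M a _ w (by rw [hrad s hs]; exact hrp s hs)
    (by rw [hrad s hs]; exact hDn s hs), ← hder s hs] at *
  linarith

/-! ### Orbits with a given radial motion -/

/-- The composition of an orbit with a change of parameter. -/
def Orbit.comp (o : Orbit) (l : ℝ → ℝ) : Orbit :=
  ⟨o.t ∘ l, o.r ∘ l, o.ρ ∘ l, o.n₁ ∘ l, o.n₂ ∘ l, o.n₃ ∘ l, o.m₁ ∘ l, o.m₂ ∘ l, o.m₃ ∘ l⟩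

theorem Orbit.IsMotion.comp {M a E L K : ℝ} {o : Orbit} {I J : Set ℝ}
    (H : o.IsMotion M a E L K (fun _ => 1) I) {l c : ℝ → ℝ} (hl : ∀ s ∈ J, l s ∈ I)
    (hd : ∀ s ∈ J, HasDerivAt l (c s) s) : (o.comp l).IsMotion M a E L K c J where
  deriv_t s hs := ((H.deriv_t _ (hl s hs)).comp s (hd s hs)).congr_deriv
    (by rw [one_mul]; exact mul_comm _ _)
  deriv_r s hs := ((H.deriv_r _ (hl s hs)).comp s (hd s hs)).congr_deriv
    (by rw [one_mul]; exact mul_comm _ _)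
  deriv_ρ s hs := ((H.deriv_ρ _ (hl s hs)).comp s (hd s hs)).congr_deriv
    (by rw [one_mul]; exact mul_comm _ _)
  deriv_n₁ s hs := ((H.deriv_n₁ _ (hl s hs)).comp s (hd s hs)).congr_deriv
    (by rw [one_mul]; exact mul_comm _ _)
  deriv_n₂ s hs := ((H.deriv_n₂ _ (hl s hs)).comp s (hd s hs)).congr_deriv
    (by rw [one_mul]; exact mul_comm _ _)
  deriv_n₃ s hs := ((H.deriv_n₃ _ (hl s hs)).comp s (hd s hs)).congr_deriv
    (by rw [one_mul]; exact mul_comm _ _)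
  deriv_m₁ s hs := ((H.deriv_m₁ _ (hl s hs)).comp s (hd s hs)).congr_deriv
    (by rw [one_mul]; exact mul_comm _ _)
  deriv_m₂ s hs := ((H.deriv_m₂ _ (hl s hs)).comp s (hd s hs)).congr_deriv
    (by rw [one_mul]; exact mul_comm _ _)
  deriv_m₃ s hs := ((H.deriv_m₃ _ (hl s hs)).comp s (hd s hs)).congr_deriv
    (by rw [one_mul]; exact mul_comm _ _)
  unit s hs := H.unit _ (hl s hs)
  orthogonal s hs := H.orthogonal _ (hl s hs)
  axial s hs := H.axial _ (hl s hs)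
  carter s hs := H.carter _ (hl s hs)
  radial s hs := H.radial _ (hl s hs)
  exterior s hs := H.exterior _ (hl s hs)

/-- The initial data of an orbit. -/
structure Orbit.HasData (o : Orbit) (t r ρ n₁ n₂ n₃ m₁ m₂ m₃ : ℝ) : Prop where
  t_zero : o.t 0 = t
  r_zero : o.r 0 = r
  ρ_zero : o.ρ 0 = ρ
  n₁_zero : o.n₁ 0 = n₁
  n₂_zero : o.n₂ 0 = n₂
  n₃_zero : o.n₃ 0 = n₃
  m₁_zero : o.m₁ 0 = m₁
  m₂_zero : o.m₂ 0 = m₂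
  m₃_zero : o.m₃ 0 = m₃

/-- The coordinates `t + ς r*` and `R_z(ς r♯) n` of an orbit at the parameters `f i` converge as `i`
tends along the filter `l`, the latter to a unit vector; here
`R_z` denotes rotations about the axis, and `ς` is `1` for ingoing and `-1` for outgoing
coordinates. -/
def Orbit.ChartConverges {ι : Type*} (M a ς : ℝ) (o : Orbit) (f : ι → ℝ) (l : Filter ι) : Prop :=
  ∃ u n₁ n₂ n₃ : ℝ, n₁ ^ 2 + n₂ ^ 2 + n₃ ^ 2 = 1 ∧
    Tendsto (fun i => o.t (f i) + ς * rStar M a (o.r (f i))) l (𝓝 u) ∧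
    Tendsto (fun i => Real.cos (ς * rSharp M a (o.r (f i))) * o.n₁ (f i)
      - Real.sin (ς * rSharp M a (o.r (f i))) * o.n₂ (f i)) l (𝓝 n₁) ∧
    Tendsto (fun i => Real.sin (ς * rSharp M a (o.r (f i))) * o.n₁ (f i)
      + Real.cos (ς * rSharp M a (o.r (f i))) * o.n₂ (f i)) l (𝓝 n₂) ∧
    Tendsto (fun i => o.n₃ (f i)) l (𝓝 n₃)

/-- A radial motion in Mino time, defined up to the time `Λ`, extends to an orbit.  The rates `A`
and `B` at which the Kerr coordinates `t + ς r*` and `φ + ς r♯` vary because of the radial motion are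
assumed to stay continuous at `Λ`, so that these coordinates converge there. -/
theorem exists_orbit {M a E L K ς η Λ : ℝ} (ha : 0 ≤ a) (haM : a < M) (hη : 0 < η) (hΛ : 0 < Λ)
    {r ρ A B : ℝ → ℝ} (hr : ∀ l ∈ Ioo (-η) Λ, HasDerivAt r (ρ l) l)
    (hρ : ∀ l ∈ Ioo (-η) Λ,
      HasDerivAt ρ (2 * E * r l * carterX a E L (r l) - (r l - M) * K) l)
    (hR : ∀ l ∈ Ioo (-η) Λ, ρ l ^ 2 = carterX a E L (r l) ^ 2 - delta M a (r l) * K)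
    (hext : ∀ l ∈ Ioo (-η) Λ, rPlus M a < r l)
    (hA : ContinuousOn A (Ioo (-η) (Λ + η))) (hB : ContinuousOn B (Ioo (-η) (Λ + η)))
    (hA' : ∀ l ∈ Ioo (-η) Λ,
      A l = (r l ^ 2 + a ^ 2) * (carterX a E L (r l) + ς * ρ l) / delta M a (r l))
    (hB' : ∀ l ∈ Ioo (-η) Λ, B l = a * (carterX a E L (r l) + ς * ρ l) / delta M a (r l))
    {n₁ n₂ n₃ m₁ m₂ m₃ : ℝ} (t₀ : ℝ) (hn : n₁ ^ 2 + n₂ ^ 2 + n₃ ^ 2 = 1)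
    (hnm : n₁ * m₁ + n₂ * m₂ + n₃ * m₃ = 0) (hL : n₁ * m₂ - n₂ * m₁ = L)
    (hK : m₁ ^ 2 + m₂ ^ 2 + m₃ ^ 2 = K + 2 * a * E * L - (a * E) ^ 2 * (1 - n₃ ^ 2)) :
    ∃ o : Orbit, o.IsMotion M a E L K (fun _ => 1) (Ioo (-η) Λ) ∧
      o.HasData t₀ (r 0) (ρ 0) n₁ n₂ n₃ m₁ m₂ m₃ ∧ o.r = r ∧
      o.ChartConverges M a ς id (𝓝[<] Λ) := by
  obtain ⟨ν₁, ν₂, ν₃, μ₁, μ₂, μ₃, ⟨i1, i2, i3, j1, j2, j3⟩, hν⟩ :=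
    exists_angular_motion (a * E) (T := Λ + η) (by linarith) n₁ n₂ n₃ m₁ m₂ m₃ hn hnm
  have h0 : (0 : ℝ) ∈ Ioo (-η) (Λ + η) := ⟨by linarith, by linarith⟩
  have h0' : (0 : ℝ) ∈ Ioo (-η) Λ := ⟨by linarith, by linarith⟩
  have hΛ' : Λ ∈ Ioo (-η) (Λ + η) := ⟨by linarith, by linarith⟩
  have hsub : Ioo (-η) (Λ + η) ⊆ Ioo (-(Λ + η)) (Λ + η) := Ioo_subset_Ioo_left (by linarith)
  have hsub' : Ioo (-η) Λ ⊆ Ioo (-η) (Λ + η) := Ioo_subset_Ioo_right (by linarith)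
  have c1 : ContinuousOn ν₁ (Ioo (-η) (Λ + η)) := fun l hl =>
    (hν l (hsub hl)).1.1.continuousAt.continuousWithinAt
  have c2 : ContinuousOn ν₂ (Ioo (-η) (Λ + η)) := fun l hl =>
    (hν l (hsub hl)).1.2.1.continuousAt.continuousWithinAt
  have c3 : ContinuousOn ν₃ (Ioo (-η) (Λ + η)) := fun l hl =>
    (hν l (hsub hl)).1.2.2.continuousAt.continuousWithinAt
  set U : ℝ → ℝ := fun l => ∫ u in (0)..l, (A u + a * (L - a * E * (1 - ν₃ u ^ 2))) with hU
  set Ψ : ℝ → ℝ := fun l => ∫ u in (0)..l, (B u - a * E) with hΨ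
  have dU : ∀ l ∈ Ioo (-η) (Λ + η), HasDerivAt U (A l + a * (L - a * E * (1 - ν₃ l ^ 2))) l :=
    fun l hl => hasDerivAt_integral (by fun_prop) h0 hl
  have dΨ : ∀ l ∈ Ioo (-η) (Λ + η), HasDerivAt Ψ (B l - a * E) l :=
    fun l hl => hasDerivAt_integral (by fun_prop) h0 hl
  set θ : ℝ → ℝ := fun l => ς * rSharp M a (r 0) + Ψ l with hθ
  set ψ : ℝ → ℝ := fun l => θ l - ς * rSharp M a (r l) with hψ
  have hD : ∀ l ∈ Ioo (-η) Λ, delta M a (r l) ≠ 0 := fun l hl =>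
    (delta_pos ha haM (hext l hl)).ne'
  have dψ : ∀ l ∈ Ioo (-η) Λ,
      HasDerivAt ψ (a * carterX a E L (r l) / delta M a (r l) - a * E) l := by
    intro l hl
    refine (((dΨ l (hsub' hl)).const_add _).sub
      (((hasDerivAt_rSharp M a _ ha haM (hext l hl)).comp l (hr l hl)).const_mul ς)).congr_deriv ?_
    rw [hB' l hl]
    have := hD l hl
    field_simp
    ring
  have hψ0 : ψ 0 = 0 := by simp [hψ, hθ, hΨ]
  let o : Orbit :=
    { t := fun l => t₀ + ς * rStar M a (r 0) + U l - ς * rStar M a (r l)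
      r := r
      ρ := ρ
      n₁ := fun l => Real.cos (ψ l) * ν₁ l - Real.sin (ψ l) * ν₂ l
      n₂ := fun l => Real.sin (ψ l) * ν₁ l + Real.cos (ψ l) * ν₂ l
      n₃ := ν₃
      m₁ := fun l => Real.cos (ψ l) * μ₁ l - Real.sin (ψ l) * μ₂ l
      m₂ := fun l => Real.sin (ψ l) * μ₁ l + Real.cos (ψ l) * μ₂ l
      m₃ := μ₃ }
  have hsc : ∀ l, Real.cos (ψ l) ^ 2 + Real.sin (ψ l) ^ 2 = 1 := fun l =>
    Real.cos_sq_add_sin_sq _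
  have hm2 : ∀ l, (Real.cos (ψ l) * μ₁ l - Real.sin (ψ l) * μ₂ l) ^ 2
      + (Real.sin (ψ l) * μ₁ l + Real.cos (ψ l) * μ₂ l) ^ 2 + μ₃ l ^ 2
      = μ₁ l ^ 2 + μ₂ l ^ 2 + μ₃ l ^ 2 := fun l => by
    linear_combination (μ₁ l ^ 2 + μ₂ l ^ 2) * hsc l
  have ν' := fun l (hl : l ∈ Ioo (-η) Λ) => hν l (hsub (hsub' hl))
  refine ⟨o, ⟨?_, ?_, ?_, ?_, ?_, ?_, ?_, ?_, ?_, ?_, ?_, ?_, ?_, ?_, ?_⟩, ?_, rfl, ?_⟩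
  · intro l hl
    refine (((dU l (hsub' hl)).const_add _).sub
      (((hasDerivAt_rStar M a _ ha haM (hext l hl)).comp l (hr l hl)).const_mul ς)).congr_deriv ?_
    rw [hA' l hl]
    have := hD l hl
    change _ = 1 * ((r l ^ 2 + a ^ 2) * carterX a E L (r l) / delta M a (r l)
      + a * (L - a * E * (1 - ν₃ l ^ 2)))
    field_simp
    ring
  · exact fun l hl => (hr l hl).congr_deriv (one_mul _).symm
  · exact fun l hl => (hρ l hl).congr_deriv (one_mul _).symm
  · intro l hl
    obtain ⟨⟨h1, h2, h3⟩, -⟩ := ν' l hl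
    refine (((dψ l hl).cos.mul h1).sub ((dψ l hl).sin.mul h2)).congr_deriv ?_
    simp only [o]
    ring
  · intro l hl
    obtain ⟨⟨h1, h2, h3⟩, -⟩ := ν' l hl
    refine (((dψ l hl).sin.mul h1).add ((dψ l hl).cos.mul h2)).congr_deriv ?_
    simp only [o]
    ring
  · exact fun l hl => (ν' l hl).1.2.2.congr_deriv (one_mul _).symm
  · intro l hl
    obtain ⟨-, ⟨h1, h2, h3⟩, -⟩ := ν' l hl
    refine (((dψ l hl).cos.mul h1).sub ((dψ l hl).sin.mul h2)).congr_deriv ?_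
    simp only [o, hm2]
    ring
  · intro l hl
    obtain ⟨-, ⟨h1, h2, h3⟩, -⟩ := ν' l hl
    refine (((dψ l hl).sin.mul h1).add ((dψ l hl).cos.mul h2)).congr_deriv ?_
    simp only [o, hm2]
    ring
  · intro l hl
    obtain ⟨-, ⟨h1, h2, h3⟩, -⟩ := ν' l hl
    refine h3.congr_deriv ?_
    simp only [o, hm2]
    ring
  · intro l hl
    simp only [o]
    linear_combination (ν₁ l ^ 2 + ν₂ l ^ 2) * hsc l + (ν' l hl).2.2.1
  · intro l hl
    simp only [o]
    linear_combination (ν₁ l * μ₁ l + ν₂ l * μ₂ l) * hsc l + (ν' l hl).2.2.2.1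
  · intro l hl
    simp only [o]
    linear_combination (ν₁ l * μ₂ l - ν₂ l * μ₁ l) * hsc l + (ν' l hl).2.2.2.2.1 + hL
  · intro l hl
    simp only [o, hm2]
    linear_combination (ν' l hl).2.2.2.2.2 + hK
  · exact hR
  · exact hext
  · constructor <;> simp [o, hψ0, i1, i2, i3, j1, j2, j3, hU]
  · have hrot1 : ∀ l, Real.cos (ς * rSharp M a (o.r l)) * o.n₁ l
        - Real.sin (ς * rSharp M a (o.r l)) * o.n₂ l
        = Real.cos (θ l) * ν₁ l - Real.sin (θ l) * ν₂ l := fun l => by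
      have : θ l = ς * rSharp M a (r l) + ψ l := by simp [hψ]
      rw [this, Real.cos_add, Real.sin_add]
      simp only [o]
      ring
    have hrot2 : ∀ l, Real.sin (ς * rSharp M a (o.r l)) * o.n₁ l
        + Real.cos (ς * rSharp M a (o.r l)) * o.n₂ l
        = Real.sin (θ l) * ν₁ l + Real.cos (θ l) * ν₂ l := fun l => by
      have : θ l = ς * rSharp M a (r l) + ψ l := by simp [hψ]
      rw [this, Real.cos_add, Real.sin_add]
      simp only [o]
      ring
    have cθ : ContinuousAt θ Λ := continuousAt_const.add (dΨ Λ hΛ').continuousAt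
    have cν := (hν Λ (hsub hΛ')).1
    have cν1 := cν.1.continuousAt
    have cν2 := cν.2.1.continuousAt
    have cos_θ : ContinuousAt (fun l => Real.cos (θ l)) Λ :=
      Real.continuous_cos.continuousAt.comp cθ
    have sin_θ : ContinuousAt (fun l => Real.sin (θ l)) Λ :=
      Real.continuous_sin.continuousAt.comp cθ
    refine ⟨t₀ + ς * rStar M a (r 0) + U Λ, Real.cos (θ Λ) * ν₁ Λ - Real.sin (θ Λ) * ν₂ Λ,
      Real.sin (θ Λ) * ν₁ Λ + Real.cos (θ Λ) * ν₂ Λ, ν₃ Λ, ?_, ?_, ?_, ?_, ?_⟩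
    · linear_combination (ν₁ Λ ^ 2 + ν₂ Λ ^ 2) * Real.cos_sq_add_sin_sq (θ Λ)
        + (hν Λ (hsub hΛ')).2.2.1
    · have : ∀ l, o.t l + ς * rStar M a (o.r l) = t₀ + ς * rStar M a (r 0) + U l := fun l => by
        simp only [o]; ring
      simp only [id, this]
      exact tendsto_nhdsWithin_of_tendsto_nhds
        (continuousAt_const.add (dU Λ hΛ').continuousAt).tendsto
    · simp only [id, hrot1]
      exact tendsto_nhdsWithin_of_tendsto_nhds ((cos_θ.mul cν1).sub (sin_θ.mul cν2)).tendsto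
    · simp only [id, hrot2]
      exact tendsto_nhdsWithin_of_tendsto_nhds ((sin_θ.mul cν1).add (cos_θ.mul cν2)).tendsto
    · exact tendsto_nhdsWithin_of_tendsto_nhds cν.2.2.continuousAt.tendsto

/-- An orbit defined up to the Mino time `Λ`, reparametrised by affine time: Mino time tends to `Λ`
at the future end of the interval of affine parameters. -/
theorem exists_affine_orbit {M a E L K η Λ : ℝ} (ha : 0 ≤ a) (haM : a < M) (hη : 0 < η)
    (hΛ : 0 < Λ) {o : Orbit} (H : o.IsMotion M a E L K (fun _ => 1) (Ioo (-η) Λ)) :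
    ∃ (J : Set ℝ) (l : ℝ → ℝ), IsOpen J ∧ J.OrdConnected ∧ (0 : ℝ) ∈ J ∧ l 0 = 0 ∧
      (o.comp l).IsMotion M a E L K
        (fun s => 1 / ((o.comp l).r s ^ 2 + a ^ 2 * (o.comp l).n₃ s ^ 2)) J ∧
      Tendsto (fun s : J => l s) atTop (𝓝[<] Λ) := by
  have hpos : ∀ u ∈ Ioo (-η) Λ, 0 < o.r u ^ 2 + a ^ 2 * o.n₃ u ^ 2 := fun u hu => by
    have := (rPlus_pos ha haM).trans (H.exterior u hu)
    positivity
  have hc : ContinuousOn (fun u => 1 / (o.r u ^ 2 + a ^ 2 * o.n₃ u ^ 2)) (Ioo (-η) Λ) := by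
    have h1 : ContinuousOn o.r (Ioo (-η) Λ) := fun u hu =>
      (H.deriv_r u hu).continuousAt.continuousWithinAt
    have h2 : ContinuousOn o.n₃ (Ioo (-η) Λ) := fun u hu =>
      (H.deriv_n₃ u hu).continuousAt.continuousWithinAt
    exact continuousOn_const.div (by fun_prop) fun u hu => (hpos u hu).ne'
  obtain ⟨J, l, hJ, hJ', h0, hl0, hd, hmono, himg⟩ := exists_solution_of_pos hc
    (fun u hu => one_div_pos.2 (hpos u hu)) (y₀ := 0) ⟨by linarith, hΛ⟩
  have hmem : ∀ s ∈ J, l s ∈ Ioo (-η) Λ := fun s hs => himg ▸ mem_image_of_mem l hs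
  refine ⟨J, l, hJ, hJ', h0, hl0, H.comp hmem hd, ?_⟩
  refine tendsto_nhdsWithin_iff.2 ⟨tendsto_order.2 ⟨fun c hc => ?_, fun c hc => ?_⟩,
    Eventually.of_forall fun s => (hmem s s.2).2⟩
  · obtain ⟨d, hd1, hd2⟩ := exists_between (max_lt hc (show -η < Λ by linarith))
    have hdI : d ∈ Ioo (-η) Λ := ⟨(le_max_right _ _).trans_lt hd1, hd2⟩
    rw [← himg] at hdI
    obtain ⟨s₀, hs₀, hs⟩ := hdI
    have : Nonempty J := ⟨⟨0, h0⟩⟩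
    filter_upwards [eventually_ge_atTop (⟨s₀, hs₀⟩ : J)] with s hs'
    have := hmono.monotoneOn hs₀ s.2 hs'
    exact (le_max_left _ _).trans_lt (hd1.trans_le (hs ▸ this))
  · exact Eventually.of_forall fun s => (hmem s s.2).2.trans hc

/-! ### One-dimensional motion up to a given point -/

/-- A continuous function that is positive on `[α, β]` is positive on a neighbourhood of it. -/
theorem exists_pos_of_pos_Icc {g : ℝ → ℝ} {α β η : ℝ} (hη : 0 < η) (hαβ : α ≤ β)
    (hg : ContinuousOn g (Ioo (α - η) (β + η))) (hpos : ∀ x ∈ Icc α β, 0 < g x) :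
    ∃ δ, 0 < δ ∧ δ ≤ η ∧ ∀ x ∈ Ioo (α - δ) (β + δ), 0 < g x := by
  have hnear : ∀ y ∈ Icc α β, ∃ δ > 0, ∀ x, |x - y| < δ → 0 < g x := by
    intro y hy
    have hc : ContinuousAt g y :=
      hg.continuousAt (Ioo_mem_nhds (by linarith [hy.1]) (by linarith [hy.2]))
    obtain ⟨δ, hδ, h⟩ := Metric.eventually_nhds_iff.1 (hc.eventually (lt_mem_nhds (hpos y hy)))
    exact ⟨δ, hδ, fun x hx => h (by rwa [Real.dist_eq])⟩
  obtain ⟨δ₁, h1, h1'⟩ := hnear α ⟨le_rfl, hαβ⟩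
  obtain ⟨δ₂, h2, h2'⟩ := hnear β ⟨hαβ, le_rfl⟩
  refine ⟨min η (min δ₁ δ₂), lt_min hη (lt_min h1 h2), min_le_left _ _, fun x hx => ?_⟩
  have m1 : min η (min δ₁ δ₂) ≤ δ₁ := (min_le_right _ _).trans (min_le_left _ _)
  have m2 : min η (min δ₁ δ₂) ≤ δ₂ := (min_le_right _ _).trans (min_le_right _ _)
  rcases lt_or_ge x α with hx1 | hx1
  · exact h1' x (by rw [abs_lt]; constructor <;> linarith [hx.1, hx.2])
  rcases lt_or_ge β x with hx2 | hx2
  · exact h2' x (by rw [abs_lt]; constructor <;> linarith [hx.1, hx.2])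
  exact hpos x ⟨hx1, hx2⟩

/-- The solution of `y' = f y` that runs from `y₀` to `y₁` in the time `Λ`, and a little further at
both ends. -/
theorem exists_increasing_solution {f : ℝ → ℝ} (hf : Continuous f) {y₀ y₁ : ℝ} (h : y₀ < y₁)
    (hpos : ∀ y ∈ Icc y₀ y₁, 0 < f y) :
    ∃ (η Λ : ℝ) (y : ℝ → ℝ), 0 < η ∧ 0 < Λ ∧ y 0 = y₀ ∧ y Λ = y₁ ∧
      (∀ l ∈ Ioo (-η) (Λ + η), 0 < f (y l) ∧ HasDerivAt y (f (y l)) l) ∧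
      (∀ l ∈ Icc 0 Λ, y l ∈ Icc y₀ y₁) ∧ ∀ l ∈ Ioo (-η) Λ, y l < y₁ := by
  obtain ⟨δ, hδ, -, hδ'⟩ := exists_pos_of_pos_Icc one_pos h.le hf.continuousOn hpos
  obtain ⟨J, y, hJ, hJ', h0, hy0, hd, hmono, himg⟩ := exists_solution_of_pos
    (hf.continuousOn (s := Ioo (y₀ - δ) (y₁ + δ))) hδ' (y₀ := y₀) ⟨by linarith, by linarith⟩
  have hmem : y₁ ∈ Ioo (y₀ - δ) (y₁ + δ) := ⟨by linarith, by linarith⟩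
  rw [← himg] at hmem
  obtain ⟨Λ, hΛJ, hΛ⟩ := hmem
  have hΛ0 : 0 < Λ := (hmono.lt_iff_lt h0 hΛJ).1 (by rw [hy0, hΛ]; exact h)
  obtain ⟨ε₁, e1, e1'⟩ := Metric.isOpen_iff.1 hJ 0 h0
  obtain ⟨ε₂, e2, e2'⟩ := Metric.isOpen_iff.1 hJ Λ hΛJ
  have hsub : ∀ l ∈ Ioo (-(min ε₁ ε₂)) (Λ + min ε₁ ε₂), l ∈ J := by
    intro l hl
    have m1 := min_le_left ε₁ ε₂
    have m2 := min_le_right ε₁ ε₂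
    rcases lt_or_ge l 0 with h1 | h1
    · exact e1' (by rw [Metric.mem_ball, Real.dist_eq, abs_lt]; constructor <;> linarith [hl.1])
    rcases lt_or_ge Λ l with h2 | h2
    · exact e2' (by rw [Metric.mem_ball, Real.dist_eq, abs_lt]; constructor <;> linarith [hl.2])
    exact hJ'.out h0 hΛJ ⟨h1, h2⟩
  have hε : 0 < min ε₁ ε₂ := lt_min e1 e2
  refine ⟨min ε₁ ε₂, Λ, y, hε, hΛ0, hy0, hΛ, fun l hl => ⟨?_, hd l (hsub l hl)⟩,
    fun l hl => ?_, fun l hl => ?_⟩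
  · exact hδ' _ (himg ▸ mem_image_of_mem y (hsub l hl))
  · have hlJ := hJ'.out h0 hΛJ hl
    exact ⟨hy0 ▸ hmono.monotoneOn h0 hlJ hl.1, hΛ ▸ hmono.monotoneOn hlJ hΛJ hl.2⟩
  · exact hΛ ▸ hmono (hsub l ⟨hl.1, by linarith [hl.2]⟩) hΛJ hl.2

/-- There is a solution of `x'' = P'(x) / 2`, `x' ^ 2 = P x`, starting from position `x₀` with
velocity `σ₀` and reaching `x₁` from below for the first time, with positive velocity and without
having entered `x < x_b`.  Unless it moves forward all the time, `P` has a root in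
`[x_b, x₁]`. -/
def Reaches (P : Polynomial ℝ) (x₀ σ₀ x_b x₁ : ℝ) : Prop :=
  ∃ (η Λ : ℝ) (x σ : ℝ → ℝ), 0 < η ∧ 0 < Λ ∧ x 0 = x₀ ∧ σ 0 = σ₀ ∧ x Λ = x₁ ∧ 0 < σ Λ ∧
    (∀ l ∈ Ioo (-η) (Λ + η), HasDerivAt x (σ l) l ∧
      HasDerivAt σ (P.derivative.eval (x l) / 2) l ∧ σ l ^ 2 = P.eval (x l)) ∧
    (∀ l ∈ Icc 0 Λ, x_b ≤ x l ∧ x l ≤ x₁) ∧ (∀ l ∈ Ioo (-η) Λ, x l < x₁) ∧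
    ∀ l ∈ Icc 0 Λ, σ l ≤ 0 → ∃ y ∈ Icc x_b x₁, P.eval y = 0

theorem reaches_of_pos {P : Polynomial ℝ} {x₀ σ₀ x₁ : ℝ} (h : x₀ < x₁) (hσ : 0 < σ₀)
    (hσ' : σ₀ ^ 2 = P.eval x₀) (hP : ∀ x ∈ Icc x₀ x₁, 0 < P.eval x) :
    Reaches P x₀ σ₀ x₀ x₁ := by
  have hc : Continuous fun y => √(P.eval y) := P.continuous.sqrt
  obtain ⟨η, Λ, y, hη, hΛ, h0, h1, hd, hI, hlt⟩ :=
    exists_increasing_solution hc h fun y hy => Real.sqrt_pos.2 (hP y hy)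
  have hΛm : Λ ∈ Ioo (-η) (Λ + η) := ⟨by linarith, by linarith⟩
  refine ⟨η, Λ, y, fun l => √(P.eval (y l)), hη, hΛ, h0, ?_, h1, (hd Λ hΛm).1, fun l hl => ?_,
    hI, hlt, fun l hl hle => ?_⟩
  · beta_reduce; rw [h0, ← hσ', Real.sqrt_sq hσ.le]
  · obtain ⟨hp, hd'⟩ := hd l hl
    have hp' := Real.sqrt_pos.1 hp
    refine ⟨hd', (((P.hasDerivAt (y l)).comp l hd').sqrt hp'.ne').congr_deriv ?_,
      Real.sq_sqrt hp'.le⟩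
    simp only [Function.comp]
    field_simp
  · exact absurd (hd l ⟨by linarith [hl.1], by linarith [hl.2]⟩).1 (not_lt.2 hle)

/-- Near a simple root `x_b`, the substitution `x = x_b + y²` turns `x'² = P(x)` into the first order
equation `y' = √(P(x) / (x - x_b)) / 2`, whose right side is smooth and positive, through the
turning point. -/
theorem reaches_of_root {P : Polynomial ℝ} {x₀ σ₀ x_b x₁ : ℝ} (hb : x_b ≤ x₀) (h : x₀ < x₁)
    (hroot : P.eval x_b = 0) (hsimple : 0 < P.derivative.eval x_b)
    (hσ : σ₀ ^ 2 = P.eval x₀) (hP : ∀ x ∈ Ioc x_b x₁, 0 < P.eval x) :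
    Reaches P x₀ σ₀ x_b x₁ := by
  obtain ⟨S, hS⟩ := Polynomial.dvd_iff_isRoot.2 hroot
  have hSe : ∀ x, P.eval x = (x - x_b) * S.eval x := fun x => by rw [hS]; simp
  have hSd : ∀ x, P.derivative.eval x = S.eval x + (x - x_b) * S.derivative.eval x := fun x => by
    rw [hS]; simp
  have hSpos : ∀ x ∈ Icc x_b x₁, 0 < S.eval x := by
    intro x hx
    rcases hx.1.eq_or_lt with rfl | hx'
    · simpa [hSd] using hsimple
    · have := hP x ⟨hx', hx.2⟩
      rw [hSe] at this
      exact pos_of_mul_pos_right this (by linarith)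
  -- The square root of `x₀ - x_b`, with the sign of the initial velocity.
  obtain ⟨y₀, hy0, hy0s⟩ : ∃ y₀, y₀ ^ 2 = x₀ - x_b ∧ y₀ * √(S.eval x₀) = σ₀ := by
    have hs := hSpos x₀ ⟨hb, h.le⟩
    have hq := Real.sqrt_pos.2 hs
    refine ⟨σ₀ / √(S.eval x₀), ?_, by field_simp⟩
    rw [div_pow, hσ, Real.sq_sqrt hs.le, hSe]
    field_simp
  set y₁ := √(x₁ - x_b) with hy1
  have hy1p : 0 < y₁ := Real.sqrt_pos.2 (by linarith)
  have hy1s : y₁ ^ 2 = x₁ - x_b := Real.sq_sqrt (by linarith)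
  have habs : |y₀| < y₁ := abs_lt_of_sq_lt_sq (by rw [hy0, hy1s]; linarith) hy1p.le
  have hlt := (abs_lt.1 habs).2
  have hgt := (abs_lt.1 habs).1
  have hc : Continuous fun y => √(S.eval (x_b + y ^ 2)) / 2 := by
    have := S.continuous
    fun_prop
  have hyI : ∀ y ∈ Icc y₀ y₁, x_b ≤ x_b + y ^ 2 ∧ x_b + y ^ 2 ≤ x₁ := fun y hy => by
    have := sq_nonneg y
    have h2 : y ^ 2 ≤ y₁ ^ 2 := sq_le_sq' (by linarith [hy.1]) hy.2
    constructor <;> linarith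
  obtain ⟨η, Λ, y, hη, hΛ, h0, h1, hd, hI, hlt'⟩ :=
    exists_increasing_solution hc hlt fun y hy =>
      half_pos (Real.sqrt_pos.2 (hSpos _ (hyI y hy)))
  have hΛm : Λ ∈ Ioo (-η) (Λ + η) := ⟨by linarith, by linarith⟩
  obtain ⟨δ, hδ, hδη, hδ'⟩ := exists_pos_of_pos_Icc (g := fun l => y₁ + y l) (α := 0) (β := 0)
    (η := min η Λ) (lt_min hη hΛ) le_rfl
    (fun l hl => by
      refine ((hd l ⟨?_, ?_⟩).2.continuousAt.const_add y₁).continuousWithinAt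
      · linarith [hl.1, min_le_left η Λ]
      · linarith [hl.2, min_le_right η Λ])
    (fun l hl => by
      obtain rfl : l = 0 := le_antisymm hl.2 hl.1
      rw [h0]; linarith)
  have hδ1 : δ ≤ η := hδη.trans (min_le_left _ _)
  refine ⟨δ, Λ, fun l => x_b + y l ^ 2, fun l => y l * √(S.eval (x_b + y l ^ 2)), hδ, hΛ, ?_, ?_,
    ?_, ?_, fun l hl => ?_, fun l hl => hyI _ (hI l hl), fun l hl => ?_, fun l hl hle => ?_⟩
  · beta_reduce; rw [h0, hy0]; ring
  · have : x_b + y 0 ^ 2 = x₀ := by rw [h0, hy0]; ring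
    beta_reduce; rw [this, h0, hy0s]
  · beta_reduce; rw [h1, hy1s]; ring
  · have := (hd Λ hΛm).1
    have h2 : 0 < √(S.eval (x_b + y Λ ^ 2)) := by linarith
    rw [h1] at h2
    beta_reduce; rw [h1]
    exact mul_pos hy1p h2
  · obtain ⟨hp, hd'⟩ := hd l ⟨by linarith [hl.1], by linarith [hl.2]⟩
    have hp1 : 0 < √(S.eval (x_b + y l ^ 2)) := by linarith
    have hp' := Real.sqrt_pos.1 hp1
    have hsq := Real.sq_sqrt hp'.le
    have hx : HasDerivAt (fun l => x_b + y l ^ 2) (y l * √(S.eval (x_b + y l ^ 2))) l := by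
      refine ((hd'.pow 2).const_add x_b).congr_deriv ?_
      push_cast; ring
    refine ⟨hx, ?_, ?_⟩
    · have hs0 : HasDerivAt (fun l => S.eval (x_b + y l ^ 2)) _ l :=
        HasDerivAt.comp (h₂ := fun x => S.eval x) l (S.hasDerivAt (x_b + y l ^ 2)) hx
      have hs := hs0.sqrt hp'.ne'
      refine (hd'.mul hs).congr_deriv ?_
      simp only [hSd]
      field_simp
      linear_combination hsq
    · beta_reduce; rw [mul_pow, hsq, hSe]; ring
  · have hl1 : y l < y₁ := hlt' l ⟨by linarith [hl.1], hl.2⟩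
    have hl2 : 0 < y₁ + y l := by
      rcases lt_or_ge l 0 with hneg | hnn
      · exact hδ' l ⟨by linarith [hl.1], by linarith⟩
      · linarith [(hI l ⟨hnn, hl.2.le⟩).1]
    nlinarith
  · exact ⟨x_b, ⟨le_rfl, by linarith⟩, hroot⟩

/-! ### Geodesics that reach the horizon or null infinity -/

/-- A unit vector `n` and an angular momentum covector `m` with the axial angular momentum `L`, for
which Carter's constant is `K` if the energy is `E`. -/
structure IsAngularData (a E L K n₁ n₂ n₃ m₁ m₂ m₃ : ℝ) : Prop where
  unit : n₁ ^ 2 + n₂ ^ 2 + n₃ ^ 2 = 1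
  orthogonal : n₁ * m₁ + n₂ * m₂ + n₃ * m₃ = 0
  axial : n₁ * m₂ - n₂ * m₁ = L
  carter : m₁ ^ 2 + m₂ ^ 2 + m₃ ^ 2 = K + 2 * a * E * L - (a * E) ^ 2 * (1 - n₃ ^ 2)

/-- A radial motion with regular Kerr coordinates at its end `Λ` belongs to a geodesic with any
admissible angular initial data, whose Kerr coordinates converge at the future end. -/
theorem exists_geodesic {M a E L K ς η Λ : ℝ} (ha : 0 ≤ a) (haM : a < M) (hη : 0 < η) (hΛ : 0 < Λ)
    {r ρ A B : ℝ → ℝ} (hr : ∀ l ∈ Ioo (-η) Λ, HasDerivAt r (ρ l) l)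
    (hρ : ∀ l ∈ Ioo (-η) Λ,
      HasDerivAt ρ (2 * E * r l * carterX a E L (r l) - (r l - M) * K) l)
    (hR : ∀ l ∈ Ioo (-η) Λ, ρ l ^ 2 = carterX a E L (r l) ^ 2 - delta M a (r l) * K)
    (hext : ∀ l ∈ Ioo (-η) Λ, rPlus M a < r l)
    (hA : ContinuousOn A (Ioo (-η) (Λ + η))) (hB : ContinuousOn B (Ioo (-η) (Λ + η)))
    (hA' : ∀ l ∈ Ioo (-η) Λ,
      A l = (r l ^ 2 + a ^ 2) * (carterX a E L (r l) + ς * ρ l) / delta M a (r l))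
    (hB' : ∀ l ∈ Ioo (-η) Λ, B l = a * (carterX a E L (r l) + ς * ρ l) / delta M a (r l))
    {n₁ n₂ n₃ m₁ m₂ m₃ : ℝ} (t₀ : ℝ) (hd : IsAngularData a E L K n₁ n₂ n₃ m₁ m₂ m₃) :
    ∃ (o : Orbit) (J : Set ℝ) (l : ℝ → ℝ), IsGeodesicOn M a (o.comp l).curve J ∧ (0 : ℝ) ∈ J ∧
      (o.comp l).curve 0 = ![t₀, r 0 * n₁, r 0 * n₂, r 0 * n₃] ∧
      deriv (o.comp l).curve 0 = orbitVelocity M a E L (r 0) (ρ 0) n₁ n₂ n₃ m₁ m₂ m₃ ∧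
      o.r = r ∧ (∀ s ∈ J, 0 < r (l s) ∧ radius ((o.comp l).curve s) = r (l s)) ∧
      o.ChartConverges M a ς (fun s : J => l s) atTop ∧
      Tendsto (fun s : J => l s) atTop (𝓝[<] Λ) := by
  obtain ⟨o, H, hdata, hor, hconv⟩ := exists_orbit ha haM hη hΛ hr hρ hR hext hA hB hA' hB' t₀
    hd.unit hd.orthogonal hd.axial hd.carter
  obtain ⟨J, l, hJ, hJ', h0, hl0, H', hl⟩ := exists_affine_orbit ha haM hη hΛ H
  obtain ⟨d1, d2, d3, d4, d5, d6, d7, d8, d9⟩ := hdata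
  refine ⟨o, J, l, H'.isGeodesicOn ha haM hJ hJ', h0, ?_, ?_, hor, fun s hs => ?_, ?_, hl⟩
  · simp [Orbit.curve, Orbit.comp, hl0, d1, d2, d4, d5, d6]
  · rw [(H'.hasDerivAt_curve ha haM h0).deriv]
    simp [Orbit.velocity, Orbit.comp, hl0, d2, d3, d4, d5, d6, d7, d8, d9]
  · have h1 := (rPlus_pos ha haM).trans (H'.exterior s hs)
    have h2 : radius ((o.comp l).curve s) = (o.comp l).r s := radius_polar h1 (H'.unit s hs)
    rw [h2, ← hor]
    exact ⟨h1, rfl⟩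
  · obtain ⟨u, k₁, k₂, k₃, hk, c0, c1, c2, c3⟩ := hconv
    exact ⟨u, k₁, k₂, k₃, hk, c0.comp hl, c1.comp hl, c2.comp hl, c3.comp hl⟩

/-- The radial potential `R = X² - Δ K`, as a polynomial in `-r`. -/
noncomputable def ingoingPotential (M a E L K : ℝ) : Polynomial ℝ :=
  (.C E * (.X ^ 2 + .C (a ^ 2)) - .C (a * L)) ^ 2
    - (.X ^ 2 + .C (2 * M) * .X + .C (a ^ 2)) * .C K

theorem ingoingPotential_eval (M a E L K r : ℝ) :
    (ingoingPotential M a E L K).eval (-r) = carterX a E L r ^ 2 - delta M a r * K := by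
  simp only [ingoingPotential, carterX, delta, Polynomial.eval_sub, Polynomial.eval_mul,
    Polynomial.eval_pow, Polynomial.eval_add, Polynomial.eval_C, Polynomial.eval_X]
  ring

theorem ingoingPotential_derivative_eval (M a E L K r : ℝ) :
    (ingoingPotential M a E L K).derivative.eval (-r)
      = -2 * (2 * E * r * carterX a E L r - (r - M) * K) := by
  simp only [ingoingPotential, carterX, Polynomial.derivative_sub, Polynomial.derivative_mul,
    Polynomial.derivative_pow, Polynomial.derivative_add, Polynomial.derivative_C,
    Polynomial.derivative_X, Polynomial.eval_sub, Polynomial.eval_mul, Polynomial.eval_pow,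
    Polynomial.eval_add, Polynomial.eval_C, Polynomial.eval_X, Polynomial.eval_zero,
    Polynomial.eval_one]
  push_cast
  ring

/-- The radial potential in the variable `x = -1 / r`, that is `x⁴ R`. -/
noncomputable def outgoingPotential (M a E L K : ℝ) : Polynomial ℝ :=
  (.C E * (1 + .C (a ^ 2) * .X ^ 2) - .C (a * L) * .X ^ 2) ^ 2
    - (1 + .C (2 * M) * .X + .C (a ^ 2) * .X ^ 2) * .X ^ 2 * .C K

theorem outgoingPotential_eval (M a E L K x : ℝ) :
    (outgoingPotential M a E L K).eval x = (E * (1 + a ^ 2 * x ^ 2) - a * L * x ^ 2) ^ 2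
      - (1 + 2 * M * x + a ^ 2 * x ^ 2) * x ^ 2 * K := by
  simp only [outgoingPotential, Polynomial.eval_sub, Polynomial.eval_mul, Polynomial.eval_pow,
    Polynomial.eval_add, Polynomial.eval_C, Polynomial.eval_X, Polynomial.eval_one]

theorem outgoingPotential_derivative_eval (M a E L K x : ℝ) :
    (outgoingPotential M a E L K).derivative.eval x
      = 4 * x * (a ^ 2 * E - a * L) * (E * (1 + a ^ 2 * x ^ 2) - a * L * x ^ 2)
      - (2 * x + 6 * M * x ^ 2 + 4 * a ^ 2 * x ^ 3) * K := by
  simp only [outgoingPotential, Polynomial.derivative_sub, Polynomial.derivative_mul,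
    Polynomial.derivative_pow, Polynomial.derivative_add, Polynomial.derivative_C,
    Polynomial.derivative_X, Polynomial.derivative_one, Polynomial.eval_sub, Polynomial.eval_mul,
    Polynomial.eval_pow, Polynomial.eval_add, Polynomial.eval_C, Polynomial.eval_X,
    Polynomial.eval_zero, Polynomial.eval_one]
  push_cast
  ring

/-- If the radial motion reaches `r₊`, then so does a geodesic.  In ingoing coordinates the motion
is regular at the horizon, because `(X + ρ) / Δ = K / (X - ρ)`. -/
theorem exists_infalling {M a E L K r₀ ρ₀ x_b : ℝ} (ha : 0 ≤ a) (haM : a < M) (hK : 0 ≤ K)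
    (hre : Reaches (ingoingPotential M a E L K) (-r₀) (-ρ₀) x_b (-rPlus M a))
    (hX : ∀ r, rPlus M a ≤ r → r ≤ -x_b → 0 < carterX a E L r)
    {n₁ n₂ n₃ m₁ m₂ m₃ : ℝ} (t₀ : ℝ) (hd : IsAngularData a E L K n₁ n₂ n₃ m₁ m₂ m₃) :
    ∃ (γ : ℝ → Fin 4 → ℝ) (J : Set ℝ), IsGeodesicOn M a γ J ∧ (0 : ℝ) ∈ J ∧
      γ 0 = ![t₀, r₀ * n₁, r₀ * n₂, r₀ * n₃] ∧
      deriv γ 0 = orbitVelocity M a E L r₀ ρ₀ n₁ n₂ n₃ m₁ m₂ m₃ ∧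
      MeetsFutureHorizon M a γ J := by
  obtain ⟨η, Λ, x, σ, hη, hΛ, hx0, hσ0, hxΛ, hσΛ, hode, hI, hlt, hturn⟩ := hre
  have hev : ∀ l ∈ Ioo (-η) (Λ + η),
      σ l ^ 2 = carterX a E L (-x l) ^ 2 - delta M a (-x l) * K := fun l hl => by
    rw [(hode l hl).2.2, ← ingoingPotential_eval, neg_neg]
  set g : ℝ → ℝ := fun l => carterX a E L (-x l) + σ l with hg
  have hIsub : ∀ l ∈ Icc 0 Λ, l ∈ Ioo (-η) (Λ + η) := fun l hl =>
    ⟨by linarith [hl.1], by linarith [hl.2]⟩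
  have hgpos : ∀ l ∈ Icc 0 Λ, 0 < g l := by
    intro l hl
    have hXl := hX (-x l) (by linarith [(hI l hl).2]) (by linarith [(hI l hl).1])
    rcases lt_or_ge 0 (σ l) with hσ | hσ
    · exact add_pos hXl hσ
    obtain ⟨y, hy, hy0⟩ := hturn l hl hσ
    have hXy := hX (-y) (by linarith [hy.2]) (by linarith [hy.1])
    rw [← neg_neg y, ingoingPotential_eval] at hy0
    have hK' : 0 < K := hK.lt_of_ne (by rintro rfl; nlinarith)
    have hlΛ : l < Λ := hl.2.lt_of_ne (by rintro rfl; linarith)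
    have hD := delta_pos ha haM (show rPlus M a < -x l by
      linarith [hlt l ⟨by linarith [hl.1], hlΛ⟩])
    have : σ l ^ 2 < carterX a E L (-x l) ^ 2 := by
      rw [hev l (hIsub l hl)]; nlinarith [mul_pos hD hK']
    have := (abs_lt.1 (abs_lt_of_sq_lt_sq this hXl.le)).1
    simp only [hg]; linarith
  have hxc : ContinuousOn x (Ioo (-η) (Λ + η)) := fun l hl =>
    (hode l hl).1.continuousAt.continuousWithinAt
  have hσc : ContinuousOn σ (Ioo (-η) (Λ + η)) := fun l hl =>
    (hode l hl).2.1.continuousAt.continuousWithinAt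
  have hgc : ContinuousOn g (Ioo (-η) (Λ + η)) := by
    simp only [hg, carterX]; fun_prop
  obtain ⟨δ, hδ, hδη, hδ'⟩ := exists_pos_of_pos_Icc hη hΛ.le (by simpa using hgc) hgpos
  rw [zero_sub] at hδ'
  have hsub : Ioo (-δ) (Λ + δ) ⊆ Ioo (-η) (Λ + η) := Ioo_subset_Ioo (by linarith) (by linarith)
  have hsub' : Ioo (-δ) Λ ⊆ Ioo (-δ) (Λ + δ) := Ioo_subset_Ioo_right (by linarith)
  have hext : ∀ l ∈ Ioo (-δ) Λ, rPlus M a < -x l := fun l hl => by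
    linarith [hlt l ⟨by linarith [hl.1], hl.2⟩]
  have hfrac : ∀ l ∈ Ioo (-δ) Λ,
      (carterX a E L (-x l) + 1 * -σ l) / delta M a (-x l) = K / g l := fun l hl => by
    rw [div_eq_div_iff (delta_pos ha haM (hext l hl)).ne' (hδ' l (hsub' hl)).ne']
    simp only [hg]
    linear_combination -hev l (hsub (hsub' hl))
  have hgc' := hgc.mono hsub
  have hxc' := hxc.mono hsub
  obtain ⟨o, J, l, hgeo, h0, hp, hv, hor, hrad, ⟨u, k₁, k₂, k₃, hk, c0, c1, c2, c3⟩, hl⟩ :=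
    exists_geodesic (ς := 1) (E := E) (L := L) (K := K) (r := fun l => -x l) (ρ := fun l => -σ l)
    (A := fun l => (x l ^ 2 + a ^ 2) * (K / g l)) (B := fun l => a * (K / g l))
    ha haM hδ hΛ (fun l hl => (hode l (hsub (hsub' hl))).1.neg)
    (fun l hl => (hode l (hsub (hsub' hl))).2.1.neg.congr_deriv (by
      rw [← neg_neg (x l), ingoingPotential_derivative_eval]
      simp only [neg_neg]
      ring))
    (fun l hl => by rw [neg_sq]; exact hev l (hsub (hsub' hl))) hext
    (ContinuousOn.mul (by fun_prop) (continuousOn_const.div hgc' fun l hl => (hδ' l hl).ne'))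
    (continuousOn_const.mul (continuousOn_const.div hgc' fun l hl => (hδ' l hl).ne'))
    (fun l hl => by rw [← hfrac l hl]; ring) (fun l hl => by rw [← hfrac l hl]; ring) t₀ hd
  have hr0 : -x 0 = r₀ := by rw [hx0, neg_neg]
  have hρ0 : -σ 0 = ρ₀ := by rw [hσ0, neg_neg]
  refine ⟨(o.comp l).curve, J, hgeo, h0, by rw [hp]; simp only [hr0],
    by rw [hv]; simp only [hr0, hρ0], ?_⟩
  have hr : Tendsto (fun s : J => o.r (l s)) atTop (𝓝 (rPlus M a)) := by
    have h1 : Tendsto (fun l => -x l) (𝓝[<] Λ) (𝓝 (-x Λ)) :=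
      tendsto_nhdsWithin_of_tendsto_nhds
        (hode Λ ⟨by linarith, by linarith⟩).1.neg.continuousAt.tendsto
    rw [hxΛ, neg_neg] at h1
    rw [hor]
    exact h1.comp hl
  refine ⟨![u, rPlus M a * k₁, rPlus M a * k₂, rPlus M a * k₃],
    radius_polar (rPlus_pos ha haM) hk, ?_⟩
  simp only [one_mul] at c0 c1 c2
  have hrad' : ∀ s : J, radius ((o.comp l).curve s) = o.r (l s) := fun s => by
    rw [(hrad s s.2).2, hor]
  rw [tendsto_pi_nhds]
  intro i
  fin_cases i
  · refine c0.congr fun s => ?_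
    simp only [ingoingChart, hrad']
    simp [Orbit.curve, Orbit.comp]
  · refine (hr.mul c1).congr fun s => ?_
    simp only [ingoingChart, hrad']
    simp [Orbit.curve, Orbit.comp]
    ring
  · refine (hr.mul c2).congr fun s => ?_
    simp only [ingoingChart, hrad']
    simp [Orbit.curve, Orbit.comp]
    ring
  · refine (hr.mul c3).congr fun s => ?_
    simp [ingoingChart, Orbit.curve, Orbit.comp]

/-- If the radial motion reaches `1 / r = 0`, then a geodesic reaches null infinity.  The outgoing
coordinates of the motion are regular there, because `(X - ρ) / Δ = K / (X + ρ)`. -/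
theorem exists_escaping {M a E L K r₀ ρ₀ x_b : ℝ} (ha : 0 ≤ a) (haM : a < M) (hK : 0 ≤ K)
    (hE : 0 < E) (hr₀ : 0 < r₀) (hxb : rPlus M a < -1 / x_b) (hxb' : x_b < 0)
    (hre : Reaches (outgoingPotential M a E L K) (-1 / r₀) (ρ₀ / r₀ ^ 2) x_b 0)
    (hX : ∀ r, -1 / x_b ≤ r → 0 < carterX a E L r)
    {n₁ n₂ n₃ m₁ m₂ m₃ : ℝ} (t₀ : ℝ) (hd : IsAngularData a E L K n₁ n₂ n₃ m₁ m₂ m₃) :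
    ∃ (γ : ℝ → Fin 4 → ℝ) (J : Set ℝ), IsGeodesicOn M a γ J ∧ (0 : ℝ) ∈ J ∧
      γ 0 = ![t₀, r₀ * n₁, r₀ * n₂, r₀ * n₃] ∧
      deriv γ 0 = orbitVelocity M a E L r₀ ρ₀ n₁ n₂ n₃ m₁ m₂ m₃ ∧
      MeetsFutureNullInfinity M a γ J := by
  obtain ⟨η, Λ, x, σ, hη, hΛ, hx0, hσ0, hxΛ, hσΛ, hode, hI, hlt, hturn⟩ := hre
  -- `Y x = x² X(-1 / x)`
  set Y : ℝ → ℝ := fun x => E * (1 + a ^ 2 * x ^ 2) - a * L * x ^ 2 with hYdef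
  have hYX : ∀ x, x ≠ 0 → Y x = x ^ 2 * carterX a E L (-1 / x) := fun x hx => by
    simp only [hYdef, carterX]; field_simp
  have hDx : ∀ x, x ≠ 0 → 1 + 2 * M * x + a ^ 2 * x ^ 2 = x ^ 2 * delta M a (-1 / x) :=
    fun x hx => by simp only [delta]; field_simp; ring
  have hneg : ∀ x, x_b ≤ x → x < 0 → -1 / x_b ≤ -1 / x := fun x h1 h2 => by
    rw [neg_div, neg_div, neg_le_neg_iff]
    exact one_div_le_one_div_of_neg_of_le h2 h1
  have hYpos : ∀ x ∈ Icc x_b 0, 0 < Y x := fun x hx => by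
    rcases hx.2.eq_or_lt with rfl | h
    · simpa [hYdef] using hE
    · rw [hYX x h.ne]
      exact mul_pos (sq_pos_of_neg h) (hX _ (hneg x hx.1 h))
  have hev : ∀ l ∈ Ioo (-η) (Λ + η), σ l ^ 2
      = Y (x l) ^ 2 - (1 + 2 * M * x l + a ^ 2 * x l ^ 2) * x l ^ 2 * K := fun l hl => by
    rw [(hode l hl).2.2, outgoingPotential_eval]
  have hIsub : ∀ l ∈ Icc 0 Λ, l ∈ Ioo (-η) (Λ + η) := fun l hl =>
    ⟨by linarith [hl.1], by linarith [hl.2]⟩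
  set g : ℝ → ℝ := fun l => Y (x l) + σ l with hg
  have hgpos : ∀ l ∈ Icc 0 Λ, 0 < g l := by
    intro l hl
    have hYl := hYpos (x l) (hI l hl)
    rcases lt_or_ge 0 (σ l) with hσ | hσ
    · exact add_pos hYl hσ
    obtain ⟨y, hy, hy0⟩ := hturn l hl hσ
    have hYy := hYpos y hy
    rw [outgoingPotential_eval] at hy0
    change Y y ^ 2 - _ = 0 at hy0
    have hK' : 0 < K := hK.lt_of_ne (by rintro rfl; nlinarith)
    have hlΛ : l < Λ := hl.2.lt_of_ne (by rintro rfl; linarith)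
    have hxl : x l < 0 := hlt l ⟨by linarith [hl.1], hlΛ⟩
    have hD := delta_pos ha haM (hxb.trans_le (hneg (x l) (hI l hl).1 hxl))
    have hx2 : 0 < x l ^ 2 := sq_pos_of_neg hxl
    have : σ l ^ 2 < Y (x l) ^ 2 := by
      rw [hev l (hIsub l hl), hDx _ hxl.ne]
      have : 0 < x l ^ 2 * delta M a (-1 / x l) * x l ^ 2 * K := by positivity
      linarith
    have := (abs_lt.1 (abs_lt_of_sq_lt_sq this hYl.le)).1
    simp only [hg]; linarith
  have hxc : ContinuousOn x (Ioo (-η) (Λ + η)) := fun l hl =>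
    (hode l hl).1.continuousAt.continuousWithinAt
  have hσc : ContinuousOn σ (Ioo (-η) (Λ + η)) := fun l hl =>
    (hode l hl).2.1.continuousAt.continuousWithinAt
  have hgc : ContinuousOn g (Ioo (-η) (Λ + η)) := by
    simp only [hg, hYdef]; fun_prop
  obtain ⟨δ₁, hδ₁, hδη₁, hδ₁'⟩ := exists_pos_of_pos_Icc hη hΛ.le (by simpa using hgc) hgpos
  -- The past of the starting point stays in the exterior region for a short time.
  have hrp := rPlus_pos ha haM
  have hxb2 : -1 / rPlus M a < x_b := by
    rw [div_lt_iff₀ hrp]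
    rw [lt_div_iff_of_neg hxb'] at hxb
    linarith
  obtain ⟨δ₂, hδ₂, -, hδ₂'⟩ := exists_pos_of_pos_Icc (g := fun l => x l - -1 / rPlus M a) hη hΛ.le
    (by rw [zero_sub]; exact hxc.sub continuousOn_const) (fun l hl => by linarith [(hI l hl).1])
  set δ := min δ₁ δ₂ with hδdef
  have hδ : 0 < δ := lt_min hδ₁ hδ₂
  have hδm1 : δ ≤ δ₁ := min_le_left _ _
  have hδm2 : δ ≤ δ₂ := min_le_right _ _
  rw [zero_sub] at hδ₁' hδ₂'
  have hδ' : ∀ l ∈ Ioo (-δ) (Λ + δ), 0 < g l := fun l hl =>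
    hδ₁' l ⟨by linarith [hl.1], by linarith [hl.2]⟩
  have hsub : Ioo (-δ) (Λ + δ) ⊆ Ioo (-η) (Λ + η) := Ioo_subset_Ioo (by linarith) (by linarith)
  have hsub' : Ioo (-δ) Λ ⊆ Ioo (-δ) (Λ + δ) := Ioo_subset_Ioo_right (by linarith)
  have hxneg : ∀ l ∈ Ioo (-δ) Λ, x l < 0 := fun l hl => hlt l ⟨by linarith [hl.1], hl.2⟩
  have hext : ∀ l ∈ Ioo (-δ) Λ, rPlus M a < -1 / x l := fun l hl => by
    have h1 := hδ₂' l ⟨by linarith [hl.1], by linarith [hl.2]⟩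
    have h2 : -1 / rPlus M a < x l := by linarith
    rw [div_lt_iff₀ hrp] at h2
    rw [lt_div_iff_of_neg (hxneg l hl)]
    linarith
  have hfrac : ∀ l ∈ Ioo (-δ) Λ,
      (carterX a E L (-1 / x l) + -1 * (σ l / x l ^ 2)) / delta M a (-1 / x l)
        = x l ^ 2 * K / g l := fun l hl => by
    have hxl := (hxneg l hl).ne
    have h1 := hev l (hsub (hsub' hl))
    rw [div_eq_div_iff (delta_pos ha haM (hext l hl)).ne' (hδ' l (hsub' hl)).ne']
    rw [hDx _ hxl, hYX _ hxl] at h1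
    simp only [hg]
    rw [hYX _ hxl]
    generalize carterX a E L (-1 / x l) = X at *
    generalize delta M a (-1 / x l) = D at *
    field_simp
    linear_combination -h1
  have hgc' := hgc.mono hsub
  have hxc' := hxc.mono hsub
  obtain ⟨o, J, l, hgeo, h0, hp, hv, hor, hrad, ⟨u, k₁, k₂, k₃, hk, c0, c1, c2, c3⟩, hl⟩ :=
    exists_geodesic (ς := -1) (E := E) (L := L) (K := K) (r := fun l => -1 / x l)
    (ρ := fun l => σ l / x l ^ 2)
    (A := fun l => (1 + a ^ 2 * x l ^ 2) * K / g l) (B := fun l => a * (x l ^ 2 * K / g l))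
    ha haM hδ hΛ
    (fun l hl => by
      have hxl := (hxneg l hl).ne
      refine ((hasDerivAt_const l (-1 : ℝ)).div (hode l (hsub (hsub' hl))).1 hxl).congr_deriv ?_
      field_simp
      ring)
    (fun l hl => by
      have hxl := (hxneg l hl).ne
      obtain ⟨h1, h2, -⟩ := hode l (hsub (hsub' hl))
      refine (h2.div (h1.pow 2) (pow_ne_zero 2 hxl)).congr_deriv ?_
      have h3 := hev l (hsub (hsub' hl))
      rw [outgoingPotential_derivative_eval]
      simp only [hYdef] at h3
      simp only [carterX, Pi.pow_apply]
      generalize x l = y at *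
      field_simp
      push_cast
      linear_combination (-4 * y) * h3)
    (fun l hl => by
      have hxl := (hxneg l hl).ne
      have h3 := hev l (hsub (hsub' hl))
      rw [hDx _ hxl, hYX _ hxl] at h3
      generalize carterX a E L (-1 / x l) = X at *
      generalize delta M a (-1 / x l) = D at *
      field_simp
      linear_combination h3) hext
    (ContinuousOn.div (by fun_prop) hgc' fun l hl => (hδ' l hl).ne')
    (continuousOn_const.mul (ContinuousOn.div (by fun_prop) hgc' fun l hl => (hδ' l hl).ne'))
    (fun l hl => by
      have hxl := (hxneg l hl).ne
      have hgl := (hδ' l (hsub' hl)).ne'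
      rw [mul_div_assoc _ (carterX _ _ _ _ + _), hfrac l hl]
      field_simp) (fun l hl => by
      rw [mul_div_assoc _ (carterX _ _ _ _ + _), hfrac l hl]) t₀ hd
  have hr0 : -1 / x 0 = r₀ := by rw [hx0]; field_simp
  have hρ0 : σ 0 / x 0 ^ 2 = ρ₀ := by rw [hσ0, hx0]; field_simp
  refine ⟨(o.comp l).curve, J, hgeo, h0, by rw [hp]; simp only [hr0],
    by rw [hv]; simp only [hr0, hρ0], ?_⟩
  have hr : Tendsto (fun s : J => 1 / o.r (l s)) atTop (𝓝 0) := by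
    have h1 : Tendsto (fun l => -x l) (𝓝[<] Λ) (𝓝 (-x Λ)) :=
      tendsto_nhdsWithin_of_tendsto_nhds
        (hode Λ ⟨by linarith, by linarith⟩).1.neg.continuousAt.tendsto
    rw [hxΛ, neg_zero] at h1
    rw [hor]
    refine (h1.comp hl).congr fun s => ?_
    simp [neg_div]
  simp only [Real.cos_neg, Real.sin_neg, neg_mul, sub_neg_eq_add] at c0 c1 c2
  have hrad' : ∀ s : J, radius ((o.comp l).curve s) = o.r (l s) := fun s => by
    rw [(hrad s s.2).2, hor]
  have hrne : ∀ s : J, o.r (l s) ≠ 0 := fun s => by rw [hor]; exact (hrad s s.2).1.ne'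
  refine ⟨(u, 0, ![k₁, k₂, k₃]), ⟨rfl, by simpa using hk⟩, ?_⟩
  refine Tendsto.prodMk_nhds (c0.congr fun s => ?_) (Tendsto.prodMk_nhds (hr.congr fun s => ?_) ?_)
  · simp only [hrad']
    simp [Orbit.curve, Orbit.comp]
    ring
  · simp only [hrad']
  rw [tendsto_pi_nhds]
  intro i
  fin_cases i
  · refine c1.congr fun s => ?_
    have := hrne s
    simp only [hrad']
    simp [Orbit.curve, Orbit.comp]
    field_simp
  · refine c2.congr fun s => ?_
    have := hrne s
    simp only [hrad']
    simp [Orbit.curve, Orbit.comp]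
    field_simp
    ring
  · refine c3.congr fun s => ?_
    have := hrne s
    simp only [hrad']
    simp [Orbit.curve, Orbit.comp]
    field_simp

/-! ### Radial motions that reach the horizon or infinity -/

/-- The radial motion that starts from `r₀` with velocity `ρ₀` in Mino time reaches infinity, without
going below the radius `-1 / x_b`, and `X > 0` beyond this radius. -/
def RadiallyEscapes (M a E L K r₀ ρ₀ : ℝ) : Prop :=
  0 < E ∧ ∃ x_b < 0, rPlus M a < -1 / x_b ∧
    Reaches (outgoingPotential M a E L K) (-1 / r₀) (ρ₀ / r₀ ^ 2) x_b 0 ∧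
    ∀ r, -1 / x_b ≤ r → 0 < carterX a E L r

/-- The radial motion that starts from `r₀` with velocity `ρ₀` in Mino time reaches the horizon,
without exceeding the radius `-x_b`, and `X > 0` up to this radius. -/
def RadiallyFalls (M a E L K r₀ ρ₀ : ℝ) : Prop :=
  ∃ x_b, Reaches (ingoingPotential M a E L K) (-r₀) (-ρ₀) x_b (-rPlus M a) ∧
    ∀ r, rPlus M a ≤ r → r ≤ -x_b → 0 < carterX a E L r

/-- `G = X - κ √Δ` with `κ² = K`; the motion with `X > 0` is confined to `G ≥ 0`. -/
noncomputable def radialGap (M a E L κ r : ℝ) : ℝ := carterX a E L r - κ * √(delta M a r)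

theorem outgoingPotential_eval_inv {M a E L K r : ℝ} (hr : r ≠ 0) :
    (outgoingPotential M a E L K).eval (-1 / r)
      = (carterX a E L r ^ 2 - delta M a r * K) / r ^ 4 := by
  rw [outgoingPotential_eval]
  simp only [carterX, delta]
  field_simp
  ring

theorem outgoingPotential_derivative_eval_inv {M a E L K r : ℝ} (hr : r ≠ 0) :
    (outgoingPotential M a E L K).derivative.eval (-1 / r)
      = 2 * (2 * E * r * carterX a E L r - (r - M) * K) / r ^ 2
        - 4 * (carterX a E L r ^ 2 - delta M a r * K) / r ^ 3 := by
  rw [outgoingPotential_derivative_eval]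
  simp only [carterX, delta]
  field_simp
  ring

section

variable {M a E L κ r r₀ r₁ ρ₀ s : ℝ}

theorem delta_nonneg (ha : 0 ≤ a) (haM : a < M) (hr : rPlus M a ≤ r) : 0 ≤ delta M a r := by
  rcases hr.eq_or_lt with rfl | h
  · exact (delta_rPlus ha haM).ge
  · exact (delta_pos ha haM h).le

theorem potential_eq (ha : 0 ≤ a) (haM : a < M) (hr : rPlus M a ≤ r) :
    carterX a E L r ^ 2 - delta M a r * κ ^ 2
      = radialGap M a E L κ r * (carterX a E L r + κ * √(delta M a r)) := by
  have := Real.sq_sqrt (delta_nonneg ha haM hr)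
  rw [radialGap]
  linear_combination κ ^ 2 * this

theorem potential_pos (ha : 0 ≤ a) (haM : a < M) (hκ : 0 ≤ κ) (hr : rPlus M a ≤ r)
    (hG : 0 < radialGap M a E L κ r) : 0 < carterX a E L r ^ 2 - delta M a r * κ ^ 2 := by
  rw [potential_eq ha haM hr]
  have h : 0 ≤ κ * √(delta M a r) := by positivity
  refine mul_pos hG ?_
  simp only [radialGap] at hG
  linarith

theorem carterX_pos_of_gap (hκ : 0 ≤ κ) (hG : 0 < radialGap M a E L κ r) :
    0 < carterX a E L r := by
  have h : 0 ≤ κ * √(delta M a r) := by positivity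
  simp only [radialGap] at hG
  linarith

theorem sqrt_delta_lt (ha : 0 ≤ a) (haM : a < M) (hr : rPlus M a ≤ r) (hs : r < s) :
    √(delta M a r) < √(delta M a s) := by
  refine Real.sqrt_lt_sqrt (delta_nonneg ha haM hr) ?_
  have := lt_rPlus ha haM
  simp only [delta]
  nlinarith

/-- `√Δ` is concave: it lies below its tangents. -/
theorem sqrt_delta_le_tangent (ha : 0 ≤ a) (haM : a < M) (hr : rPlus M a ≤ r)
    (hs : rPlus M a < s) :
    √(delta M a r) ≤ √(delta M a s) + (s - M) / √(delta M a s) * (r - s) := by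
  have hDs := delta_pos ha haM hs
  have hDr := delta_nonneg ha haM hr
  have hqs := Real.sqrt_pos.2 hDs
  have hb : 0 ≤ M ^ 2 - a ^ 2 := by nlinarith
  have hb2 := Real.sq_sqrt hb
  have hb0 := Real.sqrt_nonneg (M ^ 2 - a ^ 2)
  have h1 : √(M ^ 2 - a ^ 2) ≤ r - M := by simp only [rPlus] at hr; linarith
  have h2 : √(M ^ 2 - a ^ 2) ≤ s - M := by simp only [rPlus] at hs; linarith
  have hT : 0 ≤ delta M a s + (s - M) * (r - s) := by
    simp only [delta]
    nlinarith [mul_le_mul h1 h2 hb0 (hb0.trans h1)]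
  have key : √(delta M a r) * √(delta M a s) ≤ delta M a s + (s - M) * (r - s) := by
    rw [← Real.sqrt_mul hDr]
    refine Real.sqrt_le_iff.2 ⟨hT, ?_⟩
    simp only [delta]
    nlinarith [mul_nonneg hb (sq_nonneg (r - s))]
  have hsq := Real.mul_self_sqrt hDs.le
  rw [← mul_le_mul_iff_of_pos_right hqs]
  refine key.trans (le_of_eq ?_)
  field_simp
  linear_combination -hsq

/-- For `E ≥ 0` the gap is convex: it lies above its tangent at a zero. -/
theorem gap_ge_tangent (ha : 0 ≤ a) (haM : a < M) (hκ : 0 ≤ κ) (hE : 0 ≤ E)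
    (hr : rPlus M a ≤ r) (hs : rPlus M a < s) (hz : radialGap M a E L κ s = 0) :
    (2 * E * s - κ * ((s - M) / √(delta M a s))) * (r - s) ≤ radialGap M a E L κ r := by
  have h1 := mul_le_mul_of_nonneg_left (sqrt_delta_le_tangent ha haM hr hs) hκ
  have h2 : 0 ≤ E * (r - s) ^ 2 := by positivity
  simp only [radialGap, carterX] at *
  nlinarith

theorem continuous_radialGap : Continuous (radialGap M a E L κ) := by
  unfold radialGap carterX delta
  fun_prop

/-- The derivative of the potential at a zero of the gap. -/
theorem potential_deriv_of_gap (ha : 0 ≤ a) (haM : a < M) (hs : rPlus M a < s)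
    (hz : radialGap M a E L κ s = 0) :
    2 * E * s * carterX a E L s - (s - M) * κ ^ 2
      = carterX a E L s * (2 * E * s - κ * ((s - M) / √(delta M a s))) := by
  have hq := Real.sqrt_pos.2 (delta_pos ha haM hs)
  have hX : carterX a E L s = κ * √(delta M a s) := by
    simp only [radialGap] at hz; linarith
  rw [hX]
  field_simp

/-- A potential barrier below the starting point makes the motion escape. -/
theorem radiallyEscapes_of_barrier (ha : 0 ≤ a) (haM : a < M) (hκ : 0 < κ) (h1 : rPlus M a < r₁)
    (h10 : r₁ < r₀) (hG1 : radialGap M a E L κ r₁ < 0) (hG0 : 0 ≤ radialGap M a E L κ r₀)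
    (hρ : ρ₀ ^ 2 = carterX a E L r₀ ^ 2 - delta M a r₀ * κ ^ 2) :
    RadiallyEscapes M a E L (κ ^ 2) r₀ ρ₀ := by
  have hrp := rPlus_pos ha haM
  have hE : 0 < E := by
    by_contra hE
    rw [not_lt] at hE
    have hs := mul_lt_mul_of_pos_left (sqrt_delta_lt ha haM h1.le h10) hκ
    have : 0 ≤ E * (r₁ ^ 2 - r₀ ^ 2) := mul_nonneg_of_nonpos_of_nonpos hE (by nlinarith)
    simp only [radialGap, carterX] at hG1 hG0
    nlinarith
  obtain ⟨s, hsI, hs0⟩ := intermediate_value_Icc h10.le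
    (continuous_radialGap (M := M) (a := a) (E := E) (L := L) (κ := κ)).continuousOn
    ⟨hG1.le, hG0⟩
  have hs1 : r₁ < s := hsI.1.lt_of_ne (by rintro rfl; linarith)
  have hs := h1.trans hs1
  have hspos := hrp.trans hs
  set m := 2 * E * s - κ * ((s - M) / √(delta M a s)) with hm
  have hmpos : 0 < m := by
    have := gap_ge_tangent ha haM hκ.le hE.le h1.le hs hs0
    nlinarith
  have hG : ∀ r, s < r → 0 < radialGap M a E L κ r := fun r hr =>
    (mul_pos hmpos (sub_pos.2 hr)).trans_le
      (gap_ge_tangent ha haM hκ.le hE.le (hs.trans hr).le hs hs0)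
  have hXs : 0 < carterX a E L s := by
    have hq := Real.sqrt_pos.2 (delta_pos ha haM hs)
    have : carterX a E L s = κ * √(delta M a s) := by
      simp only [radialGap] at hs0; linarith
    rw [this]; positivity
  have hr0 : 0 < r₀ := hspos.trans_le hsI.2
  refine ⟨hE, -1 / s, div_neg_of_neg_of_pos (by norm_num) hspos, ?_, ?_, fun r hr => ?_⟩
  · field_simp; exact hs
  · have hRs : carterX a E L s ^ 2 - delta M a s * κ ^ 2 = 0 := by
      rw [potential_eq ha haM hs.le, hs0, zero_mul]
    refine reaches_of_root ?_ (div_neg_of_neg_of_pos (by norm_num) hr0) ?_ ?_ ?_ ?_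
    · rw [neg_div, neg_div, neg_le_neg_iff]
      exact one_div_le_one_div_of_le hspos hsI.2
    · rw [outgoingPotential_eval_inv hspos.ne', hRs, zero_div]
    · rw [outgoingPotential_derivative_eval_inv hspos.ne', hRs,
        potential_deriv_of_gap ha haM hs hs0, ← hm]
      simp only [mul_zero, zero_div, sub_zero]
      positivity
    · rw [outgoingPotential_eval_inv hr0.ne', ← hρ]
      field_simp
    · intro x hx
      rcases hx.2.eq_or_lt with rfl | hx0
      · simp only [outgoingPotential_eval]; ring_nf; positivity
      have hxr : s < -1 / x := by
        rw [lt_div_iff_of_neg hx0]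
        have := (div_lt_iff₀ hspos).1 hx.1
        linarith
      have hxe : x = -1 / (-1 / x) := by field_simp
      rw [hxe, outgoingPotential_eval_inv (hspos.trans hxr).ne']
      exact div_pos (potential_pos ha haM hκ.le (hs.trans hxr).le (hG _ hxr))
        (pow_pos (hspos.trans hxr) 4)
  · have hr' : s ≤ r := by
      have : -1 / (-1 / s) = s := by field_simp
      rwa [this] at hr
    rcases hr'.eq_or_lt with rfl | h
    · exact hXs
    · exact carterX_pos_of_gap hκ.le (hG r h)

/-- A potential barrier above the starting point makes the motion fall. -/
theorem radiallyFalls_of_barrier (ha : 0 ≤ a) (haM : a < M) (hκ : 0 < κ) (h0 : rPlus M a < r₀)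
    (h01 : r₀ < r₁) (hG1 : radialGap M a E L κ r₁ < 0) (hG0 : 0 ≤ radialGap M a E L κ r₀)
    (hρ : ρ₀ ^ 2 = carterX a E L r₀ ^ 2 - delta M a r₀ * κ ^ 2) :
    RadiallyFalls M a E L (κ ^ 2) r₀ ρ₀ := by
  have hrp := rPlus_pos ha haM
  have hMr := lt_rPlus ha haM
  obtain ⟨s, hsI, hs0⟩ := intermediate_value_Icc' h01.le
    (continuous_radialGap (M := M) (a := a) (E := E) (L := L) (κ := κ)).continuousOn
    ⟨hG1.le, hG0⟩
  have hs1 : s < r₁ := hsI.2.lt_of_ne (by rintro rfl; linarith)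
  have hs := h0.trans_le hsI.1
  have hspos := hrp.trans hs
  have hq := Real.sqrt_pos.2 (delta_pos ha haM hs)
  set m := 2 * E * s - κ * ((s - M) / √(delta M a s)) with hm
  have hmneg : m < 0 := by
    rcases le_or_gt E 0 with hE | hE
    · have h1 : 0 < κ * ((s - M) / √(delta M a s)) :=
        mul_pos hκ (div_pos (by linarith) hq)
      have h2 : E * s ≤ 0 := mul_nonpos_of_nonpos_of_nonneg hE hspos.le
      rw [hm]; linarith
    · have := gap_ge_tangent ha haM hκ.le hE.le (hs.trans hs1).le hs hs0
      nlinarith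
  have hG : ∀ r, rPlus M a ≤ r → r < s → 0 < radialGap M a E L κ r := by
    intro r hr hrs
    rcases le_or_gt E 0 with hE | hE
    · have h1 := mul_lt_mul_of_pos_left (sqrt_delta_lt ha haM hr hrs) hκ
      have h2 : 0 ≤ E * (r ^ 2 - s ^ 2) := mul_nonneg_of_nonpos_of_nonpos hE (by nlinarith)
      simp only [radialGap, carterX] at hs0 ⊢
      nlinarith
    · exact (mul_pos_of_neg_of_neg hmneg (sub_neg.2 hrs)).trans_le
        (gap_ge_tangent ha haM hκ.le hE.le hr hs hs0)
  have hXs : 0 < carterX a E L s := by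
    have : carterX a E L s = κ * √(delta M a s) := by
      simp only [radialGap] at hs0; linarith
    rw [this]; positivity
  have hRs : carterX a E L s ^ 2 - delta M a s * κ ^ 2 = 0 := by
    rw [potential_eq ha haM hs.le, hs0, zero_mul]
  refine ⟨-s, reaches_of_root (by linarith [hsI.1]) (by linarith) ?_ ?_ ?_ ?_, fun r hr hrs => ?_⟩
  · rw [ingoingPotential_eval, hRs]
  · rw [ingoingPotential_derivative_eval, potential_deriv_of_gap ha haM hs hs0, ← hm]
    nlinarith [mul_pos_of_neg_of_neg hmneg (neg_neg_of_pos hXs)]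
  · rw [neg_sq, ingoingPotential_eval, hρ]
  · intro x hx
    rw [← neg_neg x, ingoingPotential_eval]
    have hx1 : rPlus M a ≤ -x := by linarith [hx.2]
    exact potential_pos ha haM hκ.le hx1 (hG _ hx1 (by linarith [hx.1]))
  · rw [neg_neg] at hrs
    rcases hrs.eq_or_lt with rfl | h
    · exact hXs
    · exact carterX_pos_of_gap hκ.le (hG r hr h)

/-- An outgoing motion that meets no barrier escapes. -/
theorem radiallyEscapes_of_gap_pos (ha : 0 ≤ a) (haM : a < M) (hκ : 0 ≤ κ)
    (hκE : κ = 0 → 0 < E) (h0 : rPlus M a < r₀)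
    (hG : ∀ r, r₀ ≤ r → 0 < radialGap M a E L κ r) (hρ0 : 0 < ρ₀)
    (hρ : ρ₀ ^ 2 = carterX a E L r₀ ^ 2 - delta M a r₀ * κ ^ 2) :
    RadiallyEscapes M a E L (κ ^ 2) r₀ ρ₀ := by
  have hrp := rPlus_pos ha haM
  have hr0 := hrp.trans h0
  have hE : 0 < E := by
    rcases hκ.eq_or_lt with h | hκ'
    · exact hκE h.symm
    by_contra hE
    rw [not_lt] at hE
    -- At this radius the barrier `κ √Δ` exceeds the value of `X` at the start.
    have hX0 := carterX_pos_of_gap hκ (hG r₀ le_rfl)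
    set r := r₀ + 2 * M + carterX a E L r₀ / κ with hr
    have hdiv : 0 < carterX a E L r₀ / κ := div_pos hX0 hκ'
    have hM : 0 < M := by linarith
    have hle : r₀ ≤ r := by linarith
    have h1 : carterX a E L r ≤ carterX a E L r₀ := by
      have : E * (r ^ 2 - r₀ ^ 2) ≤ 0 := mul_nonpos_of_nonpos_of_nonneg hE (by nlinarith)
      simp only [carterX]
      nlinarith
    have h2 : carterX a E L r₀ / κ ≤ √(delta M a r) := by
      refine Real.le_sqrt_of_sq_le ?_
      simp only [delta]
      nlinarith
    have h3 : carterX a E L r₀ ≤ κ * √(delta M a r) := by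
      rw [div_le_iff₀ hκ'] at h2; linarith
    have := hG r hle
    simp only [radialGap] at this
    linarith
  have hdd : -1 / (-1 / r₀) = r₀ := by field_simp
  have hneg : -1 / r₀ < 0 := div_neg_of_neg_of_pos (by norm_num) hr0
  refine ⟨hE, -1 / r₀, hneg, by rwa [hdd], ?_, fun r hr => ?_⟩
  · refine reaches_of_pos hneg (by positivity) ?_ fun x hx => ?_
    · rw [outgoingPotential_eval_inv hr0.ne', ← hρ]
      field_simp
    · rcases hx.2.eq_or_lt with rfl | hx0
      · simp only [outgoingPotential_eval]; ring_nf; positivity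
      have hxr : r₀ ≤ -1 / x := by
        rw [le_div_iff_of_neg hx0]
        have := (div_le_iff₀ hr0).1 hx.1
        linarith
      have hxe : x = -1 / (-1 / x) := by field_simp
      rw [hxe, outgoingPotential_eval_inv (hr0.trans_le hxr).ne']
      exact div_pos (potential_pos ha haM hκ (h0.le.trans hxr) (hG _ hxr))
        (pow_pos (hr0.trans_le hxr) 4)
  · rw [hdd] at hr
    exact carterX_pos_of_gap hκ (hG r hr)

/-- An ingoing motion that meets no barrier falls. -/
theorem radiallyFalls_of_gap_pos (ha : 0 ≤ a) (haM : a < M) (hκ : 0 ≤ κ) (h0 : rPlus M a < r₀)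
    (hG : ∀ r, rPlus M a ≤ r → r ≤ r₀ → 0 < radialGap M a E L κ r) (hρ0 : ρ₀ < 0)
    (hρ : ρ₀ ^ 2 = carterX a E L r₀ ^ 2 - delta M a r₀ * κ ^ 2) :
    RadiallyFalls M a E L (κ ^ 2) r₀ ρ₀ := by
  refine ⟨-r₀, reaches_of_pos (by linarith) (by linarith) ?_ fun x hx => ?_, fun r h1 h2 => ?_⟩
  · rw [neg_sq, ingoingPotential_eval, hρ]
  · rw [← neg_neg x, ingoingPotential_eval]
    exact potential_pos ha haM hκ (by linarith [hx.2])
      (hG _ (by linarith [hx.2]) (by linarith [hx.1]))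
  · rw [neg_neg] at h2
    exact carterX_pos_of_gap hκ (hG r h1 h2)

end

/-! ### Null vectors in Carter's tetrad -/

/-- The energy of a null vector with `X = √(ΣΔ)` times its time component in Carter's tetrad, and
with the axial component `W = (n × N)₃` of its angular part `N`. -/
noncomputable def tetradEnergy (a r n₃ X W : ℝ) : ℝ := (X + a * W) / (r ^ 2 + a ^ 2 * n₃ ^ 2)

/-- The axial angular momentum `W + a E sin² θ`. -/
noncomputable def tetradMomentum (a r n₃ X W : ℝ) : ℝ :=
  W + a * tetradEnergy a r n₃ X W * (1 - n₃ ^ 2)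

/-- The tangent vector at the point with radius `r` and direction `n` whose components in Carter's
tetrad are, up to normalisation, `X` (time), `ρ` (radius) and the vector `N` orthogonal to `n`
(angles). -/
noncomputable def tetradVector (M a r n₁ n₂ n₃ X ρ N₁ N₂ N₃ : ℝ) : Fin 4 → ℝ :=
  let E := tetradEnergy a r n₃ X (n₁ * N₂ - n₂ * N₁)
  let L := tetradMomentum a r n₃ X (n₁ * N₂ - n₂ * N₁)
  orbitVelocity M a E L r ρ n₁ n₂ n₃ (N₁ - a * E * n₂) (N₂ + a * E * n₁) N₃

section

variable {M a r n₁ n₂ n₃ X ρ N₁ N₂ N₃ W t : ℝ}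

theorem carterX_tetrad (hr : 0 < r) :
    carterX a (tetradEnergy a r n₃ X W) (tetradMomentum a r n₃ X W) r = X := by
  have hS : r ^ 2 + a ^ 2 * n₃ ^ 2 ≠ 0 := by positivity
  have hE : tetradEnergy a r n₃ X W * (r ^ 2 + a ^ 2 * n₃ ^ 2) = X + a * W := by
    rw [tetradEnergy]; field_simp
  simp only [carterX, tetradMomentum]
  linear_combination hE

theorem isAngularData_tetrad (hn : n₁ ^ 2 + n₂ ^ 2 + n₃ ^ 2 = 1)
    (hN : n₁ * N₁ + n₂ * N₂ + n₃ * N₃ = 0) {E K : ℝ}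
    (hE : E = tetradEnergy a r n₃ X (n₁ * N₂ - n₂ * N₁)) (hK : K = N₁ ^ 2 + N₂ ^ 2 + N₃ ^ 2) :
    IsAngularData a E (tetradMomentum a r n₃ X (n₁ * N₂ - n₂ * N₁)) K
      n₁ n₂ n₃ (N₁ - a * E * n₂) (N₂ + a * E * n₁) N₃ := by
  refine ⟨hn, by linear_combination hN, ?_, ?_⟩
  · rw [tetradMomentum, ← hE]
    linear_combination a * E * hn
  · rw [tetradMomentum, ← hE, hK]
    linear_combination a ^ 2 * E ^ 2 * hn

/-- The components of `tetradVector`, without the constants of motion. -/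
theorem tetradVector_eq (hr : 0 < r) :
    tetradVector M a r n₁ n₂ n₃ X ρ N₁ N₂ N₃ =
      ![((r ^ 2 + a ^ 2) * X / delta M a r + a * (n₁ * N₂ - n₂ * N₁)) / (r ^ 2 + a ^ 2 * n₃ ^ 2),
        (ρ * n₁ + r * (N₁ - a * X / delta M a r * n₂)) / (r ^ 2 + a ^ 2 * n₃ ^ 2),
        (ρ * n₂ + r * (N₂ + a * X / delta M a r * n₁)) / (r ^ 2 + a ^ 2 * n₃ ^ 2),
        (ρ * n₃ + r * N₃) / (r ^ 2 + a ^ 2 * n₃ ^ 2)] := by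
  simp only [tetradVector, orbitVelocity, carterX_tetrad hr]
  congr 1
  · rw [tetradMomentum]; ring_nf
  · congr 1
    · ring_nf
    · congr 1
      ring_nf

/-- Every tangent vector has components in Carter's tetrad. -/
theorem exists_eq_tetradVector (hr : 0 < r) (hD : delta M a r ≠ 0)
    (hn : n₁ ^ 2 + n₂ ^ 2 + n₃ ^ 2 = 1) (v : Fin 4 → ℝ) :
    ∃ X ρ N₁ N₂ N₃ : ℝ, n₁ * N₁ + n₂ * N₂ + n₃ * N₃ = 0 ∧
      v = tetradVector M a r n₁ n₂ n₃ X ρ N₁ N₂ N₃ := by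
  have hS : r ^ 2 + a ^ 2 * n₃ ^ 2 ≠ 0 := by positivity
  set S := r ^ 2 + a ^ 2 * n₃ ^ 2 with hSdef
  set ω := (n₁ * v 2 - n₂ * v 1) / r with hω
  set d := n₁ * v 1 + n₂ * v 2 + n₃ * v 3 with hd
  set τ := v 0 - a * ω with hτ
  have hωr : r * ω = n₁ * v 2 - n₂ * v 1 := by rw [hω]; field_simp
  refine ⟨delta M a r * τ, S * d, S * ((v 1 - n₁ * d) / r) + a * τ * n₂,
    S * ((v 2 - n₂ * d) / r) - a * τ * n₁, S * ((v 3 - n₃ * d) / r), ?_, ?_⟩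
  · field_simp
    linear_combination (-S * d) * hn
  · rw [tetradVector_eq hr]
    ext i
    fin_cases i
    · have : v 0 = τ + a * ω := by rw [hτ]; ring
      simp only [Fin.zero_eta, Matrix.cons_val_zero]
      rw [this, ← hSdef]
      have h1 : n₁ * (S * ((v 2 - n₂ * d) / r) - a * τ * n₁)
          - n₂ * (S * ((v 1 - n₁ * d) / r) + a * τ * n₂) = S * ω - a * τ * (1 - n₃ ^ 2) := by
        rw [hω]; field_simp
        linear_combination (-a * τ * r) * hn
      rw [h1]
      field_simp
      rw [hSdef]; ring
    · simp only [Fin.mk_one, Matrix.cons_val_one, Matrix.cons_val_zero]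
      rw [← hSdef]
      field_simp
      ring
    · simp only [Fin.reduceFinMk, Matrix.cons_val]
      rw [← hSdef]
      field_simp
      ring
    · simp only [Fin.reduceFinMk, Matrix.cons_val]
      rw [← hSdef]
      field_simp
      ring

theorem metric_tetradVector_self (hr : 0 < r) (hD : delta M a r ≠ 0)
    (hn : n₁ ^ 2 + n₂ ^ 2 + n₃ ^ 2 = 1) (hN : n₁ * N₁ + n₂ * N₂ + n₃ * N₃ = 0) :
    metric M a ![t, r * n₁, r * n₂, r * n₃] (tetradVector M a r n₁ n₂ n₃ X ρ N₁ N₂ N₃)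
      (tetradVector M a r n₁ n₂ n₃ X ρ N₁ N₂ N₃)
      = (ρ ^ 2 - X ^ 2 + delta M a r * (N₁ ^ 2 + N₂ ^ 2 + N₃ ^ 2))
        / (delta M a r * (r ^ 2 + a ^ 2 * n₃ ^ 2)) := by
  have hS : r ^ 2 + a ^ 2 * n₃ ^ 2 ≠ 0 := by positivity
  have hdat := isAngularData_tetrad (r := r) (X := X) (a := a) hn hN rfl rfl
  conv_lhs => arg 4; rw [tetradVector]
  rw [metric_orbitVelocity hr hD hn hdat.orthogonal hdat.axial, tetradVector_eq hr]
  have hE : tetradEnergy a r n₃ X (n₁ * N₂ - n₂ * N₁) * (r ^ 2 + a ^ 2 * n₃ ^ 2)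
      = X + a * (n₁ * N₂ - n₂ * N₁) := by
    rw [tetradEnergy]; field_simp
  generalize tetradEnergy a r n₃ X (n₁ * N₂ - n₂ * N₁) = E at *
  simp only [Matrix.cons_val]
  set S := r ^ 2 + a ^ 2 * n₃ ^ 2 with hSdef
  generalize delta M a r = D at *
  set c := a * X / D with hc
  have hcD : c * D = a * X := by rw [hc]; field_simp
  have h1 : n₁ * ((ρ * n₁ + r * (N₁ - c * n₂)) / S) + n₂ * ((ρ * n₂ + r * (N₂ + c * n₁)) / S)
      + n₃ * ((ρ * n₃ + r * N₃) / S) = ρ / S := by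
    field_simp
    linear_combination ρ * hn + r * hN
  have h2 : ((N₁ - a * E * n₂) * ((ρ * n₁ + r * (N₁ - c * n₂)) / S)
      + (N₂ + a * E * n₁) * ((ρ * n₂ + r * (N₂ + c * n₁)) / S) + N₃ * ((ρ * n₃ + r * N₃) / S)) / r
      = (N₁ ^ 2 + N₂ ^ 2 + N₃ ^ 2 + (c + a * E) * (n₁ * N₂ - n₂ * N₁)
        + a * E * c * (1 - n₃ ^ 2)) / S := by
    field_simp
    linear_combination ρ * hN + r * a * E * c * hn
  rw [h1, h2]
  field_simp
  linear_combination (n₁ * N₂ - n₂ * N₁ + a * E * (1 - n₃ ^ 2)) * hcD - X * hE - E * X * hSdef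

theorem metric_tetradVector_timeDirection (hr : 0 < r) (hD : delta M a r ≠ 0)
    (hn : n₁ ^ 2 + n₂ ^ 2 + n₃ ^ 2 = 1) (hN : n₁ * N₁ + n₂ * N₂ + n₃ * N₃ = 0) :
    metric M a ![t, r * n₁, r * n₂, r * n₃] (tetradVector M a r n₁ n₂ n₃ X ρ N₁ N₂ N₃)
      (timeDirection a ![t, r * n₁, r * n₂, r * n₃]) = -X := by
  have hdat := isAngularData_tetrad (r := r) (X := X) (a := a) hn hN rfl rfl
  rw [tetradVector]
  rw [metric_orbitVelocity hr hD hn hdat.orthogonal hdat.axial]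
  nth_rewrite 4 [← carterX_tetrad (a := a) (n₃ := n₃) (X := X) (W := n₁ * N₂ - n₂ * N₁) hr]
  have hax := hdat.axial
  generalize tetradMomentum a r n₃ X (n₁ * N₂ - n₂ * N₁) = L at *
  generalize tetradEnergy a r n₃ X (n₁ * N₂ - n₂ * N₁) = E at *
  simp only [timeDirection, radius_polar hr hn, Matrix.cons_val, carterX]
  field_simp
  linear_combination a * r * delta M a r * hax

end

/-! ### Cones of infalling and escaping null vectors -/

/-- The tangent vectors at `p` all of whose positive multiples are tangent to a geodesic that meets
the future horizon. -/
def fallingCone (M a : ℝ) (p : Fin 4 → ℝ) : Set (Fin 4 → ℝ) :=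
  {v | ∀ c : ℝ, 0 < c → ∃ γ J, IsGeodesicOn M a γ J ∧ (0 : ℝ) ∈ J ∧ γ 0 = p ∧
    deriv γ 0 = c • v ∧ MeetsFutureHorizon M a γ J}

/-- The tangent vectors at `p` all of whose positive multiples are tangent to a geodesic that meets
future null infinity. -/
def escapingCone (M a : ℝ) (p : Fin 4 → ℝ) : Set (Fin 4 → ℝ) :=
  {v | ∀ c : ℝ, 0 < c → ∃ γ J, IsGeodesicOn M a γ J ∧ (0 : ℝ) ∈ J ∧ γ 0 = p ∧
    deriv γ 0 = c • v ∧ MeetsFutureNullInfinity M a γ J}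

/-- The null vectors at `p`. -/
def nullCone (M a : ℝ) (p : Fin 4 → ℝ) : Set (Fin 4 → ℝ) := {v | metric M a p v v = 0}

/-- The radial gap of the null vector with tetrad components `X` and angular part of length `κ` and
axial component `W`, at the point with radius `r`. -/
noncomputable def tetradGap (M a r n₃ X W κ s : ℝ) : ℝ :=
  radialGap M a (tetradEnergy a r n₃ X W) (tetradMomentum a r n₃ X W) κ s

/-- The components in Carter's tetrad, at the point with radius `r` and direction `n`, of a future
null vector with angular part of length `κ`. -/
structure IsNullData (M a r n₁ n₂ n₃ X ρ N₁ N₂ N₃ κ : ℝ) : Prop where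
  unit : n₁ ^ 2 + n₂ ^ 2 + n₃ ^ 2 = 1
  orthogonal : n₁ * N₁ + n₂ * N₂ + n₃ * N₃ = 0
  norm : N₁ ^ 2 + N₂ ^ 2 + N₃ ^ 2 = κ ^ 2
  norm_nonneg : 0 ≤ κ
  exterior : rPlus M a < r
  future : 0 < X
  null : ρ ^ 2 = X ^ 2 - delta M a r * κ ^ 2

section

variable {M a r n₁ n₂ n₃ X ρ N₁ N₂ N₃ W κ s c t μ ς : ℝ}

theorem tetradEnergy_mul : tetradEnergy a r n₃ (c * X) (c * W) = c * tetradEnergy a r n₃ X W := by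
  simp only [tetradEnergy]; ring

theorem tetradMomentum_mul :
    tetradMomentum a r n₃ (c * X) (c * W) = c * tetradMomentum a r n₃ X W := by
  simp only [tetradMomentum, tetradEnergy_mul]; ring

theorem smul_tetradVector (hr : 0 < r) : c • tetradVector M a r n₁ n₂ n₃ X ρ N₁ N₂ N₃
    = tetradVector M a r n₁ n₂ n₃ (c * X) (c * ρ) (c * N₁) (c * N₂) (c * N₃) := by
  rw [tetradVector_eq hr, tetradVector_eq hr]
  ext i
  fin_cases i <;> simp <;> ring

theorem tetradGap_mul : tetradGap M a r n₃ (c * X) (c * W) (c * κ) s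
    = c * tetradGap M a r n₃ X W κ s := by
  simp only [tetradGap, radialGap, tetradEnergy_mul, tetradMomentum_mul, carterX]; ring

theorem continuous_tetradGap : Continuous (tetradGap M a r n₃ X W κ) := continuous_radialGap

theorem tetradGap_self (hr : 0 < r) : tetradGap M a r n₃ X W κ r = X - κ * √(delta M a r) := by
  rw [tetradGap, radialGap, carterX_tetrad hr]

/-- Shrinking the angular part of a null vector by the factor `1 - μ` moves its radial gap towards
that of a principal null vector. -/
theorem tetradGap_shrink (hr : 0 < r) : tetradGap M a r n₃ X ((1 - μ) * W) ((1 - μ) * κ) s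
    = (1 - μ) * tetradGap M a r n₃ X W κ s
      + μ * (X * (s ^ 2 + a ^ 2 * n₃ ^ 2) / (r ^ 2 + a ^ 2 * n₃ ^ 2)) := by
  have hS : r ^ 2 + a ^ 2 * n₃ ^ 2 ≠ 0 := by positivity
  simp only [tetradGap, radialGap, carterX, tetradMomentum, tetradEnergy]
  field_simp
  ring

namespace IsNullData

theorem radius_pos (h : IsNullData M a r n₁ n₂ n₃ X ρ N₁ N₂ N₃ κ) (ha : 0 ≤ a) (haM : a < M) :
    0 < r := (rPlus_pos ha haM).trans h.exterior

theorem mul (h : IsNullData M a r n₁ n₂ n₃ X ρ N₁ N₂ N₃ κ) (hc : 0 < c) :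
    IsNullData M a r n₁ n₂ n₃ (c * X) (c * ρ) (c * N₁) (c * N₂) (c * N₃) (c * κ) where
  unit := h.unit
  orthogonal := by linear_combination c * h.orthogonal
  norm := by linear_combination c ^ 2 * h.norm
  norm_nonneg := mul_nonneg hc.le h.norm_nonneg
  exterior := h.exterior
  future := mul_pos hc h.future
  null := by linear_combination c ^ 2 * h.null

theorem gap_self_nonneg (h : IsNullData M a r n₁ n₂ n₃ X ρ N₁ N₂ N₃ κ) (ha : 0 ≤ a)
    (haM : a < M) : 0 ≤ tetradGap M a r n₃ X W κ r := by
  rw [tetradGap_self (h.radius_pos ha haM), sub_nonneg]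
  refine abs_le_of_sq_le_sq' ?_ h.future.le |>.2
  rw [mul_pow, Real.sq_sqrt (delta_pos ha haM h.exterior).le]
  nlinarith [h.null, sq_nonneg ρ]

theorem axial_eq_zero (h : IsNullData M a r n₁ n₂ n₃ X ρ N₁ N₂ N₃ 0) :
    n₁ * N₂ - n₂ * N₁ = 0 := by
  have h1 : N₁ = 0 := by nlinarith [h.norm, sq_nonneg N₁, sq_nonneg N₂, sq_nonneg N₃]
  have h2 : N₂ = 0 := by nlinarith [h.norm, sq_nonneg N₁, sq_nonneg N₂, sq_nonneg N₃]
  rw [h1, h2]; ring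

theorem mem_nullCone (h : IsNullData M a r n₁ n₂ n₃ X ρ N₁ N₂ N₃ κ) (ha : 0 ≤ a) (haM : a < M) :
    tetradVector M a r n₁ n₂ n₃ X ρ N₁ N₂ N₃ ∈ nullCone M a ![t, r * n₁, r * n₂, r * n₃] := by
  rw [nullCone, mem_ofPred_eq, metric_tetradVector_self (h.radius_pos ha haM)
    (delta_pos ha haM h.exterior).ne' h.unit h.orthogonal, h.norm, h.null]
  ring

theorem exists_infalling (h : IsNullData M a r n₁ n₂ n₃ X ρ N₁ N₂ N₃ κ) (ha : 0 ≤ a) (haM : a < M)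
    (t : ℝ) (hf : RadiallyFalls M a (tetradEnergy a r n₃ X (n₁ * N₂ - n₂ * N₁))
      (tetradMomentum a r n₃ X (n₁ * N₂ - n₂ * N₁)) (κ ^ 2) r ρ) :
    ∃ γ J, IsGeodesicOn M a γ J ∧ (0 : ℝ) ∈ J ∧ γ 0 = ![t, r * n₁, r * n₂, r * n₃] ∧
      deriv γ 0 = tetradVector M a r n₁ n₂ n₃ X ρ N₁ N₂ N₃ ∧ MeetsFutureHorizon M a γ J := by
  obtain ⟨x_b, hre, hX⟩ := hf
  exact Kerr.exists_infalling ha haM (sq_nonneg κ) hre hX t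
    (isAngularData_tetrad h.unit h.orthogonal rfl h.norm.symm)

theorem exists_escaping (h : IsNullData M a r n₁ n₂ n₃ X ρ N₁ N₂ N₃ κ) (ha : 0 ≤ a) (haM : a < M)
    (t : ℝ) (hf : RadiallyEscapes M a (tetradEnergy a r n₃ X (n₁ * N₂ - n₂ * N₁))
      (tetradMomentum a r n₃ X (n₁ * N₂ - n₂ * N₁)) (κ ^ 2) r ρ) :
    ∃ γ J, IsGeodesicOn M a γ J ∧ (0 : ℝ) ∈ J ∧ γ 0 = ![t, r * n₁, r * n₂, r * n₃] ∧
      deriv γ 0 = tetradVector M a r n₁ n₂ n₃ X ρ N₁ N₂ N₃ ∧ MeetsFutureNullInfinity M a γ J := by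
  obtain ⟨hE, x_b, hxb, hxb', hre, hX⟩ := hf
  exact Kerr.exists_escaping ha haM (sq_nonneg κ) hE (h.radius_pos ha haM) hxb' hxb hre hX t
    (isAngularData_tetrad h.unit h.orthogonal rfl h.norm.symm)

theorem carterX_eq (h : IsNullData M a r n₁ n₂ n₃ X ρ N₁ N₂ N₃ κ) (ha : 0 ≤ a) (haM : a < M) :
    ρ ^ 2 = carterX a (tetradEnergy a r n₃ X W) (tetradMomentum a r n₃ X W) r ^ 2
      - delta M a r * κ ^ 2 := by
  rw [carterX_tetrad (h.radius_pos ha haM), h.null]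

theorem mem_fallingCone_of_barrier (h : IsNullData M a r n₁ n₂ n₃ X ρ N₁ N₂ N₃ κ) (ha : 0 ≤ a)
    (haM : a < M) (hκ : 0 < κ) (hs : r < s)
    (hG : tetradGap M a r n₃ X (n₁ * N₂ - n₂ * N₁) κ s < 0) :
    tetradVector M a r n₁ n₂ n₃ X ρ N₁ N₂ N₃ ∈ fallingCone M a ![t, r * n₁, r * n₂, r * n₃] := by
  intro c hc
  rw [smul_tetradVector (h.radius_pos ha haM)]
  have h' := h.mul hc
  refine h'.exists_infalling ha haM t (radiallyFalls_of_barrier ha haM (mul_pos hc hκ) h.exterior hs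
    ?_ (h'.gap_self_nonneg ha haM) (h'.carterX_eq ha haM))
  rw [← tetradGap, show n₁ * (c * N₂) - n₂ * (c * N₁) = c * (n₁ * N₂ - n₂ * N₁) by ring,
    tetradGap_mul]
  exact mul_neg_of_pos_of_neg hc hG

theorem mem_escapingCone_of_barrier (h : IsNullData M a r n₁ n₂ n₃ X ρ N₁ N₂ N₃ κ) (ha : 0 ≤ a)
    (haM : a < M) (hκ : 0 < κ) (hs : s < r) (hs' : rPlus M a ≤ s)
    (hG : tetradGap M a r n₃ X (n₁ * N₂ - n₂ * N₁) κ s < 0) :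
    tetradVector M a r n₁ n₂ n₃ X ρ N₁ N₂ N₃ ∈ escapingCone M a ![t, r * n₁, r * n₂, r * n₃] := by
  -- move the barrier off the horizon
  obtain ⟨q, hqG, hsq, hqr⟩ : ∃ q, tetradGap M a r n₃ X (n₁ * N₂ - n₂ * N₁) κ q < 0 ∧
      s < q ∧ q < r :=
    (((continuous_tetradGap.tendsto s).eventually_lt_const hG).filter_mono
      nhdsWithin_le_nhds |>.and (Ioo_mem_nhdsGT hs)).exists
  intro c hc
  rw [smul_tetradVector (h.radius_pos ha haM)]
  have h' := h.mul hc
  refine h'.exists_escaping ha haM t (radiallyEscapes_of_barrier ha haM (mul_pos hc hκ)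
    (hs'.trans_lt hsq) hqr ?_ (h'.gap_self_nonneg ha haM) (h'.carterX_eq ha haM))
  rw [← tetradGap, show n₁ * (c * N₂) - n₂ * (c * N₁) = c * (n₁ * N₂ - n₂ * N₁) by ring,
    tetradGap_mul]
  exact mul_neg_of_pos_of_neg hc hqG

theorem mem_fallingCone_of_gap_pos (h : IsNullData M a r n₁ n₂ n₃ X ρ N₁ N₂ N₃ κ) (ha : 0 ≤ a)
    (haM : a < M) (hρ : ρ < 0)
    (hG : ∀ s, rPlus M a ≤ s → s ≤ r → 0 < tetradGap M a r n₃ X (n₁ * N₂ - n₂ * N₁) κ s) :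
    tetradVector M a r n₁ n₂ n₃ X ρ N₁ N₂ N₃ ∈ fallingCone M a ![t, r * n₁, r * n₂, r * n₃] := by
  intro c hc
  rw [smul_tetradVector (h.radius_pos ha haM)]
  have h' := h.mul hc
  refine h'.exists_infalling ha haM t (radiallyFalls_of_gap_pos ha haM h'.norm_nonneg h.exterior
    (fun s h1 h2 => ?_) (mul_neg_of_pos_of_neg hc hρ) (h'.carterX_eq ha haM))
  rw [← tetradGap, show n₁ * (c * N₂) - n₂ * (c * N₁) = c * (n₁ * N₂ - n₂ * N₁) by ring,
    tetradGap_mul]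
  exact mul_pos hc (hG s h1 h2)

theorem mem_escapingCone_of_gap_pos (h : IsNullData M a r n₁ n₂ n₃ X ρ N₁ N₂ N₃ κ) (ha : 0 ≤ a)
    (haM : a < M) (hρ : 0 < ρ)
    (hG : ∀ s, r ≤ s → 0 < tetradGap M a r n₃ X (n₁ * N₂ - n₂ * N₁) κ s) :
    tetradVector M a r n₁ n₂ n₃ X ρ N₁ N₂ N₃ ∈ escapingCone M a ![t, r * n₁, r * n₂, r * n₃] := by
  intro c hc
  have hr := h.radius_pos ha haM
  rw [smul_tetradVector hr]
  have h' := h.mul hc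
  refine h'.exists_escaping ha haM t (radiallyEscapes_of_gap_pos ha haM h'.norm_nonneg (fun h0 => ?_)
    h.exterior (fun s h1 => ?_) (mul_pos hc hρ) (h'.carterX_eq ha haM))
  · rw [h0] at h'
    have hS : 0 < r ^ 2 + a ^ 2 * n₃ ^ 2 := by positivity
    rw [h'.axial_eq_zero, tetradEnergy, mul_zero, add_zero]
    exact div_pos h'.future hS
  rw [← tetradGap, show n₁ * (c * N₂) - n₂ * (c * N₁) = c * (n₁ * N₂ - n₂ * N₁) by ring,
    tetradGap_mul]
  exact mul_pos hc (hG s h1)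

/-- Shrinking the angular part and adjusting the radial component gives null vectors again. -/
theorem shrink (h : IsNullData M a r n₁ n₂ n₃ X ρ N₁ N₂ N₃ κ) (hμ : μ ≤ 1) (hς : ς ^ 2 = 1)
    (hrad : 0 ≤ X ^ 2 - delta M a r * ((1 - μ) * κ) ^ 2) :
    IsNullData M a r n₁ n₂ n₃ X (ς * √(X ^ 2 - delta M a r * ((1 - μ) * κ) ^ 2))
      ((1 - μ) * N₁) ((1 - μ) * N₂) ((1 - μ) * N₃) ((1 - μ) * κ) where
  unit := h.unit
  orthogonal := by linear_combination (1 - μ) * h.orthogonal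
  norm := by linear_combination (1 - μ) ^ 2 * h.norm
  norm_nonneg := mul_nonneg (by linarith) h.norm_nonneg
  exterior := h.exterior
  future := h.future
  null := by rw [mul_pow, hς, one_mul, Real.sq_sqrt hrad]

/-- If the shrunken vectors eventually lie in `A`, then the original vector lies in its closure. -/
theorem mem_closure_of_shrink (h : IsNullData M a r n₁ n₂ n₃ X ρ N₁ N₂ N₃ κ) (ha : 0 ≤ a)
    (haM : a < M) (hς : ς * |ρ| = ρ) (A : Set (Fin 4 → ℝ)) {F : Filter ℝ} [F.NeBot]
    (hF : F ≤ 𝓝 0)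
    (hA : ∀ᶠ μ in F, tetradVector M a r n₁ n₂ n₃ X
      (ς * √(X ^ 2 - delta M a r * ((1 - μ) * κ) ^ 2))
      ((1 - μ) * N₁) ((1 - μ) * N₂) ((1 - μ) * N₃) ∈ A) :
    tetradVector M a r n₁ n₂ n₃ X ρ N₁ N₂ N₃ ∈ closure A := by
  have hcont : Continuous fun μ : ℝ => tetradVector M a r n₁ n₂ n₃ X
      (ς * √(X ^ 2 - delta M a r * ((1 - μ) * κ) ^ 2))
      ((1 - μ) * N₁) ((1 - μ) * N₂) ((1 - μ) * N₃) := by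
    simp only [tetradVector_eq (h.radius_pos ha haM)]
    refine continuous_pi fun i => ?_
    fin_cases i <;> simp <;> fun_prop
  have hlim := (hcont.tendsto 0).mono_left hF
  simp only [sub_zero, one_mul, ← h.null, Real.sqrt_sq_eq_abs, hς] at hlim
  exact mem_closure_of_tendsto hlim hA

/-- A null vector outside both cones is a limit of null vectors in each of them.  Its radial gap is
nonnegative.  Shrinking the angular part makes the gap positive, and the motion then keeps its
radial direction; enlarging it creates a potential barrier ahead, which reverses the motion. -/
theorem mem_closure_cones (h : IsNullData M a r n₁ n₂ n₃ X ρ N₁ N₂ N₃ κ) (ha : 0 ≤ a)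
    (haM : a < M)
    (hf : tetradVector M a r n₁ n₂ n₃ X ρ N₁ N₂ N₃ ∉ fallingCone M a ![t, r * n₁, r * n₂, r * n₃])
    (he : tetradVector M a r n₁ n₂ n₃ X ρ N₁ N₂ N₃
      ∉ escapingCone M a ![t, r * n₁, r * n₂, r * n₃]) :
    let p := ![t, r * n₁, r * n₂, r * n₃]
    let v := tetradVector M a r n₁ n₂ n₃ X ρ N₁ N₂ N₃
    v ∈ closure (nullCone M a p ∩ fallingCone M a p) ∧
      v ∈ closure (nullCone M a p ∩ escapingCone M a p) := by
  intro p v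
  have hr := h.radius_pos ha haM
  have hrp := rPlus_pos ha haM
  have hX := h.future
  have hS : 0 < r ^ 2 + a ^ 2 * n₃ ^ 2 := by positivity
  have hP : ∀ s, rPlus M a ≤ s → 0 < X * (s ^ 2 + a ^ 2 * n₃ ^ 2) / (r ^ 2 + a ^ 2 * n₃ ^ 2) := by
    intro s hs
    have hs0 : 0 < s := hrp.trans_le hs
    positivity
  have hD := delta_pos ha haM h.exterior
  have hκ : 0 < κ := by
    refine h.norm_nonneg.lt_of_ne fun h0 => ?_
    subst h0
    -- a principal null vector
    have hgap : ∀ s, rPlus M a ≤ s → 0 < tetradGap M a r n₃ X (n₁ * N₂ - n₂ * N₁) 0 s := by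
      intro s hs
      have := tetradGap_shrink (M := M) (a := a) (n₃ := n₃) (X := X) (W := 0) (κ := 0) (μ := 1)
        (s := s) hr
      rw [h.axial_eq_zero]
      simp only [sub_self, zero_mul, one_mul, zero_add] at this
      rw [this]
      exact hP s hs
    rcases lt_trichotomy ρ 0 with hρ | hρ | hρ
    · exact hf (h.mem_fallingCone_of_gap_pos ha haM hρ fun s h1 _ => hgap s h1)
    · have := h.null
      rw [hρ] at this
      nlinarith
    · exact he (h.mem_escapingCone_of_gap_pos ha haM hρ fun s h1 =>
        hgap s (h.exterior.le.trans h1))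
  have hgap : ∀ s, rPlus M a ≤ s → 0 ≤ tetradGap M a r n₃ X (n₁ * N₂ - n₂ * N₁) κ s := by
    intro s hs
    by_contra hneg
    rw [not_le] at hneg
    rcases lt_trichotomy s r with hsr | rfl | hsr
    · exact he (h.mem_escapingCone_of_barrier ha haM hκ hsr hs hneg)
    · exact hneg.not_ge (h.gap_self_nonneg ha haM)
    · exact hf (h.mem_fallingCone_of_barrier ha haM hκ hsr hneg)
  have hW : ∀ μ : ℝ, n₁ * ((1 - μ) * N₂) - n₂ * ((1 - μ) * N₁) = (1 - μ) * (n₁ * N₂ - n₂ * N₁) :=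
    fun μ => by ring
  have hshrink : ∀ᶠ μ in 𝓝[>] (0 : ℝ), μ < 1 ∧ 0 < X ^ 2 - delta M a r * ((1 - μ) * κ) ^ 2 ∧
      ∀ s, rPlus M a ≤ s →
        0 < tetradGap M a r n₃ X (n₁ * ((1 - μ) * N₂) - n₂ * ((1 - μ) * N₁)) ((1 - μ) * κ) s := by
    filter_upwards [Ioo_mem_nhdsGT (zero_lt_one' ℝ)] with μ hμ
    refine ⟨hμ.2, ?_, fun s hs => ?_⟩
    · have h1 : 0 < delta M a r * κ ^ 2 := by positivity
      have h2 : 0 < delta M a r * κ ^ 2 * (μ * (2 - μ)) :=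
        mul_pos h1 (mul_pos hμ.1 (by linarith [hμ.2]))
      nlinarith [h.null, sq_nonneg ρ]
    · rw [hW, tetradGap_shrink hr]
      have h1 := mul_nonneg (sub_nonneg.2 hμ.2.le) (hgap s hs)
      have h2 := mul_pos hμ.1 (hP s hs)
      linarith
  -- enlarging the angular part, `μ < 0`, turns a zero of the gap into a barrier
  have henlarge : ρ ≠ 0 → ∀ s, rPlus M a ≤ s →
      tetradGap M a r n₃ X (n₁ * N₂ - n₂ * N₁) κ s ≤ 0 →
      ∀ᶠ μ in 𝓝[<] (0 : ℝ), μ < 0 ∧ 0 < X ^ 2 - delta M a r * ((1 - μ) * κ) ^ 2 ∧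
        tetradGap M a r n₃ X (n₁ * ((1 - μ) * N₂) - n₂ * ((1 - μ) * N₁)) ((1 - μ) * κ) s < 0 := by
    intro hρ s hs hG
    have hc : Continuous fun μ : ℝ => X ^ 2 - delta M a r * ((1 - μ) * κ) ^ 2 := by fun_prop
    have hev := (hc.tendsto 0).eventually_const_lt (u := 0) (by
      rw [sub_zero, one_mul, ← h.null]; positivity)
    filter_upwards [self_mem_nhdsWithin, hev.filter_mono nhdsWithin_le_nhds] with μ hμ hpos
    refine ⟨hμ, hpos, ?_⟩
    rw [mem_Iio] at hμ
    rw [hW, tetradGap_shrink hr]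
    have h1 : (1 - μ) * tetradGap M a r n₃ X (n₁ * N₂ - n₂ * N₁) κ s ≤ 0 :=
      mul_nonpos_of_nonneg_of_nonpos (by linarith) hG
    have h2 := mul_neg_of_neg_of_pos hμ (hP s hs)
    linarith
  have hfalls : ρ ≤ 0 → v ∈ closure (nullCone M a p ∩ fallingCone M a p) := by
    intro hρ
    refine h.mem_closure_of_shrink ha haM (ς := -1) (by rw [abs_of_nonpos hρ]; ring) _
      (F := 𝓝[>] 0) nhdsWithin_le_nhds ?_
    filter_upwards [hshrink] with μ ⟨h1, h2, h3⟩
    have h' := h.shrink h1.le (by norm_num : (-1 : ℝ) ^ 2 = 1) h2.le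
    refine ⟨h'.mem_nullCone ha haM, h'.mem_fallingCone_of_gap_pos ha haM ?_ fun s hs _ => h3 s hs⟩
    have := Real.sqrt_pos.2 h2
    linarith
  have hescapes : 0 ≤ ρ → v ∈ closure (nullCone M a p ∩ escapingCone M a p) := by
    intro hρ
    refine h.mem_closure_of_shrink ha haM (ς := 1) (by rw [abs_of_nonneg hρ]; ring) _
      (F := 𝓝[>] 0) nhdsWithin_le_nhds ?_
    filter_upwards [hshrink] with μ ⟨h1, h2, h3⟩
    have h' := h.shrink h1.le (by norm_num : (1 : ℝ) ^ 2 = 1) h2.le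
    refine ⟨h'.mem_nullCone ha haM, h'.mem_escapingCone_of_gap_pos ha haM ?_ fun s hs =>
      h3 s (h.exterior.le.trans hs)⟩
    have := Real.sqrt_pos.2 h2
    linarith
  refine ⟨(le_or_gt ρ 0).elim hfalls fun hρ => ?_, (le_or_gt 0 ρ).elim hescapes fun hρ => ?_⟩
  · obtain ⟨s, hrs, hs⟩ : ∃ s, r ≤ s ∧ tetradGap M a r n₃ X (n₁ * N₂ - n₂ * N₁) κ s ≤ 0 := by
      by_contra! hc
      exact he (h.mem_escapingCone_of_gap_pos ha haM hρ hc)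
    have hrs' : r < s := hrs.lt_of_ne fun hrs' => by
      rw [← hrs', tetradGap_self hr] at hs
      have h1 := Real.sq_sqrt hD.le
      have h2 := h.gap_self_nonneg (W := 0) ha haM
      rw [tetradGap_self hr] at h2
      have h3 : X = κ * √(delta M a r) := by linarith
      have := h.null
      rw [h3, mul_pow, h1] at this
      nlinarith
    refine h.mem_closure_of_shrink ha haM (ς := 1) (by rw [abs_of_pos hρ]; ring) _
      (F := 𝓝[<] 0) nhdsWithin_le_nhds ?_
    filter_upwards [henlarge hρ.ne' s (h.exterior.le.trans hrs) hs] with μ ⟨h1, h2, h3⟩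
    have h' := h.shrink (by linarith : μ ≤ 1) (by norm_num : (1 : ℝ) ^ 2 = 1) h2.le
    exact ⟨h'.mem_nullCone ha haM,
      h'.mem_fallingCone_of_barrier ha haM (mul_pos (by linarith) hκ) hrs' h3⟩
  · obtain ⟨s, hs', hrs, hs⟩ : ∃ s, rPlus M a ≤ s ∧ s ≤ r ∧
        tetradGap M a r n₃ X (n₁ * N₂ - n₂ * N₁) κ s ≤ 0 := by
      by_contra! hc
      exact hf (h.mem_fallingCone_of_gap_pos ha haM hρ hc)
    have hrs' : s < r := hrs.lt_of_ne fun hrs' => by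
      rw [hrs', tetradGap_self hr] at hs
      have h1 := Real.sq_sqrt hD.le
      have h2 := h.gap_self_nonneg (W := 0) ha haM
      rw [tetradGap_self hr] at h2
      have h3 : X = κ * √(delta M a r) := by linarith
      have := h.null
      rw [h3, mul_pow, h1] at this
      nlinarith
    refine h.mem_closure_of_shrink ha haM (ς := -1) (by rw [abs_of_neg hρ]; ring) _
      (F := 𝓝[<] 0) nhdsWithin_le_nhds ?_
    filter_upwards [henlarge hρ.ne s hs' hs] with μ ⟨h1, h2, h3⟩
    have h' := h.shrink (by linarith : μ ≤ 1) (by norm_num : (-1 : ℝ) ^ 2 = 1) h2.le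
    exact ⟨h'.mem_nullCone ha haM,
      h'.mem_escapingCone_of_barrier ha haM (mul_pos (by linarith) hκ) hrs' hs' h3⟩

end IsNullData

end

/-! ### Observers and their celestial spheres -/

/-- The metric at `q` as a bilinear form. -/
noncomputable def metricForm (M a : ℝ) (q : Fin 4 → ℝ) :
    (Fin 4 → ℝ) →ₗ[ℝ] (Fin 4 → ℝ) →ₗ[ℝ] ℝ :=
  LinearMap.mk₂ ℝ (metric M a q)
    (fun u v w => by simp only [metric, dr, sinSqDphi, Pi.add_apply]; ring)
    (fun c v w => by simp only [metric, dr, sinSqDphi, Pi.smul_apply, smul_eq_mul]; ring)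
    (fun u v w => by simp only [metric, dr, sinSqDphi, Pi.add_apply]; ring)
    (fun c v w => by simp only [metric, dr, sinSqDphi, Pi.smul_apply, smul_eq_mul]; ring)

theorem metricForm_apply (M a : ℝ) (q v w : Fin 4 → ℝ) : metricForm M a q v w = metric M a q v w :=
  rfl

theorem metric_comm (M a : ℝ) (q v w : Fin 4 → ℝ) : metric M a q v w = metric M a q w v := by
  simp only [metric]; ring

section

variable {M a : ℝ} {p : Fin 4 → ℝ} {e : Fin 4 → Fin 4 → ℝ}


theorem IsObserver.expand (he : IsObserver M a p e) (v : Fin 4 → ℝ) :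
    v = -metric M a p v (e 0) • e 0 + ∑ i : Fin 3, metric M a p v (e i.succ) • e i.succ := by
  have hpair : ∀ (c : Fin 4 → ℝ) (j : Fin 4), metric M a p (∑ i, c i • e i) (e j)
      = c j * if j = 0 then -1 else 1 := by
    intro c j
    rw [← metricForm_apply, map_sum, LinearMap.sum_apply]
    simp [metricForm_apply, he.orthonormal]
  have hli : LinearIndependent ℝ e := by
    rw [Fintype.linearIndependent_iff]
    intro c hc j
    have h1 := hpair c j
    rw [hc, ← metricForm_apply, map_zero, LinearMap.zero_apply] at h1
    split_ifs at h1 <;> linarith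
  have hspan := hli.span_eq_top_of_card_eq_finrank (by simp)
  obtain ⟨c, hc⟩ := (Submodule.mem_span_range_iff_exists_fun ℝ).1
    (hspan ▸ Submodule.mem_top : v ∈ Submodule.span ℝ (range e))
  have hc' : ∀ j, metric M a p v (e j) = c j * if j = 0 then -1 else 1 := fun j => by
    rw [← hpair, hc]
  conv_lhs => rw [← hc, Fin.sum_univ_succ]
  simp [hc']

theorem IsObserver.metric_eq (he : IsObserver M a p e) (v w : Fin 4 → ℝ) :
    metric M a p v w = -(metric M a p v (e 0) * metric M a p w (e 0))
      + ∑ i : Fin 3, metric M a p v (e i.succ) * metric M a p w (e i.succ) := by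
  conv_lhs => rw [he.expand w]
  rw [← metricForm_apply, map_add, map_sum]
  simp only [map_smul, metricForm_apply, smul_eq_mul]
  rw [neg_mul, mul_comm]
  simp only [mul_comm]

theorem IsObserver.metric_nullVector_zero (he : IsObserver M a p e) (k : CelestialSphere) :
    metric M a p (nullVector e k) (e 0) = -1 := by
  rw [nullVector, ← metricForm_apply, map_add, map_sum, LinearMap.add_apply, LinearMap.sum_apply]
  simp [metricForm_apply, he.orthonormal]

theorem IsObserver.metric_nullVector_succ (he : IsObserver M a p e) (k : CelestialSphere)
    (i : Fin 3) : metric M a p (nullVector e k) (e i.succ) = k.1 i := by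
  rw [nullVector, ← metricForm_apply, map_add, map_sum, LinearMap.add_apply, LinearMap.sum_apply]
  simp [metricForm_apply, he.orthonormal, Fin.succ_ne_zero, (Fin.succ_ne_zero _).symm]

theorem sum_sq_celestialSphere (k : CelestialSphere) : ∑ i : Fin 3, k.1 i ^ 2 = 1 := by
  have h := k.2
  rw [mem_sphere_zero_iff_norm, EuclideanSpace.norm_eq, Real.sqrt_eq_one] at h
  simpa using h

theorem IsObserver.nullVector_mem_nullCone (he : IsObserver M a p e) (k : CelestialSphere) :
    nullVector e k ∈ nullCone M a p := by
  rw [nullCone, mem_ofPred_eq, he.metric_eq]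
  simp only [he.metric_nullVector_zero, he.metric_nullVector_succ, ← sq, sum_sq_celestialSphere]
  norm_num

/-- A future directed null vector has a negative product with a timelike vector field defining the
time orientation. -/
theorem IsObserver.metric_nullVector_neg (he : IsObserver M a p e) {T : Fin 4 → ℝ}
    (hT : metric M a p T T < 0) (hT0 : metric M a p (e 0) T < 0) (k : CelestialSphere) :
    metric M a p (nullVector e k) T < 0 := by
  have hk := sum_sq_celestialSphere k
  have hcs := Finset.sum_mul_sq_le_sq_mul_sq Finset.univ (fun i => k.1 i)
    fun i : Fin 3 => metric M a p T (e i.succ)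
  rw [hk, one_mul] at hcs
  rw [he.metric_eq] at hT ⊢
  rw [metric_comm] at hT0
  simp only [he.metric_nullVector_zero, he.metric_nullVector_succ, ← sq] at hT ⊢
  have := abs_lt_of_sq_lt_sq' (a := ∑ i : Fin 3, k.1 i * metric M a p T (e i.succ))
    (b := -metric M a p T (e 0)) (by rw [neg_sq]; linarith) (by linarith)
  linarith [this.2]

/-- A direction whose null vector is a limit of null vectors in a set `A` is a limit of directions
whose null vectors are positive multiples of elements of `A`. -/
theorem IsObserver.exists_mem_ball (he : IsObserver M a p e) {k : CelestialSphere}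
    {A : Set (Fin 4 → ℝ)} (hk : nullVector e k ∈ closure (nullCone M a p ∩ A)) {ε : ℝ}
    (hε : 0 < ε) :
    ∃ k' ∈ Metric.ball k ε, ∃ c : ℝ, 0 < c ∧ ∃ v ∈ A, nullVector e k' = c • v := by
  have hcont : ∀ i, Continuous fun v => metric M a p v (e i) := fun i =>
    ((metricForm M a p).flip (e i)).continuous_of_finiteDimensional
  set f : (Fin 4 → ℝ) → EuclideanSpace ℝ (Fin 3) := fun v =>
    WithLp.toLp 2 fun i => metric M a p v (e i.succ) / -metric M a p v (e 0) with hf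
  have hfk : f (nullVector e k) = k.1 := by
    ext i
    simp [hf, he.metric_nullVector_zero, he.metric_nullVector_succ]
  have hfc : ContinuousAt f (nullVector e k) := by
    refine (PiLp.continuous_toLp 2 _).continuousAt.comp (continuousAt_pi.2 fun i => ?_)
    refine (hcont i.succ).continuousAt.div (hcont 0).neg.continuousAt ?_
    rw [he.metric_nullVector_zero]; norm_num
  have hnear : ∀ᶠ v in 𝓝 (nullVector e k), metric M a p v (e 0) < 0 ∧ dist (f v) k.1 < ε := by
    refine ((hcont 0).continuousAt.eventually_lt_const ?_).and ?_
    · simp only [he.metric_nullVector_zero]; norm_num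
    · have := hfc.eventually (Metric.ball_mem_nhds _ hε)
      rwa [hfk] at this
  obtain ⟨v, ⟨hv0, hvd⟩, hvn, hvA⟩ := mem_closure_iff_nhds.1 hk _ hnear
  have hsum : ∑ i : Fin 3, metric M a p v (e i.succ) ^ 2 = metric M a p v (e 0) ^ 2 := by
    rw [nullCone, mem_ofPred_eq, he.metric_eq] at hvn
    simp only [← sq] at hvn
    linarith
  have hsphere : f v ∈ Metric.sphere (0 : EuclideanSpace ℝ (Fin 3)) 1 := by
    rw [mem_sphere_zero_iff_norm, EuclideanSpace.norm_eq, Real.sqrt_eq_one]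
    simp only [hf, Real.norm_eq_abs, sq_abs, div_pow, ← Finset.sum_div, hsum, neg_sq]
    exact div_self (pow_ne_zero 2 hv0.ne)
  refine ⟨⟨f v, hsphere⟩, hvd, 1 / -metric M a p v (e 0), by
    have : 0 < -metric M a p v (e 0) := by linarith
    positivity, v, hvA, ?_⟩
  have hne : -metric M a p v (e 0) ≠ 0 := by linarith
  conv_rhs => arg 2; rw [he.expand v]
  rw [smul_add, smul_smul, one_div, inv_mul_cancel₀ hne, one_smul, Finset.smul_sum, nullVector]
  congr 1
  refine Finset.sum_congr rfl fun i _ => ?_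
  rw [smul_smul]
  congr 1
  exact div_eq_inv_mul _ _

theorem metric_timeDirection_neg (ha : 0 ≤ a) (haM : a < M) {t r n₁ n₂ n₃ : ℝ}
    (hr : rPlus M a < r) (hn : n₁ ^ 2 + n₂ ^ 2 + n₃ ^ 2 = 1) :
    metric M a ![t, r * n₁, r * n₂, r * n₃] (timeDirection a ![t, r * n₁, r * n₂, r * n₃])
      (timeDirection a ![t, r * n₁, r * n₂, r * n₃]) < 0 := by
  have hr0 := (rPlus_pos ha haM).trans hr
  have hD := delta_pos ha haM hr
  have hS : 0 < r ^ 2 + a ^ 2 * n₃ ^ 2 := by positivity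
  have hT : timeDirection a ![t, r * n₁, r * n₂, r * n₃]
      = tetradVector M a r n₁ n₂ n₃ (delta M a r * (r ^ 2 + a ^ 2 * n₃ ^ 2)) 0 0 0 0 := by
    rw [tetradVector_eq hr0, timeDirection, radius_polar hr0 hn]
    ext i
    fin_cases i <;> simp <;> field_simp
  conv_lhs => arg 4; rw [hT]
  rw [metric_tetradVector_timeDirection hr0 hD.ne' hn (by ring)]
  have := mul_pos hD hS
  linarith

end

end Kerr

theorem mainTheorem2 (M a : ℝ) (ha : 0 ≤ a) (haM : a < M)
    (p : Fin 4 → ℝ) (hp : p ∈ Kerr.exterior M a)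
    (e : Fin 4 → Fin 4 → ℝ) (he : Kerr.IsObserver M a p e)
    (k : Kerr.CelestialSphere) (hk : k ∈ Kerr.futureTrapped M a p e)
    (ε : ℝ) (hε : 0 < ε) :
    (Metric.ball k ε ∩ Kerr.futureInfalling M a p e).Nonempty ∧
      (Metric.ball k ε ∩ Kerr.futureEscaping M a p e).Nonempty := by
  have hr : Kerr.rPlus M a < Kerr.radius p := hp
  have hr0 := (Kerr.rPlus_pos ha haM).trans hr
  have hD := Kerr.delta_pos ha haM hr
  have hsq : Kerr.radius p ^ 2 = p 1 ^ 2 + p 2 ^ 2 + p 3 ^ 2 := Real.sq_sqrt (by positivity)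
  obtain ⟨n₁, h1⟩ : ∃ n₁, p 1 = Kerr.radius p * n₁ := ⟨p 1 / Kerr.radius p, by field_simp⟩
  obtain ⟨n₂, h2⟩ : ∃ n₂, p 2 = Kerr.radius p * n₂ := ⟨p 2 / Kerr.radius p, by field_simp⟩
  obtain ⟨n₃, h3⟩ : ∃ n₃, p 3 = Kerr.radius p * n₃ := ⟨p 3 / Kerr.radius p, by field_simp⟩
  generalize Kerr.radius p = r at *
  have hn : n₁ ^ 2 + n₂ ^ 2 + n₃ ^ 2 = 1 := by
    have : r ^ 2 * (n₁ ^ 2 + n₂ ^ 2 + n₃ ^ 2) = r ^ 2 * 1 := by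
      rw [h1, h2, h3] at hsq; linarith
    exact mul_left_cancel₀ (by positivity) this
  obtain ⟨t, rfl⟩ : ∃ t, p = ![t, r * n₁, r * n₂, r * n₃] :=
    ⟨p 0, by ext i; fin_cases i <;> simp [h1, h2, h3]⟩
  obtain ⟨X, ρ, N₁, N₂, N₃, hN, hv⟩ := Kerr.exists_eq_tetradVector hr0 hD.ne' hn
    (Kerr.nullVector e k)
  have hX := he.metric_nullVector_neg (Kerr.metric_timeDirection_neg ha haM hr hn) he.future k
  rw [hv, Kerr.metric_tetradVector_timeDirection hr0 hD.ne' hn hN] at hX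
  have hnull := he.nullVector_mem_nullCone k
  rw [Kerr.nullCone, Set.mem_ofPred_eq, hv, Kerr.metric_tetradVector_self hr0 hD.ne' hn hN,
    div_eq_zero_iff, or_iff_left (by positivity)] at hnull
  have hK : 0 ≤ N₁ ^ 2 + N₂ ^ 2 + N₃ ^ 2 := by positivity
  have hdata : Kerr.IsNullData M a r n₁ n₂ n₃ X ρ N₁ N₂ N₃ √(N₁ ^ 2 + N₂ ^ 2 + N₃ ^ 2) :=
    ⟨hn, hN, (Real.sq_sqrt hK).symm, Real.sqrt_nonneg _, hr, by linarith, by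
      rw [Real.sq_sqrt hK]; linarith⟩
  have hf : Kerr.nullVector e k ∉ Kerr.fallingCone M a ![t, r * n₁, r * n₂, r * n₃] := fun h => by
    obtain ⟨γ, J, g1, g2, g3, g4, g5⟩ := h 1 one_pos
    exact hk γ J ⟨g1, g2, g3, by rw [g4, one_smul]⟩ (Or.inl g5)
  have hesc : Kerr.nullVector e k ∉ Kerr.escapingCone M a ![t, r * n₁, r * n₂, r * n₃] :=
      fun h => by
    obtain ⟨γ, J, g1, g2, g3, g4, g5⟩ := h 1 one_pos
    exact hk γ J ⟨g1, g2, g3, by rw [g4, one_smul]⟩ (Or.inr g5)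
  rw [hv] at hf hesc
  obtain ⟨hcf, hce⟩ := hdata.mem_closure_cones ha haM hf hesc
  rw [← hv] at hcf hce
  constructor
  · obtain ⟨k', hk', c, hc, v, hvA, hkv⟩ := he.exists_mem_ball hcf hε
    obtain ⟨γ, J, g1, g2, g3, g4, g5⟩ := hvA c hc
    exact ⟨k', hk', γ, J, ⟨g1, g2, g3, by rw [g4, hkv]⟩, g5⟩
  · obtain ⟨k', hk', c, hc, v, hvA, hkv⟩ := he.exists_mem_ball hce hε
    obtain ⟨γ, J, g1, g2, g3, g4, g5⟩ := hvA c hc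
    exact ⟨k', hk', γ, J, ⟨g1, g2, g3, by rw [g4, hkv]⟩, g5⟩
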